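/- **Conventions.** Let $\mathbb A$ be a Cauchy complete category (every idempotent splits) and $H:\mathbb A\to\mathbb A$ a functor; $1$ also denotes an identity transformation. Composition $g\cdot f$ means first $f$, then $g$. For $\varphi:F\to F'$ write $(\varphi H)_X=\varphi_{HX}$, $(H\varphi)_X=H(\varphi_X)$, and juxtapose natural transformations for horizontal composition. A *weak Yang–Baxter pair* on $H$ is a pair $\tau,\tau':HH\to HH$ with $\tau\tau'\tau=\tau$, $\tau'\tau\tau'=\tau'$, $\tau\tau'=\tau'\tau=:\nabla$ (products being composites), such that for $t=\tau$ and $t=\tau'$: $Ht\cdot tH\cdot Ht=tH\cdot Ht\cdot tH$, $\;tH\cdot H\nabla=H\nabla\cdot tH$, $\;Ht\cdot\nabla H=\nabla H\cdot Ht$. A *weak braided bimonad* $\mathbf H$ on $\mathbb A$ consists of a monad $\underline{\mathbf H}=(H,m,e)$, a comonad $\overline{\mathbf H}=(H,\delta,\varepsilon)$ and a weak Yang–Baxter pair $\tau,\tau'$ on $H$ such that 1. $m\cdot\nabla=m$, $\nabla\cdot\delta=\delta$; 2. $\nabla\cdot He=\tau\cdot eH$, $H\varepsilon\cdot\nabla=\varepsilon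 H\cdot\tau$, $\nabla\cdot eH=\tau\cdot He$, $\varepsilon H\cdot\nabla=H\varepsilon\cdot\tau$; 3. $\delta H\cdot\tau=H\tau\cdot\tau H\cdot H\delta$, $\tau\cdot mH=Hm\cdot\tau H\cdot H\tau$; 4. $H\delta\cdot\tau=\tau H\cdot H\tau\cdot\delta H$, $\tau\cdot Hm=mH\cdot H\tau\cdot\tau H$; 5. $\delta\cdot m=mm\cdot H\tau H\cdot\delta\delta$; 6. $\varepsilon\varepsilon\cdot mm\cdot H\delta H=\varepsilon\cdot m\cdot mH=\varepsilon\varepsilon\cdot mm\cdot H\tau'H\cdot H\delta H$; 7. $HmH\cdot\delta\delta\cdot ee=\delta H\cdot\delta\cdot e=HmH\cdot H\tau'H\cdot\delta\delta\cdot ee$. Put $\omega=mH\cdot H\tau\cdot\delta H$, $\;\overline\omega=Hm\cdot\tau H\cdot H\delta$, $\;\sigma=Hm\cdot\delta H$, $\;\overline\sigma=mH\cdot H\delta$, $\;\xi=\varepsilon H\cdot\omega\cdot eH$, $\;\overline\xi=H\varepsilon\cdot\overline\omega\cdot He$, and $\varphi*\psi=m\cdot\varphi\psi\cdot\delta$ for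 $\varphi,\psi:H\to H$. $\mathbf H$ is a *weak braided Hopf monad* if there is $S:H\to H$ with $1*S=\xi$, $S*1=\overline\xi$, $S*1*S=S$. *Mixed bimodules.* $\mathbb A_{\underline{\mathbf H}}^{\overline{\mathbf H}}(\omega)$ is the category of triples $(a,h,\theta)$ with $(a,h)$ an $\underline{\mathbf H}$-module, $(a,\theta)$ an $\overline{\mathbf H}$-comodule and $\theta\cdot h=H(h)\cdot\omega_a\cdot H(\theta)$; morphisms are the morphisms of $\mathbb A$ that are module and comodule morphisms. The functor $K_\omega:\mathbb A\to\mathbb A_{\underline{\mathbf H}}^{\overline{\mathbf H}}(\omega)$ is $X\mapsto(HX,m_X,\delta_X)$. *The base.* $\overline\xi$ is idempotent; let $H\xrightarrow{q}H^{\overline\xi}\xrightarrow{\iota}H$ be a splitting ($\iota q=\overline\xi$, $q\iota=1$). Then $\underline{\mathbf H}^{\overline\xi}=(H^{\overline\xi},\,q\cdot m\cdot\iota\iota,\,q\cdot e)$ is a monad and $\overline{\mathbf H}_{\overline\xi}=(H^{\overline\xi},\,qq\cdot\delta\cdot\iota,\,\varepsilon\cdot\iota)$ is a comonad. With $\rho_l=m\cdot\iota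 H$, $\rho_r=m\cdot H\iota$, $\theta_l=qH\cdot\delta$, $\theta_r=Hq\cdot\delta$, let $l:HH\to H\otimes_{\underline{\mathbf H}^{\overline\xi}}H$ denote a coequaliser of $\rho_rH,\,H\rho_l:HH^{\overline\xi}H\rightrightarrows HH$, and $\mathrm{can}:H\otimes^{\overline{\mathbf H}_{\overline\xi}}H\to HH$ an equaliser of $\theta_rH,\,H\theta_l:HH\rightrightarrows HH^{\overline\xi}H$, both in the category of endofunctors of $\mathbb A$. *The functors $\overline G$ and $\overline T$.* The morphisms $\Gamma_{(a,h)}=H(h)\cdot\omega_a\cdot e_{H(a)}$ are idempotents on $H(a)$, natural in $(a,h)\in\mathbb A_{\underline{\mathbf H}}$, and the morphisms $\Gamma'_{(a,\theta)}=\varepsilon_{H(a)}\cdot\omega_a\cdot H(\theta)$ are idempotents on $H(a)$, natural in $(a,\theta)\in\mathbb A^{\overline{\mathbf H}}$. Let $G:\mathbb A_{\underline{\mathbf H}}\to\mathbb A$ and $T:\mathbb A^{\overline{\mathbf H}}\to\mathbb A$ be functors through which they split, and let $\overline G$, $\overline T$ be the composites of $G$ with the free module functor and of $T$ with the cofree comodule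 functor, with the induced split epimorphism $\overline p:HH\to\overline G$ and split monomorphism $\overline i':\overline T\to HH$. Then $\sigma\cdot\rho_rH=\sigma\cdot H\rho_l$ and $\theta_rH\cdot\overline\sigma=H\theta_l\cdot\overline\sigma$, so there are unique $$\gamma:H\otimes_{\underline{\mathbf H}^{\overline\xi}}H\to\overline G,\quad \gamma\cdot l=\overline p\cdot\sigma,\qquad\qquad \gamma':\overline T\to H\otimes^{\overline{\mathbf H}_{\overline\xi}}H,\quad \mathrm{can}\cdot\gamma'=\overline\sigma\cdot\overline i'.$$ **Theorem.** Let $\mathbf H$ be a weak braided bimonad on a Cauchy complete category $\mathbb A$. The tensor product $H\otimes_{\underline{\mathbf H}^{\overline\xi}}H$ and the cotensor product $H\otimes^{\overline{\mathbf H}_{\overline\xi}}H$ exist, and: (1) If $H$ preserves all coequalisers that exist in $\mathbb A$, the following are equivalent: (a) $\mathbf H$ is a weak braided Hopf monad; (b) $K_\omega$ has a monadic right adjoint (one whose comparison functor to the modules over the monad of the adjunction is an equivalence); (c) $\gamma$ is an isomorphism. (2) If $H$ preserves all equalisers that exist in $\mathbb A$, the following are equivalent: (a) $\mathbf H$ is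 a weak braided Hopf monad; (b) $K_\omega$ has a comonadic left adjoint (one whose comparison functor to the comodules over the comonad of the adjunction is an equivalence); (c) $\gamma'$ is an isomorphism. Moreover, if $\mathbf H$ is a weak braided Hopf monad (hence whenever the equivalent conditions of (1) or of (2) hold), there is an equivalence of categories $\mathbb A_{\underline{\mathbf H}^{\overline\xi}}\simeq\mathbb A_{\underline{\mathbf H}}^{\overline{\mathbf H}}(\omega)$, where $\mathbb A_{\underline{\mathbf H}^{\overline\xi}}$ is the category of $\underline{\mathbf H}^{\overline\xi}$-modules. -/

import Mathlib

open CategoryTheory CategoryTheory.Limits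

universe v v' u u'

/-- A weak Yang-Baxter pair on an endofunctor `H`: natural transformations `τ, τ' : HH → HH`
with `τ·τ'·τ = τ`, `τ'·τ·τ' = τ'`, `τ·τ' = τ'·τ`, both satisfying the Yang-Baxter equation, and
such that both `τH`, `τ'H` commute with `H∇` and both `Hτ`, `Hτ'` commute with `∇H`, where
`∇ = τ·τ'` (that is, `τ' ≫ τ`).  Here and below `(τH)_X = τ.app (H.obj X)` and
`(Hτ)_X = H.map (τ.app X)`. -/
structure WeakYBPair {C : Type u} [Category.{v} C] {H : C ⥤ C} (τ τ' : H ⋙ H ⟶ H ⋙ H) :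
    Prop where
  regular : τ ≫ τ' ≫ τ = τ
  regular' : τ' ≫ τ ≫ τ' = τ'
  comm : τ' ≫ τ = τ ≫ τ'
  yangBaxter : ∀ X, H.map (τ.app X) ≫ τ.app (H.obj X) ≫ H.map (τ.app X) =
    τ.app (H.obj X) ≫ H.map (τ.app X) ≫ τ.app (H.obj X)
  yangBaxter' : ∀ X, H.map (τ'.app X) ≫ τ'.app (H.obj X) ≫ H.map (τ'.app X) =
    τ'.app (H.obj X) ≫ H.map (τ'.app X) ≫ τ'.app (H.obj X)
  tauH_Hnabla : ∀ X, H.map ((τ' ≫ τ).app X) ≫ τ.app (H.obj X) =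
    τ.app (H.obj X) ≫ H.map ((τ' ≫ τ).app X)
  Htau_nablaH : ∀ X, (τ' ≫ τ).app (H.obj X) ≫ H.map (τ.app X) =
    H.map (τ.app X) ≫ (τ' ≫ τ).app (H.obj X)
  tauH_Hnabla' : ∀ X, H.map ((τ' ≫ τ).app X) ≫ τ'.app (H.obj X) =
    τ'.app (H.obj X) ≫ H.map ((τ' ≫ τ).app X)
  Htau_nablaH' : ∀ X, (τ' ≫ τ).app (H.obj X) ≫ H.map (τ'.app X) =
    H.map (τ'.app X) ≫ (τ' ≫ τ).app (H.obj X)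

/-- A monad `(H, m, e)` and a comonad `(H, δ, ε)` on the same endofunctor `H`. -/
structure MonadComonad (C : Type u) [Category.{v} C] where
  H : C ⥤ C
  m : H ⋙ H ⟶ H
  e : 𝟭 C ⟶ H
  δ : H ⟶ H ⋙ H
  ε : H ⟶ 𝟭 C
  assoc : ∀ X, H.map (m.app X) ≫ m.app X = m.app (H.obj X) ≫ m.app X
  left_unit : ∀ X, e.app (H.obj X) ≫ m.app X = 𝟙 (H.obj X)
  right_unit : ∀ X, H.map (e.app X) ≫ m.app X = 𝟙 (H.obj X)
  coassoc : ∀ X, δ.app X ≫ H.map (δ.app X) = δ.app X ≫ δ.app (H.obj X)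
  left_counit : ∀ X, δ.app X ≫ ε.app (H.obj X) = 𝟙 (H.obj X)
  right_counit : ∀ X, δ.app X ≫ H.map (ε.app X) = 𝟙 (H.obj X)

/-- A weak braided bimonad: a monad and a comonad on `H` with a weak Yang-Baxter pair
`τ, τ' : HH → HH` such that, with `∇ = τ·τ'`,
* `m·∇ = m` and `∇·δ = δ`;
* `∇·He = τ·eH`, `Hε·∇ = εH·τ`, `∇·eH = τ·He`, `εH·∇ = Hε·τ`;
* `δH·τ = Hτ·τH·Hδ` and `τ·mH = Hm·τH·Hτ`;
* `Hδ·τ = τH·Hτ·δH` and `τ·Hm = mH·Hτ·τH`;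
* `δ·m = mm·HτH·δδ`;
* `εε·mm·HδH = ε·m·mH = εε·mm·Hτ'H·HδH`;
* `HmH·δδ·ee = δH·δ·e = HmH·Hτ'H·δδ·ee`.

Horizontal composites are written out, e.g. `(mm)_X` is `m.app (H (H X)) ≫ H.map (m.app X)`. -/
structure WeakBraidedBimonad (C : Type u) [Category.{v} C] extends MonadComonad C where
  τ : H ⋙ H ⟶ H ⋙ H
  τ' : H ⋙ H ⟶ H ⋙ H
  ybPair : WeakYBPair τ τ'
  nabla_m : ∀ X, (τ' ≫ τ).app X ≫ m.app X = m.app X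
  delta_nabla : ∀ X, δ.app X ≫ (τ' ≫ τ).app X = δ.app X
  He_nabla : ∀ X, H.map (e.app X) ≫ (τ' ≫ τ).app X = e.app (H.obj X) ≫ τ.app X
  nabla_Heps : ∀ X, (τ' ≫ τ).app X ≫ H.map (ε.app X) = τ.app X ≫ ε.app (H.obj X)
  eH_nabla : ∀ X, e.app (H.obj X) ≫ (τ' ≫ τ).app X = H.map (e.app X) ≫ τ.app X
  nabla_epsH : ∀ X, (τ' ≫ τ).app X ≫ ε.app (H.obj X) = τ.app X ≫ H.map (ε.app X)
  tau_deltaH : ∀ X, τ.app X ≫ δ.app (H.obj X) =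
    H.map (δ.app X) ≫ τ.app (H.obj X) ≫ H.map (τ.app X)
  mH_tau : ∀ X, m.app (H.obj X) ≫ τ.app X =
    H.map (τ.app X) ≫ τ.app (H.obj X) ≫ H.map (m.app X)
  tau_Hdelta : ∀ X, τ.app X ≫ H.map (δ.app X) =
    δ.app (H.obj X) ≫ H.map (τ.app X) ≫ τ.app (H.obj X)
  Hm_tau : ∀ X, H.map (m.app X) ≫ τ.app X =
    τ.app (H.obj X) ≫ H.map (τ.app X) ≫ m.app (H.obj X)
  m_delta : ∀ X, m.app X ≫ δ.app X =
    (H.map (δ.app X) ≫ δ.app (H.obj (H.obj X))) ≫ H.map (τ.app (H.obj X)) ≫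
      (m.app (H.obj (H.obj X)) ≫ H.map (m.app X))
  eps_mul : ∀ X,
    H.map (δ.app (H.obj X)) ≫ (m.app (H.obj (H.obj X)) ≫ H.map (m.app X)) ≫
      (ε.app (H.obj X) ≫ ε.app X) =
    m.app (H.obj X) ≫ m.app X ≫ ε.app X
  eps_mul' : ∀ X,
    H.map (δ.app (H.obj X)) ≫ H.map (τ'.app (H.obj X)) ≫
      (m.app (H.obj (H.obj X)) ≫ H.map (m.app X)) ≫ (ε.app (H.obj X) ≫ ε.app X) =
    m.app (H.obj X) ≫ m.app X ≫ ε.app X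
  unit_comul : ∀ X,
    (e.app X ≫ e.app (H.obj X)) ≫ (H.map (δ.app X) ≫ δ.app (H.obj (H.obj X))) ≫
      H.map (m.app (H.obj X)) =
    e.app X ≫ δ.app X ≫ δ.app (H.obj X)
  unit_comul' : ∀ X,
    (e.app X ≫ e.app (H.obj X)) ≫ (H.map (δ.app X) ≫ δ.app (H.obj (H.obj X))) ≫
      H.map (τ'.app (H.obj X)) ≫ H.map (m.app (H.obj X)) =
    e.app X ≫ δ.app X ≫ δ.app (H.obj X)

namespace WeakBraidedBimonad

variable {C : Type u} [Category.{v} C] (B : WeakBraidedBimonad C)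

/-! The components of the structure maps, typed by iterated applications of `B.H`. -/

/-- The component `m_X`. -/
def mu (X : C) : B.H.obj (B.H.obj X) ⟶ B.H.obj X := B.m.app X
/-- The component `e_X`. -/
def un (X : C) : X ⟶ B.H.obj X := B.e.app X
/-- The component `δ_X`. -/
def de (X : C) : B.H.obj X ⟶ B.H.obj (B.H.obj X) := B.δ.app X
/-- The component `ε_X`. -/
def co (X : C) : B.H.obj X ⟶ X := B.ε.app X
/-- The component `τ_X`. -/
def ta (X : C) : B.H.obj (B.H.obj X) ⟶ B.H.obj (B.H.obj X) := B.τ.app X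
/-- The component `τ'_X`. -/
def tb (X : C) : B.H.obj (B.H.obj X) ⟶ B.H.obj (B.H.obj X) := B.τ'.app X
/-- The component `∇_X = τ_X·τ'_X`. -/
def na (X : C) : B.H.obj (B.H.obj X) ⟶ B.H.obj (B.H.obj X) := B.tb X ≫ B.ta X

variable {X Y : C} (f : X ⟶ Y)

theorem mu_nat : B.H.map (B.H.map f) ≫ B.mu Y = B.mu X ≫ B.H.map f := B.m.naturality f
theorem un_nat : f ≫ B.un Y = B.un X ≫ B.H.map f := B.e.naturality f
theorem de_nat : B.H.map f ≫ B.de Y = B.de X ≫ B.H.map (B.H.map f) := B.δ.naturality f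
theorem co_nat : B.H.map f ≫ B.co Y = B.co X ≫ f := B.ε.naturality f
theorem ta_nat : B.H.map (B.H.map f) ≫ B.ta Y = B.ta X ≫ B.H.map (B.H.map f) :=
  B.τ.naturality f
theorem tb_nat : B.H.map (B.H.map f) ≫ B.tb Y = B.tb X ≫ B.H.map (B.H.map f) :=
  B.τ'.naturality f
theorem na_nat : B.H.map (B.H.map f) ≫ B.na Y = B.na X ≫ B.H.map (B.H.map f) := by
  simp only [na, Category.assoc, ← ta_nat]; rw [reassoc_of% (B.tb_nat f)]

variable (X)

theorem mu_assoc : B.H.map (B.mu X) ≫ B.mu X = B.mu (B.H.obj X) ≫ B.mu X := B.assoc X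
theorem un_mu : B.un (B.H.obj X) ≫ B.mu X = 𝟙 _ := B.left_unit X
theorem Hun_mu : B.H.map (B.un X) ≫ B.mu X = 𝟙 _ := B.right_unit X
theorem de_coassoc : B.de X ≫ B.H.map (B.de X) = B.de X ≫ B.de (B.H.obj X) := B.coassoc X
theorem de_co : B.de X ≫ B.co (B.H.obj X) = 𝟙 _ := B.left_counit X
theorem de_Hco : B.de X ≫ B.H.map (B.co X) = 𝟙 _ := B.right_counit X

theorem na_def : B.na X = B.tb X ≫ B.ta X := rfl

theorem na_eq : B.na X = B.ta X ≫ B.tb X :=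
  congrArg (fun t : B.H ⋙ B.H ⟶ B.H ⋙ B.H => t.app X) B.ybPair.comm

theorem ta_tb_ta : B.ta X ≫ B.tb X ≫ B.ta X = B.ta X :=
  congrArg (fun t : B.H ⋙ B.H ⟶ B.H ⋙ B.H => t.app X) B.ybPair.regular
theorem tb_ta_tb : B.tb X ≫ B.ta X ≫ B.tb X = B.tb X :=
  congrArg (fun t : B.H ⋙ B.H ⟶ B.H ⋙ B.H => t.app X) B.ybPair.regular'
theorem ta_na : B.ta X ≫ B.na X = B.ta X := B.ta_tb_ta X
theorem na_ta : B.na X ≫ B.ta X = B.ta X := by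
  rw [na_eq, Category.assoc, ta_tb_ta]
theorem na_tb : B.na X ≫ B.tb X = B.tb X := by
  rw [na, Category.assoc, tb_ta_tb]
theorem tb_na : B.tb X ≫ B.na X = B.tb X := by
  rw [na_eq, tb_ta_tb]

theorem Hna_ta : B.H.map (B.na X) ≫ B.ta (B.H.obj X) = B.ta (B.H.obj X) ≫ B.H.map (B.na X) :=
  B.ybPair.tauH_Hnabla X
theorem na_Hta : B.na (B.H.obj X) ≫ B.H.map (B.ta X) = B.H.map (B.ta X) ≫ B.na (B.H.obj X) :=
  B.ybPair.Htau_nablaH X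

theorem na_mu : B.na X ≫ B.mu X = B.mu X := B.nabla_m X
theorem de_na : B.de X ≫ B.na X = B.de X := B.delta_nabla X
theorem un_na : B.un (B.H.obj X) ≫ B.na X = B.H.map (B.un X) ≫ B.ta X := B.eH_nabla X
theorem na_co : B.na X ≫ B.co (B.H.obj X) = B.ta X ≫ B.H.map (B.co X) := B.nabla_epsH X
theorem ta_de : B.ta X ≫ B.de (B.H.obj X) =
    B.H.map (B.de X) ≫ B.ta (B.H.obj X) ≫ B.H.map (B.ta X) := B.tau_deltaH X
theorem mu_ta : B.mu (B.H.obj X) ≫ B.ta X =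
    B.H.map (B.ta X) ≫ B.ta (B.H.obj X) ≫ B.H.map (B.mu X) := B.mH_tau X
theorem ta_Hde : B.ta X ≫ B.H.map (B.de X) =
    B.de (B.H.obj X) ≫ B.H.map (B.ta X) ≫ B.ta (B.H.obj X) := B.tau_Hdelta X
theorem Hmu_ta : B.H.map (B.mu X) ≫ B.ta X =
    B.ta (B.H.obj X) ≫ B.H.map (B.ta X) ≫ B.mu (B.H.obj X) := B.Hm_tau X
theorem mu_de : B.mu X ≫ B.de X =
    B.H.map (B.de X) ≫ B.de (B.H.obj (B.H.obj X)) ≫ B.H.map (B.ta (B.H.obj X)) ≫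
      B.mu (B.H.obj (B.H.obj X)) ≫ B.H.map (B.mu X) := by
  simpa only [Category.assoc] using! B.m_delta X
theorem co_mul : B.mu (B.H.obj X) ≫ B.mu X ≫ B.co X =
    B.H.map (B.de (B.H.obj X)) ≫ B.mu (B.H.obj (B.H.obj X)) ≫ B.H.map (B.mu X) ≫
      B.co (B.H.obj X) ≫ B.co X := by
  simpa only [Category.assoc] using! (B.eps_mul X).symm
theorem co_mul' : B.mu (B.H.obj X) ≫ B.mu X ≫ B.co X =
    B.H.map (B.de (B.H.obj X)) ≫ B.H.map (B.tb (B.H.obj X)) ≫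
      B.mu (B.H.obj (B.H.obj X)) ≫ B.H.map (B.mu X) ≫
      B.co (B.H.obj X) ≫ B.co X := by
  simpa only [Category.assoc] using! (B.eps_mul' X).symm
theorem un_com : B.un X ≫ B.de X ≫ B.de (B.H.obj X) =
    B.un X ≫ B.un (B.H.obj X) ≫ B.H.map (B.de X) ≫ B.de (B.H.obj (B.H.obj X)) ≫
      B.H.map (B.mu (B.H.obj X)) := by
  simpa only [Category.assoc] using! (B.unit_comul X).symm
theorem un_com' : B.un X ≫ B.de X ≫ B.de (B.H.obj X) =
    B.un X ≫ B.un (B.H.obj X) ≫ B.H.map (B.de X) ≫ B.de (B.H.obj (B.H.obj X)) ≫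
      B.H.map (B.tb (B.H.obj X)) ≫ B.H.map (B.mu (B.H.obj X)) := by
  simpa only [Category.assoc] using! (B.unit_comul' X).symm

/-! ### Consequences of the axioms -/

theorem Hde_ta : B.H.map (B.de X) ≫ B.ta (B.H.obj X) =
    B.ta X ≫ B.de (B.H.obj X) ≫ B.H.map (B.tb X) := by
  rw [reassoc_of% (B.ta_de X), ← B.H.map_comp, ← na_eq, ← Hna_ta, ← B.H.map_comp_assoc, de_na]

theorem de_Hta : B.de (B.H.obj X) ≫ B.H.map (B.ta X) =
    B.ta X ≫ B.H.map (B.de X) ≫ B.tb (B.H.obj X) := by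
  rw [reassoc_of% (B.ta_Hde X), ← na_eq, ← na_Hta, reassoc_of% (B.de_na (B.H.obj X))]

theorem ta_Hmu : B.ta (B.H.obj X) ≫ B.H.map (B.mu X) =
    B.H.map (B.tb X) ≫ B.mu (B.H.obj X) ≫ B.ta X := by
  rw [B.mu_ta X, ← B.H.map_comp_assoc, ← na, reassoc_of% (B.Hna_ta X), ← B.H.map_comp, na_mu]

theorem Hta_mu : B.H.map (B.ta X) ≫ B.mu (B.H.obj X) =
    B.tb (B.H.obj X) ≫ B.H.map (B.mu X) ≫ B.ta X := by
  rw [B.Hmu_ta X]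
  have h := reassoc_of% (B.na_Hta X)
  rw [na] at h
  simp only [Category.assoc] at h
  rw [h, ← Category.assoc (B.tb _), ← na, na_mu]

theorem na_de : B.na X ≫ B.de (B.H.obj X) = B.de (B.H.obj X) ≫ B.H.map (B.na X) := by
  have h1 : B.na X ≫ B.de (B.H.obj X) ≫ B.H.map (B.na X) = B.na X ≫ B.de (B.H.obj X) := by
    rw [na, Category.assoc, reassoc_of% (B.ta_de X), ← B.H.map_comp, ← na, ta_na, ← B.ta_de X,
      ← Category.assoc, ← na_def]
  have h2 : B.na X ≫ B.de (B.H.obj X) ≫ B.H.map (B.na X) =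
      B.de (B.H.obj X) ≫ B.H.map (B.na X) := by
    rw [B.na_eq X, B.H.map_comp, reassoc_of% (B.de_Hta X), ← na_eq, reassoc_of% (B.na_ta X)]
  rw [← h1, h2]

theorem mu_na : B.mu (B.H.obj X) ≫ B.na X = B.H.map (B.na X) ≫ B.mu (B.H.obj X) := by
  have h1 : B.H.map (B.na X) ≫ B.mu (B.H.obj X) ≫ B.na X = B.mu (B.H.obj X) ≫ B.na X := by
    rw [na_eq B X, reassoc_of% (B.mu_ta X), ← B.H.map_comp_assoc, ← na_eq, na_ta]
  have h2 : B.H.map (B.na X) ≫ B.mu (B.H.obj X) ≫ B.na X =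
      B.H.map (B.na X) ≫ B.mu (B.H.obj X) := by
    rw [B.na_def X, B.H.map_comp]
    simp only [Category.assoc]
    rw [B.Hta_mu X, ← B.na_def X, reassoc_of% (B.Hta_mu X), ta_na]
  rw [← h1, h2]

/-- `σ = Hm·δH`, at `X`. -/
def sg : B.H.obj (B.H.obj X) ⟶ B.H.obj (B.H.obj X) := B.de (B.H.obj X) ≫ B.H.map (B.mu X)
/-- `σ̄ = mH·Hδ`, at `X`. -/
def sb : B.H.obj (B.H.obj X) ⟶ B.H.obj (B.H.obj X) := B.H.map (B.de X) ≫ B.mu (B.H.obj X)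
/-- `ω = mH·Hτ·δH`, at `X`. -/
def om : B.H.obj (B.H.obj X) ⟶ B.H.obj (B.H.obj X) :=
  B.de (B.H.obj X) ≫ B.H.map (B.ta X) ≫ B.mu (B.H.obj X)
/-- `ω̄ = Hm·τH·Hδ`, at `X`. -/
def ob : B.H.obj (B.H.obj X) ⟶ B.H.obj (B.H.obj X) :=
  B.H.map (B.de X) ≫ B.ta (B.H.obj X) ≫ B.H.map (B.mu X)
/-- `ξ̄ = Hε·ω̄·He`, at `X`. -/
def xb : B.H.obj X ⟶ B.H.obj X := B.H.map (B.un X) ≫ B.ob X ≫ B.H.map (B.co X)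
/-- `δ·e`, at `X`. -/
def kk : X ⟶ B.H.obj (B.H.obj X) := B.un X ≫ B.de X
/-- `ε·m`, at `X`. -/
def ll : B.H.obj (B.H.obj X) ⟶ X := B.mu X ≫ B.co X

theorem kk_nat {X Y : C} (f : X ⟶ Y) : f ≫ B.kk Y = B.kk X ≫ B.H.map (B.H.map f) := by
  rw [kk, kk, reassoc_of% (B.un_nat f), B.de_nat f, Category.assoc]
theorem ll_nat {X Y : C} (f : X ⟶ Y) : B.H.map (B.H.map f) ≫ B.ll Y = B.ll X ≫ f := by
  rw [ll, ll, reassoc_of% (B.mu_nat f), B.co_nat f, Category.assoc]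

theorem xb_eq1 : B.xb X = B.H.map (B.kk X) ≫ B.ta (B.H.obj X) ≫ B.H.map (B.ll X) := by
  simp only [xb, ob, kk, ll, Category.assoc, Functor.map_comp]

theorem un_ta : B.H.map (B.kk X) ≫ B.ta (B.H.obj X) =
    B.kk (B.H.obj X) ≫ B.H.map (B.tb X) := by
  rw [kk, kk, B.H.map_comp, Category.assoc, B.Hde_ta X, ← reassoc_of% (B.un_na X),
    reassoc_of% (B.na_de X), ← B.H.map_comp, na_tb, Category.assoc]

theorem ta_co : B.ta (B.H.obj X) ≫ B.H.map (B.ll X) =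
    B.H.map (B.tb X) ≫ B.ll (B.H.obj X) := by
  rw [ll, ll, B.H.map_comp, reassoc_of% (B.ta_Hmu X), ← B.na_co X, reassoc_of% (B.mu_na X),
    ← B.H.map_comp_assoc, tb_na]

theorem xb_eq2 : B.xb X = B.kk (B.H.obj X) ≫ B.H.map (B.tb X ≫ B.ll X) := by
  rw [xb_eq1, reassoc_of% (B.un_ta X), ← B.H.map_comp]

theorem xb_eq3 : B.xb X = B.H.map (B.kk X ≫ B.tb X) ≫ B.ll (B.H.obj X) := by
  rw [xb_eq1, B.ta_co X, ← B.H.map_comp_assoc]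

theorem xb_nat {X Y : C} (f : X ⟶ Y) : B.H.map f ≫ B.xb Y = B.xb X ≫ B.H.map f := by
  rw [xb_eq1, xb_eq1, ← B.H.map_comp_assoc, kk_nat, B.H.map_comp, Category.assoc,
    reassoc_of% (B.ta_nat (B.H.map f)), ← B.H.map_comp, ll_nat, B.H.map_comp]
  simp only [Category.assoc]

theorem kk_kk : B.kk X ≫ B.H.map (B.H.map (B.kk X)) ≫ B.H.map (B.mu (B.H.obj X)) =
    B.kk X ≫ B.de (B.H.obj X) := by
  rw [← reassoc_of% (B.kk_nat (B.kk X))]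
  simp only [kk, Category.assoc]
  rw [un_com, reassoc_of% (B.un_nat (B.de X))]

theorem kk_kk' : B.kk X ≫ B.H.map (B.H.map (B.kk X)) ≫ B.H.map (B.tb (B.H.obj X)) ≫
      B.H.map (B.mu (B.H.obj X)) = B.kk X ≫ B.de (B.H.obj X) := by
  rw [← reassoc_of% (B.kk_nat (B.kk X))]
  simp only [kk, Category.assoc]
  rw [un_com', reassoc_of% (B.un_nat (B.de X))]

theorem ll_ll : B.H.map (B.de (B.H.obj X)) ≫ B.H.map (B.H.map (B.ll X)) ≫ B.ll X =
    B.mu (B.H.obj X) ≫ B.ll X := by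
  rw [ll_nat]
  simp only [ll, Category.assoc]
  rw [co_mul, ← reassoc_of% (B.co_nat (B.mu X))]

theorem ll_ll' : B.H.map (B.de (B.H.obj X)) ≫ B.H.map (B.tb (B.H.obj X)) ≫
      B.H.map (B.H.map (B.ll X)) ≫ B.ll X = B.mu (B.H.obj X) ≫ B.ll X := by
  rw [ll_nat]
  simp only [ll, Category.assoc]
  rw [co_mul', ← reassoc_of% (B.co_nat (B.mu X))]

theorem kk_xb : B.kk X ≫ B.xb (B.H.obj X) = B.kk X := by
  rw [xb_eq2, reassoc_of% (B.kk_nat (B.kk X)), B.H.map_comp, ll, B.H.map_comp,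
    reassoc_of% (B.kk_kk' X), de_Hco, Category.comp_id]

theorem na_Hxb : B.na X ≫ B.H.map (B.xb X) = B.H.map (B.xb X) ≫ B.na X := by
  have h1 := B.na_nat (B.kk X)
  have h2 := B.na_nat (B.ll X)
  rw [xb_eq1, B.H.map_comp, B.H.map_comp, Category.assoc, Category.assoc, h2,
    ← reassoc_of% h1, ← reassoc_of% (B.na_Hta (B.H.obj X))]

theorem na_sg : B.na X ≫ B.sg X = B.sg X := by
  rw [sg, reassoc_of% (B.na_de X), ← B.H.map_comp, na_mu]

theorem sb_na : B.sb X ≫ B.na X = B.sb X := by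
  rw [sb, Category.assoc, B.mu_na X, ← B.H.map_comp_assoc, de_na]

theorem xb_de : B.xb X ≫ B.de X = B.xb X ≫ B.un (B.H.obj X) ≫ B.sg X := by
  have h1 : B.xb X ≫ B.de X = B.H.map (B.kk X ≫ B.de (B.H.obj X)) ≫
      B.ta (B.H.obj (B.H.obj X)) ≫ B.H.map (B.ta (B.H.obj X)) ≫
        B.H.map (B.H.map (B.ll X)) := by
    rw [xb_eq1, Category.assoc, Category.assoc, B.de_nat (B.ll X),
      reassoc_of% (B.ta_de (B.H.obj X)), B.H.map_comp, Category.assoc]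
  have h2 := B.ta_nat (B.mu (B.H.obj X))
  have h3 := B.ta_nat (B.H.map (B.kk X))
  have h4 := B.ta_nat (B.kk X)
  have h5 := B.mu_nat (B.ll X)
  rw [h1, ← kk_kk, B.H.map_comp, B.H.map_comp]
  simp only [Category.assoc]
  rw [reassoc_of% h2, reassoc_of% h3, ← B.H.map_comp_assoc (B.H.map (B.mu _)), B.Hmu_ta,
    B.H.map_comp, B.H.map_comp, Category.assoc, Category.assoc,
    ← B.H.map_comp_assoc (B.H.map (B.H.map (B.kk X))), h4, B.H.map_comp, Category.assoc,
    ← B.H.map_comp (B.mu _), ← h5, B.H.map_comp (B.H.map _)]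
  have h6 : B.H.map (B.kk X) ≫ B.ta (B.H.obj X) ≫ B.H.map (B.ta X) =
      B.un (B.H.obj X) ≫ B.na X ≫ B.de (B.H.obj X) := by
    rw [kk, B.H.map_comp, Category.assoc, ← B.ta_de X, reassoc_of% (B.un_na X)]
  have h7 : B.H.map (B.H.map (B.H.map (B.kk X))) ≫
      B.H.map (B.H.map (B.ta (B.H.obj X))) ≫ B.H.map (B.H.map (B.H.map (B.ll X))) ≫
        B.H.map (B.mu X) =
      B.H.map (B.H.map (B.xb X)) ≫ B.H.map (B.mu X) := by
    simp only [xb_eq1, Functor.map_comp, Category.assoc]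
  rw [reassoc_of% h6, h7, ← reassoc_of% (B.de_nat (B.xb X)),
    reassoc_of% (B.na_Hxb X), ← sg, na_sg, ← reassoc_of% (B.un_nat (B.xb X))]

theorem mu_xb : B.mu X ≫ B.xb X = B.sb X ≫ B.co (B.H.obj X) ≫ B.xb X := by
  have h1 : B.mu X ≫ B.xb X = B.H.map (B.H.map (B.kk X)) ≫ B.H.map (B.ta (B.H.obj X)) ≫
      B.ta (B.H.obj (B.H.obj X)) ≫ B.H.map (B.mu (B.H.obj X) ≫ B.ll X) := by
    rw [xb_eq1, ← reassoc_of% (B.mu_nat (B.kk X)),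
      reassoc_of% (B.mu_ta (B.H.obj X)), B.H.map_comp]
  have h2 := B.ta_nat (B.de (B.H.obj X))
  have h3 := B.ta_nat (B.H.map (B.ll X))
  have h4 := B.ta_nat (B.ll X)
  have h5 := B.de_nat (B.kk X)
  have h6 : B.H.map (B.ta X) ≫ B.ta (B.H.obj X) ≫ B.H.map (B.ll X) =
      B.mu (B.H.obj X) ≫ B.na X ≫ B.co (B.H.obj X) := by
    rw [ll, B.H.map_comp, ← reassoc_of% (B.mu_ta X), B.na_co X]
  have h7 : B.H.map (B.H.map (B.H.map (B.kk X))) ≫ B.H.map (B.H.map (B.ta (B.H.obj X))) ≫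
      B.H.map (B.H.map (B.H.map (B.ll X))) = B.H.map (B.H.map (B.xb X)) := by
    simp only [xb_eq1, Functor.map_comp]
  rw [h1, ← ll_ll, B.H.map_comp, B.H.map_comp, ← reassoc_of% h2, ← reassoc_of% h3,
    ← B.H.map_comp_assoc (B.ta _), B.ta_Hde, B.H.map_comp, B.H.map_comp]
  simp only [Category.assoc]
  rw [← B.H.map_comp_assoc (B.ta _) (B.H.map (B.H.map (B.ll X))), ← h4, B.H.map_comp,
    Category.assoc, h6, ← B.H.map_comp_assoc (B.H.map (B.kk X)), h5, B.H.map_comp,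
    Category.assoc, reassoc_of% h7, reassoc_of% (B.mu_nat (B.xb X)), ← reassoc_of% (B.na_Hxb X),
    B.co_nat, ← Category.assoc, ← sb, reassoc_of% (B.sb_na X)]

theorem ch_xb : B.un (B.H.obj X) ≫ B.sg X ≫ B.H.map (B.co X) ≫ B.xb X =
    B.un (B.H.obj X) ≫ B.sg X ≫ B.H.map (B.co X) := by
  have h := B.kk_xb (B.H.obj X)
  simp only [kk, Category.assoc] at h
  rw [B.xb_nat, sg, Category.assoc, reassoc_of% (B.xb_nat (B.mu X)), reassoc_of% h]
  simp only [Category.assoc]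

variable {X} in
theorem eq_xb_of_de {Z : C} (z : Z ⟶ B.H.obj X)
    (hz : z ≫ B.de X = z ≫ B.un (B.H.obj X) ≫ B.sg X) : z ≫ B.xb X = z := by
  have h : z = z ≫ B.un (B.H.obj X) ≫ B.sg X ≫ B.H.map (B.co X) := by
    rw [← reassoc_of% hz, de_Hco, Category.comp_id]
  rw [h]
  simp only [Category.assoc, ch_xb]

theorem xb_idem : B.xb X ≫ B.xb X = B.xb X := B.eq_xb_of_de _ (B.xb_de X)

theorem un_xb : B.un X ≫ B.xb X = B.un X := by
  have h := B.kk_xb X =≫ B.H.map (B.co X)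
  rw [Category.assoc, ← B.xb_nat] at h
  simpa only [kk, Category.assoc, B.de_Hco, reassoc_of% (B.de_Hco X), Category.comp_id] using h

theorem Hxb_mu_de : B.H.map (B.xb X) ≫ B.mu X ≫ B.de X = B.H.map (B.xb X) ≫ B.sg X := by
  have h1 := B.mu_de (B.H.obj X)
  have hd := B.de_nat (B.H.map (B.mu X))
  have ht := B.ta_nat (B.mu X)
  have hm := B.mu_nat (B.H.map (B.mu X))
  rw [mu_de, ← B.H.map_comp_assoc, xb_de, sg, B.H.map_comp, B.H.map_comp, B.H.map_comp]
  simp only [Category.assoc]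
  rw [reassoc_of% hd, ← B.H.map_comp_assoc (B.H.map (B.H.map _)), ht, B.H.map_comp, Category.assoc,
    reassoc_of% hm, ← B.H.map_comp (B.H.map _), B.mu_assoc, B.H.map_comp,
    ← reassoc_of% h1, reassoc_of% (B.Hun_mu (B.H.obj X))]

theorem mu_de_Hxb : B.mu X ≫ B.de X ≫ B.H.map (B.xb X) = B.sb X ≫ B.H.map (B.xb X) := by
  have h1 := B.mu_de (B.H.obj X)
  have hd := B.mu_nat (B.H.map (B.de X))
  have ht := B.ta_nat (B.de X)
  have hm := B.de_nat (B.H.map (B.de X))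
  rw [reassoc_of% (B.mu_de X), ← B.H.map_comp, mu_xb, sb, B.H.map_comp, B.H.map_comp, B.H.map_comp]
  simp only [Category.assoc]
  rw [← reassoc_of% hd, ← B.H.map_comp_assoc (B.ta _), ← ht, B.H.map_comp, Category.assoc,
    ← reassoc_of% hm, ← B.H.map_comp_assoc (B.de X), B.de_coassoc, B.H.map_comp, Category.assoc,
    ← reassoc_of% h1, reassoc_of% (B.de_Hco (B.H.obj X))]

theorem balance : B.H.map (B.xb (B.H.obj X)) ≫ B.mu (B.H.obj X) ≫ B.sg X =
    B.H.map (B.xb (B.H.obj X)) ≫ B.H.map (B.mu X) ≫ B.sg X := by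
  have h := B.Hxb_mu_de (B.H.obj X)
  have h2 := B.de_nat (B.mu X)
  rw [sg] at *
  rw [reassoc_of% h, ← B.H.map_comp, ← B.mu_assoc, B.H.map_comp, reassoc_of% h2]

theorem cobalance : B.sb X ≫ B.de (B.H.obj X) ≫ B.H.map (B.xb (B.H.obj X)) =
    B.sb X ≫ B.H.map (B.de X) ≫ B.H.map (B.xb (B.H.obj X)) := by
  have h := B.mu_de_Hxb (B.H.obj X)
  have h2 := B.mu_nat (B.de X)
  rw [sb] at *
  rw [Category.assoc, h, Category.assoc, Category.assoc, ← reassoc_of% h2,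
    ← B.H.map_comp_assoc, ← B.de_coassoc, B.H.map_comp, Category.assoc]

theorem xbxb_mu : B.H.map (B.xb X) ≫ B.xb (B.H.obj X) ≫ B.mu X ≫ B.xb X =
    B.H.map (B.xb X) ≫ B.xb (B.H.obj X) ≫ B.mu X := by
  have key : (B.H.map (B.xb X) ≫ B.xb (B.H.obj X) ≫ B.mu X) ≫ B.xb X =
      B.H.map (B.xb X) ≫ B.xb (B.H.obj X) ≫ B.mu X := by
    apply B.eq_xb_of_de
    have hu := B.un_nat (B.mu X)
    have hd := B.de_nat (B.mu X)
    simp only [Category.assoc]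
    rw [reassoc_of% (B.xb_nat (B.xb X)), B.Hxb_mu_de X, ← reassoc_of% (B.xb_nat (B.xb X)), sg, reassoc_of% (B.xb_de (B.H.obj X)), reassoc_of% hu,
      reassoc_of% hd, sg, Category.assoc, ← B.H.map_comp, ← B.H.map_comp, mu_assoc]
  simpa only [Category.assoc] using key

theorem mu_om : B.mu (B.H.obj X) ≫ B.om X =
    B.H.map (B.om X) ≫ B.om (B.H.obj X) ≫ B.H.map (B.mu X) := by
  have e1 := B.mu_nat (B.H.map (B.ta X))
  have e2 := B.mu_nat (B.ta (B.H.obj X))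
  have e4 := B.mu_nat (B.mu X)
  have e5 := B.mu_assoc (B.H.obj (B.H.obj X))
  have f1 := B.de_nat (B.mu (B.H.obj X))
  have f2 := B.de_nat (B.H.map (B.ta X))
  have f3 := B.ta_nat (B.ta X)
  rw [om, om, reassoc_of% (B.mu_de (B.H.obj X)), ← B.H.map_comp_assoc (B.mu _), B.mu_ta]
  simp only [B.H.map_comp, Category.assoc]
  rw [← reassoc_of% e1, ← reassoc_of% e2, e4, ← reassoc_of% e5,
    reassoc_of% f1, reassoc_of% f2, ← B.H.map_comp_assoc (B.H.map (B.mu _)), B.Hmu_ta,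
    B.H.map_comp, B.H.map_comp, Category.assoc, Category.assoc,
    ← B.H.map_comp_assoc (B.H.map (B.H.map (B.ta X))) (B.ta (B.H.obj (B.H.obj X))), f3,
    B.H.map_comp, Category.assoc]

theorem om_de : B.om X ≫ B.de (B.H.obj X) =
    B.H.map (B.de X) ≫ B.om (B.H.obj X) ≫ B.H.map (B.om X) := by
  have e1 := B.de_nat (B.H.map (B.ta X))
  have e2 := B.de_nat (B.ta (B.H.obj X))
  have e4 := B.de_nat (B.de X)
  have e5 := B.de_coassoc (B.H.obj (B.H.obj X))
  have f1 := B.mu_nat (B.de (B.H.obj X))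
  have f2 := B.mu_nat (B.H.map (B.ta X))
  have f3 := B.ta_nat (B.ta X)
  rw [om, om]
  simp only [Category.assoc]
  rw [B.mu_de (B.H.obj X)]
  simp only [B.H.map_comp]
  rw [← B.H.map_comp_assoc (B.ta X), B.ta_de, B.H.map_comp, B.H.map_comp, Category.assoc,
    Category.assoc, ← reassoc_of% e4, reassoc_of% e1, reassoc_of% e2, ← reassoc_of% e5,
    ← reassoc_of% f1, ← reassoc_of% f2, ← B.H.map_comp_assoc (B.ta _) (B.H.map (B.de _)),
    B.ta_Hde, B.H.map_comp, B.H.map_comp, Category.assoc, Category.assoc,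
    ← B.H.map_comp_assoc (B.H.map (B.H.map (B.ta X))) (B.ta (B.H.obj (B.H.obj X))), f3,
    B.H.map_comp, Category.assoc]

theorem om_nat {X Y : C} (f : X ⟶ Y) :
    B.H.map (B.H.map f) ≫ B.om Y = B.om X ≫ B.H.map (B.H.map f) := by
  have h1 := B.de_nat (B.H.map f)
  have h2 := B.ta_nat f
  have h3 := B.mu_nat (B.H.map f)
  rw [om, om, reassoc_of% h1, ← B.H.map_comp_assoc, h2, B.H.map_comp, Category.assoc, h3]
  simp only [Category.assoc]

theorem sg_nat {X Y : C} (f : X ⟶ Y) :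
    B.H.map (B.H.map f) ≫ B.sg Y = B.sg X ≫ B.H.map (B.H.map f) := by
  have h1 := B.de_nat (B.H.map f)
  rw [sg, sg, reassoc_of% h1, ← B.H.map_comp, mu_nat, B.H.map_comp, Category.assoc]

theorem sb_nat {X Y : C} (f : X ⟶ Y) :
    B.H.map (B.H.map f) ≫ B.sb Y = B.sb X ≫ B.H.map (B.H.map f) := by
  have h1 := B.mu_nat (B.H.map f)
  rw [sb, sb, ← B.H.map_comp_assoc, de_nat, B.H.map_comp, Category.assoc, h1, Category.assoc]

/-- `ξ̄ = Hε·ω̄·He : H → H`. -/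
def xiBar : B.H ⟶ B.H where
  app X := B.xb X
  naturality _ _ f := B.xb_nat f

/-- `ξ = εH·ω·eH : H → H`. -/
def xi : B.H ⟶ B.H where
  app X := B.un (B.H.obj X) ≫ B.om X ≫ B.co (B.H.obj X)
  naturality X Y f := by
    rw [reassoc_of% (B.un_nat (B.H.map f)), reassoc_of% (B.om_nat f), B.co_nat]
    simp only [Category.assoc]

/-- The convolution product `φ * ψ = m·φψ·δ` of natural transformations `H → H`. -/
def conv (φ ψ : B.H ⟶ B.H) : B.H ⟶ B.H where
  app X := B.de X ≫ (B.H.map (ψ.app X) ≫ φ.app (B.H.obj X)) ≫ B.mu X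
  naturality X Y f := by
    rw [reassoc_of% (B.de_nat f), Category.assoc, ← B.H.map_comp_assoc, ψ.naturality,
      B.H.map_comp, Category.assoc, φ.naturality_assoc, mu_nat]
    simp only [Category.assoc]

/-- `S` is a weak antipode: `1 * S = ξ`, `S * 1 = ξ̄` and `S * 1 * S = S`. -/
structure IsWeakAntipode (S : B.H ⟶ B.H) : Prop where
  id_conv : B.conv (𝟙 B.H) S = B.xi
  conv_id : B.conv S (𝟙 B.H) = B.xiBar
  conv_id_conv : B.conv (B.conv S (𝟙 B.H)) S = S

/-- The weak braided bimonad is a weak braided Hopf monad: it has a weak antipode. -/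
def IsHopf : Prop := ∃ S : B.H ⟶ B.H, B.IsWeakAntipode S

/-- The underlying monad `(H, m, e)`. -/
def monad : Monad C where
  toFunctor := B.H
  η := B.e
  μ := B.m
  assoc := B.assoc
  left_unit := B.left_unit
  right_unit := B.right_unit

/-- The underlying comonad `(H, δ, ε)`. -/
def comonad : Comonad C where
  toFunctor := B.H
  ε := B.ε
  δ := B.δ
  coassoc X := (B.coassoc X)
  left_counit := B.left_counit
  right_counit := B.right_counit

/-- A mixed bimodule `(A, h, θ)`: an `H`-module `h : HA → A` and `H`-comodule `θ : A → HA` with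
`θ·h = H(h)·ω_A·H(θ)`. -/
structure MixedBimodule where
  A : C
  h : B.H.obj A ⟶ A
  θ : A ⟶ B.H.obj A
  unit : B.un A ≫ h = 𝟙 A
  assoc : B.mu A ≫ h = B.H.map h ≫ h
  counit : θ ≫ B.co A = 𝟙 A
  coassoc : θ ≫ B.de A = θ ≫ B.H.map θ
  compat : h ≫ θ = B.H.map θ ≫ B.om A ≫ B.H.map h

variable {B} in
/-- Morphisms of mixed bimodules: morphisms of modules and of comodules. -/
@[ext]
structure MixedBimodule.Hom (M N : B.MixedBimodule) where
  f : M.A ⟶ N.A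
  h : B.H.map f ≫ N.h = M.h ≫ f
  θ : M.θ ≫ B.H.map f = f ≫ N.θ

instance : Category B.MixedBimodule where
  Hom := MixedBimodule.Hom
  id M := ⟨𝟙 M.A, by simp, by simp⟩
  comp {M N P} f g := ⟨f.f ≫ g.f,
    by rw [B.H.map_comp, Category.assoc, g.h, reassoc_of% f.h],
    by rw [B.H.map_comp, reassoc_of% f.θ, g.θ, Category.assoc]⟩
  id_comp f := MixedBimodule.Hom.ext (Category.id_comp _)
  comp_id f := MixedBimodule.Hom.ext (Category.comp_id _)
  assoc f g k := MixedBimodule.Hom.ext (Category.assoc _ _ _)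

theorem mu_de_om : B.mu X ≫ B.de X =
    B.H.map (B.de X) ≫ B.om (B.H.obj X) ≫ B.H.map (B.mu X) := by
  rw [mu_de, om]; simp only [Category.assoc]

/-- The comparison functor `K_ω : X ↦ (HX, m_X, δ_X)`. -/
def Komega : C ⥤ B.MixedBimodule where
  obj X :=
    { A := B.H.obj X
      h := B.mu X
      θ := B.de X
      unit := B.un_mu X
      assoc := (B.mu_assoc X).symm
      counit := B.de_co X
      coassoc := (B.de_coassoc X).symm
      compat := B.mu_de_om X }
  map f := ⟨B.H.map f, B.mu_nat f, (B.de_nat f).symm⟩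
  map_id X := MixedBimodule.Hom.ext (B.H.map_id X)
  map_comp f g := MixedBimodule.Hom.ext (B.H.map_comp f g)

end WeakBraidedBimonad

/-- A splitting `F → obj → F` of an endomorphism `f` of a functor `F`, in the functor category. -/
structure NatSplitting {C : Type u} [Category.{v} C] {D : Type u'} [Category.{v'} D]
    {F : C ⥤ D} (f : F ⟶ F) where
  obj : C ⥤ D
  proj : F ⟶ obj
  incl : obj ⟶ F
  incl_proj : incl ≫ proj = 𝟙 obj
  proj_incl : proj ≫ incl = f

namespace NatSplitting

variable {C : Type u} [Category.{v} C] {D : Type u'} [Category.{v'} D]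
    {F : C ⥤ D} {f : F ⟶ F}

theorem ip (S : NatSplitting f) (X : C) : S.incl.app X ≫ S.proj.app X = 𝟙 (S.obj.obj X) := by
  rw [← NatTrans.comp_app, S.incl_proj, NatTrans.id_app]

theorem pi (S : NatSplitting f) (X : C) : S.proj.app X ≫ S.incl.app X = f.app X := by
  rw [← NatTrans.comp_app, S.proj_incl]

theorem nonempty_of_idem [IsIdempotentComplete D] (hf : f ≫ f = f) :
    Nonempty (NatSplitting f) := by
  have h : ∀ X, ∃ (Y : D) (i : Y ⟶ F.obj X) (p : F.obj X ⟶ Y),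
      i ≫ p = 𝟙 Y ∧ p ≫ i = f.app X := fun X =>
    IsIdempotentComplete.idempotents_split _ (f.app X) (by rw [← NatTrans.comp_app, hf])
  choose Y i p hip hpi using h
  exact ⟨{
    obj :=
      { obj := Y
        map := fun {X Z} g => i X ≫ F.map g ≫ p Z
        map_id := fun X => by rw [F.map_id, Category.id_comp, hip]
        map_comp := fun {X Z W} g k => by
          have : p Z ≫ i Z ≫ F.map k = F.map k ≫ f.app W := by
            rw [reassoc_of% (hpi Z), f.naturality]
          simp only [Category.assoc]
          rw [reassoc_of% this, ← hpi W, Category.assoc, hip, Category.comp_id, F.map_comp,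
            Category.assoc] }
    proj :=
      { app := p
        naturality := fun X Z g => by
          show F.map g ≫ p Z = p X ≫ i X ≫ F.map g ≫ p Z
          rw [reassoc_of% (hpi X), ← f.naturality_assoc, ← hpi Z, Category.assoc, hip,
            Category.comp_id] }
    incl :=
      { app := i
        naturality := fun X Z g => by
          show (i X ≫ F.map g ≫ p Z) ≫ i Z = i X ≫ F.map g
          rw [Category.assoc, Category.assoc, hpi, f.naturality, ← hpi X, Category.assoc,
            reassoc_of% (hip X)] }
    incl_proj := by ext X; exact hip X
    proj_incl := by ext X; exact hpi X }⟩

end NatSplitting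

namespace WeakBraidedBimonad

variable {C : Type u} [Category.{v} C] (B : WeakBraidedBimonad C)

instance [IsIdempotentComplete C] : Nonempty (NatSplitting B.xiBar) :=
  NatSplitting.nonempty_of_idem (by ext X; exact B.xb_idem X)

variable {B} in
theorem incl_mu_xb (S : NatSplitting B.xiBar) (X : C) :
    S.incl.app (S.obj.obj X) ≫ B.H.map (S.incl.app X) ≫ B.mu X ≫ B.xb X =
    S.incl.app (S.obj.obj X) ≫ B.H.map (S.incl.app X) ≫ B.mu X := by
  have hi : ∀ Y, S.incl.app Y = S.incl.app Y ≫ B.xb Y := fun Y => by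
    have := S.ip Y =≫ S.incl.app Y
    rw [Category.assoc, S.pi, Category.id_comp] at this
    exact this.symm
  have h1 : S.incl.app (S.obj.obj X) ≫ B.H.map (S.incl.app X) =
      S.incl.app (S.obj.obj X) ≫ B.H.map (S.incl.app X) ≫ B.H.map (B.xb X) ≫
        B.xb (B.H.obj X) := by
    conv_lhs => rw [hi, hi X]
    rw [Category.assoc, ← B.xb_nat, B.H.map_comp, Category.assoc]
  rw [reassoc_of% h1, B.xbxb_mu, ← reassoc_of% h1]

/-- The monad `H^ξ̄` on a splitting `H → H^ξ̄ → H` (`proj = q`, `incl = ι`) of `ξ̄`, with unit `q·e` and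
multiplication `q·m·ιι`. -/
def xiMonad (S : NatSplitting B.xiBar) : Monad C where
  toFunctor := S.obj
  η := B.e ≫ S.proj
  μ :=
    { app := fun X => S.incl.app (S.obj.obj X) ≫ B.H.map (S.incl.app X) ≫ B.mu X ≫ S.proj.app X
      naturality := fun X Y f => by
        show S.obj.map (S.obj.map f) ≫ _ = _
        rw [S.incl.naturality_assoc, ← B.H.map_comp_assoc, S.incl.naturality, B.H.map_comp,
          Category.assoc, reassoc_of% (B.mu_nat f), S.proj.naturality]
        simp only [Category.assoc] }
  assoc X := by
    dsimp only
    rw [S.incl.naturality_assoc, ← B.H.map_comp_assoc]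
    simp only [Category.assoc]
    have hp : ∀ Y, S.proj.app Y ≫ S.incl.app Y = B.xb Y := S.pi
    rw [hp X, incl_mu_xb S X, reassoc_of% (hp (S.obj.obj X)),
      reassoc_of% (incl_mu_xb S (S.obj.obj X)), ← reassoc_of% (B.mu_nat (S.incl.app X)),
      ← reassoc_of% (B.mu_assoc X)]
    simp only [Functor.map_comp, Category.assoc]
    rfl
  left_unit X := by
    have hp : ∀ Y, S.proj.app Y ≫ S.incl.app Y = B.xb Y := S.pi
    show (B.un (S.obj.obj X) ≫ S.proj.app (S.obj.obj X)) ≫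
      S.incl.app (S.obj.obj X) ≫ B.H.map (S.incl.app X) ≫ B.mu X ≫ S.proj.app X =
        𝟙 (S.obj.obj X)
    rw [Category.assoc, reassoc_of% (hp (S.obj.obj X)), reassoc_of% (B.un_xb (S.obj.obj X)),
      ← reassoc_of% (B.un_nat (S.incl.app X)), reassoc_of% (B.un_mu X), S.ip]
  right_unit X := by
    have hp : ∀ Y, S.proj.app Y ≫ S.incl.app Y = B.xb Y := S.pi
    show S.obj.map (B.un X ≫ S.proj.app X) ≫
      S.incl.app (S.obj.obj X) ≫ B.H.map (S.incl.app X) ≫ B.mu X ≫ S.proj.app X =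
        𝟙 (S.obj.obj X)
    rw [S.incl.naturality_assoc, ← B.H.map_comp_assoc, Category.assoc, hp, B.un_xb,
      reassoc_of% (B.Hun_mu X), S.ip]

section

variable {A A' : C}

theorem gam_nat {a : B.H.obj A ⟶ A} {a' : B.H.obj A' ⟶ A'} {f : A ⟶ A'}
    (h : B.H.map f ≫ a' = a ≫ f) :
    B.H.map f ≫ B.un (B.H.obj A') ≫ B.om A' ≫ B.H.map a' =
      (B.un (B.H.obj A) ≫ B.om A ≫ B.H.map a) ≫ B.H.map f := by
  rw [reassoc_of% (B.un_nat (B.H.map f)), reassoc_of% (B.om_nat f), ← B.H.map_comp, h,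
    B.H.map_comp]
  simp only [Category.assoc]

theorem gam_idem {a : B.H.obj A ⟶ A} (h : B.mu A ≫ a = B.H.map a ≫ a) :
    (B.un (B.H.obj A) ≫ B.om A ≫ B.H.map a) ≫ B.un (B.H.obj A) ≫ B.om A ≫ B.H.map a =
      B.un (B.H.obj A) ≫ B.om A ≫ B.H.map a := by
  rw [Category.assoc, Category.assoc, reassoc_of% (B.un_nat (B.H.map a)),
    reassoc_of% (B.om_nat a), ← B.H.map_comp, ← h, B.H.map_comp,
    reassoc_of% (B.un_nat (B.om A)), ← reassoc_of% (B.mu_om A),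
    reassoc_of% (B.un_mu (B.H.obj A))]

theorem gam'_nat {a : A ⟶ B.H.obj A} {a' : A' ⟶ B.H.obj A'} {f : A ⟶ A'}
    (h : a ≫ B.H.map f = f ≫ a') :
    B.H.map f ≫ B.H.map a' ≫ B.om A' ≫ B.co (B.H.obj A') =
      (B.H.map a ≫ B.om A ≫ B.co (B.H.obj A)) ≫ B.H.map f := by
  rw [← B.H.map_comp_assoc, ← h, B.H.map_comp, Category.assoc, reassoc_of% (B.om_nat f),
    B.co_nat]
  simp only [Category.assoc]

theorem gam'_idem {a : A ⟶ B.H.obj A} (h : a ≫ B.de A = a ≫ B.H.map a) :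
    (B.H.map a ≫ B.om A ≫ B.co (B.H.obj A)) ≫ B.H.map a ≫ B.om A ≫ B.co (B.H.obj A) =
      B.H.map a ≫ B.om A ≫ B.co (B.H.obj A) := by
  rw [Category.assoc, Category.assoc, ← reassoc_of% (B.co_nat (B.H.map a)),
    ← reassoc_of% (B.om_nat a), ← B.H.map_comp_assoc, ← h, B.H.map_comp, Category.assoc,
    ← reassoc_of% (B.co_nat (B.om A)), ← reassoc_of% (B.om_de A),
    reassoc_of% (B.de_co (B.H.obj A))]

end

/-- The idempotent `Γ = Hh·ω·eH` on `H(a)`, natural in the `H`-module `(a, h)`. -/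
def Gamma : B.monad.forget ⋙ B.H ⟶ B.monad.forget ⋙ B.H where
  app M := B.un (B.H.obj M.A) ≫ B.om M.A ≫ B.H.map M.a
  naturality _ _ f := B.gam_nat f.h

theorem Gamma_idem : B.Gamma ≫ B.Gamma = B.Gamma := by
  ext M
  exact B.gam_idem M.assoc

/-- The idempotent `Γ' = εH·ω·Hθ` on `H(a)`, natural in the `H`-comodule `(a, θ)`. -/
def GammaPrime : B.comonad.forget ⋙ B.H ⟶ B.comonad.forget ⋙ B.H where
  app M := B.H.map M.a ≫ B.om M.A ≫ B.co (B.H.obj M.A)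
  naturality _ _ f := B.gam'_nat f.h

theorem GammaPrime_idem : B.GammaPrime ≫ B.GammaPrime = B.GammaPrime := by
  ext M
  exact B.gam'_idem M.coassoc

instance [IsIdempotentComplete C] : Nonempty (NatSplitting B.Gamma) :=
  NatSplitting.nonempty_of_idem B.Gamma_idem

instance [IsIdempotentComplete C] : Nonempty (NatSplitting B.GammaPrime) :=
  NatSplitting.nonempty_of_idem B.GammaPrime_idem

section

variable (S : NatSplitting B.xiBar)

theorem incl_xb (X : C) : S.incl.app X ≫ B.xb X = S.incl.app X := by
  have := S.ip X =≫ S.incl.app X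
  rwa [Category.assoc, S.pi, Category.id_comp] at this

theorem xb_proj (X : C) : B.xb X ≫ S.proj.app X = S.proj.app X := by
  have := S.proj.app X ≫= S.ip X
  rwa [← Category.assoc, S.pi, Category.comp_id] at this

/-- The left action `m·ιH : H^ξ̄ H → H`. -/
def rhoLeft : B.H ⋙ S.obj ⟶ B.H where
  app X := S.incl.app (B.H.obj X) ≫ B.mu X
  naturality X Y f := by
    have h := S.incl.naturality (B.H.map f)
    show S.obj.map (B.H.map f) ≫ _ = _
    rw [reassoc_of% h, B.mu_nat, Category.assoc]

/-- The right action `m·Hι : H H^ξ̄ → H`. -/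
def rhoRight : S.obj ⋙ B.H ⟶ B.H where
  app X := B.H.map (S.incl.app X) ≫ B.mu X
  naturality X Y f := by
    have h := S.incl.naturality f
    show B.H.map (S.obj.map f) ≫ _ = _
    rw [← B.H.map_comp_assoc, h, B.H.map_comp, Category.assoc, B.mu_nat, Category.assoc]

/-- The left coaction `qH·δ : H → H_ξ̄ H` of the comonad `H_ξ̄ = (H^ξ̄, qq·δ·ι, ε·ι)`. -/
def thetaLeft : B.H ⟶ B.H ⋙ S.obj where
  app X := B.de X ≫ S.proj.app (B.H.obj X)
  naturality X Y f := by
    have h := S.proj.naturality (B.H.map f)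
    show _ = _ ≫ S.obj.map (B.H.map f)
    rw [reassoc_of% (B.de_nat f), h, Category.assoc]

/-- The right coaction `Hq·δ : H → H H_ξ̄`. -/
def thetaRight : B.H ⟶ S.obj ⋙ B.H where
  app X := B.de X ≫ B.H.map (S.proj.app X)
  naturality X Y f := by
    have h := S.proj.naturality f
    show _ = _ ≫ B.H.map (S.obj.map f)
    rw [reassoc_of% (B.de_nat f), ← B.H.map_comp, h, B.H.map_comp, Category.assoc]

/-- `ρ_r H : H H^ξ̄ H → HH`. -/
def rhoRightH : B.H ⋙ S.obj ⋙ B.H ⟶ B.H ⋙ B.H := Functor.whiskerLeft B.H (B.rhoRight S)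

/-- `H ρ_l : H H^ξ̄ H → HH`; a coequaliser of `ρ_r H` and `H ρ_l` is a tensor product
`H ⊗ H` over `H^ξ̄`. -/
def HrhoLeft : B.H ⋙ S.obj ⋙ B.H ⟶ B.H ⋙ B.H := Functor.whiskerRight (B.rhoLeft S) B.H

/-- `θ_r H : HH → H H_ξ̄ H`. -/
def thetaRightH : B.H ⋙ B.H ⟶ B.H ⋙ S.obj ⋙ B.H := Functor.whiskerLeft B.H (B.thetaRight S)

/-- `H θ_l : HH → H H_ξ̄ H`; an equaliser of `θ_r H` and `H θ_l` is a cotensor product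
of `H` with itself over `H_ξ̄`. -/
def HthetaLeft : B.H ⋙ B.H ⟶ B.H ⋙ S.obj ⋙ B.H := Functor.whiskerRight (B.thetaLeft S) B.H

end

/-- `σ = Hm·δH : HH → HH`. -/
def sigma : B.H ⋙ B.H ⟶ B.H ⋙ B.H where
  app X := B.sg X
  naturality _ _ f := B.sg_nat f

/-- `σ̄ = mH·Hδ : HH → HH`. -/
def sigmaBar : B.H ⋙ B.H ⟶ B.H ⋙ B.H where
  app X := B.sb X
  naturality _ _ f := B.sb_nat f

section

/-- `Ḡ = G φ_H`, the value on free modules of the functor `G : A_H → A` that splits `Γ`. -/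
def GBar (SG : NatSplitting B.Gamma) : C ⥤ C := B.monad.free ⋙ SG.obj

/-- The projection `p̄ : HH → Ḡ` of the splitting. -/
def pBar (SG : NatSplitting B.Gamma) : B.H ⋙ B.H ⟶ B.GBar SG :=
  Functor.whiskerLeft B.monad.free SG.proj

/-- `T̄ = T φ^H`, the value on cofree comodules of the functor `T : A^H → A` that splits `Γ'`. -/
def TBar (ST : NatSplitting B.GammaPrime) : C ⥤ C := B.comonad.cofree ⋙ ST.obj

/-- The inclusion `T̄ → HH` of the splitting. -/
def iBar (ST : NatSplitting B.GammaPrime) : B.TBar ST ⟶ B.H ⋙ B.H :=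
  Functor.whiskerLeft B.comonad.cofree ST.incl

theorem rho_sigma (S : NatSplitting B.xiBar) :
    B.rhoRightH S ≫ B.sigma = B.HrhoLeft S ≫ B.sigma := by
  ext X
  show (B.H.map (S.incl.app (B.H.obj X)) ≫ B.mu (B.H.obj X)) ≫ B.sg X =
    B.H.map (S.incl.app (B.H.obj X) ≫ B.mu X) ≫ B.sg X
  rw [← B.incl_xb S (B.H.obj X), B.H.map_comp, Category.assoc, Category.assoc, B.balance X]
  simp only [B.H.map_comp, Category.assoc]

theorem sigma_theta (S : NatSplitting B.xiBar) :
    B.sigmaBar ≫ B.thetaRightH S = B.sigmaBar ≫ B.HthetaLeft S := by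
  ext X
  show B.sb X ≫ B.de (B.H.obj X) ≫ B.H.map (S.proj.app (B.H.obj X)) =
    B.sb X ≫ B.H.map (B.de X ≫ S.proj.app (B.H.obj X))
  rw [← B.xb_proj S (B.H.obj X), B.H.map_comp, reassoc_of% (B.cobalance X)]
  simp only [B.H.map_comp]

/-- The morphism `γ : H ⊗ H → Ḡ` induced by `p̄·σ`: if `l : HH → H ⊗ H` denotes the coequaliser of
`ρ_r H` and `H ρ_l`, then `γ·l = p̄·σ`. -/
def gamma (S : NatSplitting B.xiBar) (SG : NatSplitting B.Gamma)
    (c : Cofork (B.rhoRightH S) (B.HrhoLeft S)) (hc : IsColimit c) : c.pt ⟶ B.GBar SG :=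
  hc.desc (Cofork.ofπ (B.sigma ≫ B.pBar SG) (by
    rw [← Category.assoc, B.rho_sigma S, Category.assoc]))

/-- The morphism `γ'` from `T̄` to the cotensor product induced by `σ̄` on `T̄ → HH`: composed with
the equaliser inclusion into `HH` it is `T̄ → HH` followed by `σ̄`. -/
def gamma' (S : NatSplitting B.xiBar) (ST : NatSplitting B.GammaPrime)
    (c : Fork (B.thetaRightH S) (B.HthetaLeft S)) (hc : IsLimit c) : B.TBar ST ⟶ c.pt :=
  hc.lift (Fork.ofι (B.iBar ST ≫ B.sigmaBar) (by
    rw [Category.assoc, B.sigma_theta S, Category.assoc]))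

end

/-- `K` has a right adjoint `R` that is monadic: the comparison functor from the domain of `R` to
the category of algebras of the monad of `K ⊣ R` is an equivalence. -/
def HasMonadicRightAdjoint {A : Type u} [Category.{v} A] {D : Type u'} [Category.{v'} D]
    (K : A ⥤ D) : Prop :=
  ∃ (R : D ⥤ A) (adj : K ⊣ R), (Monad.comparison adj).IsEquivalence

/-- `K` has a left adjoint `L` that is comonadic: the comparison functor from the domain of `L` to
the category of coalgebras of the comonad of `L ⊣ K` is an equivalence. -/
def HasComonadicLeftAdjoint {A : Type u} [Category.{v} A] {D : Type u'} [Category.{v'} D]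
    (K : A ⥤ D) : Prop :=
  ∃ (L : D ⥤ A) (adj : L ⊣ K), (Comonad.comparison adj).IsEquivalence

end WeakBraidedBimonad

/-! Read `H(X)` as `H⊗X`, write `δ(h) = h₁⊗h₂`, and suppress the braidings. For an `H`-module `A`
three endomorphisms of `H(A)` matter: `σ : h⊗x ↦ h₁⊗h₂x`, `E : h⊗x ↦ h₁⊗ξ̄(h₂)x` and `Γ : h⊗x ↦
h₁⊗ξ(h₂)x`. Both `E` and `Γ` are idempotent, and `σ` is unchanged by `E` before it (`E_sigma`) and
by `Γ` after it (`sigma_un_diag`). For `A = H(X)` the image of `E` is the tensor product over the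
base (`hasCoequalizer_rho`) and the image of `Γ` is `Ḡ(X)`. So `γ` is invertible exactly when `σ` is
invertible modulo `E` and `Γ`; this is `IsGalois`.

The equivalences come from a circle: antipode ⇒ equivalence of base modules with mixed bimodules ⇒
monadic right adjoint of `K_ω` ⇒ Galois ⇒ antipode.

A base module `X` induces a mixed bimodule, the image of the analogue of `E` on `H(X)`. A morphism
out of `K_ω(X)` is determined by its restriction along the unit, which is coinvariant; coinvariants
of `K_ω(Y)` lie in the image of `ξ̄`. Hence induction is fully faithful even without an antipode. An
antipode `S` supplies `κ : h⊗x ↦ h₁⊗S(h₂)x`, a weak inverse of `σ`, and the projection `a ↦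
S(a₋₁)a₀` onto coinvariants. This gives the fundamental theorem of Hopf modules
(`essSurj_of_split`). Induction turns free modules into values of `K_ω` (`freeIso`), so `K_ω` has a
monadic right adjoint.

Conversely, every morphism `K_ω(Z) ⟶ im Γ` of mixed bimodules factors through `σ`. Monadicity then
makes `σ` an effective epimorphism, and since morphisms identified by `σ` are identified by `E`, the
projection onto `im E` factors through `σ`. From the resulting weak inverse `k` of `σ` the antipode
is `S(h) = (ε⊗1)k(h⊗1)` (`IsGalois.isHopf`).

The axioms are self-dual: passing to `Cᵒᵖ` exchanges monad with comonad and `σ` with `σ̄`, and fixes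
`ω`, `ξ`, `ξ̄`. The second family of equivalences is the first one for `B.op`. -/

namespace WeakBraidedBimonad

variable {C : Type u} [Category.{v} C] (B : WeakBraidedBimonad C) (X : C)

/-- `ξ = εH·ω·eH`, at `X`. -/
def xa : B.H.obj X ⟶ B.H.obj X := B.un (B.H.obj X) ≫ B.om X ≫ B.co (B.H.obj X)

theorem xi_app : B.xi.app X = B.xa X := rfl

theorem xa_nat {X Y : C} (f : X ⟶ Y) : B.H.map f ≫ B.xa Y = B.xa X ≫ B.H.map f :=
  B.xi.naturality f

/-! ### The target counital map -/

/-- This is the `τ'` form of weak multiplicativity of `ε`, with the unit as the middle factor. Since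
`ξ̄` is itself built from `ε·m`, it passes from here to `xb_mu_xb`. -/
theorem xb_ll : B.xb (B.H.obj X) ≫ B.ll X = B.ll X := by
  have h := B.Hun_mu (B.H.obj X)
  have h1 := B.ll_ll' X
  have h2 := B.ll_nat (B.ll X)
  rw [xb_eq3, Category.assoc, ← h2, kk, B.H.map_comp, B.H.map_comp]
  simp only [Category.assoc]
  rw [h1, reassoc_of% h]

theorem xb_mu_ll : B.xb (B.H.obj (B.H.obj X)) ≫ B.mu (B.H.obj X) ≫ B.ll X =
    B.mu (B.H.obj X) ≫ B.ll X := by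
  have h := B.xb_nat (B.mu X)
  have h1 := B.xb_ll X
  rw [ll] at *
  rw [← reassoc_of% (B.mu_assoc X), ← reassoc_of% h, h1]

theorem xb_mu_xb : B.xb (B.H.obj X) ≫ B.mu X ≫ B.xb X = B.mu X ≫ B.xb X := by
  have h1 := B.mu_nat (B.kk X ≫ B.tb X)
  have h2 := B.xb_nat (B.H.map (B.kk X ≫ B.tb X))
  have h3 := B.xb_mu_ll (B.H.obj X)
  rw [B.xb_eq3 X, ← reassoc_of% h1, ← reassoc_of% h2, h3]

theorem Hxb_mu_xb : B.H.map (B.xb X) ≫ B.mu X ≫ B.xb X =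
    B.H.map (B.xb X) ≫ B.xb (B.H.obj X) ≫ B.mu X := by
  rw [← xbxb_mu, xb_mu_xb]

/-- The formula `h₁ξ̄(h₂) = h`: unfolding `ξ̄` exhibits the left side as `δ(h·1)` with the counit
applied to its second leg. -/
theorem de_Hxb_mu : B.de X ≫ B.H.map (B.xb X) ≫ B.mu X = 𝟙 _ := by
  have h := B.de_nat (B.kk X)
  have h2 := B.mu_nat (B.ll X)
  have h1 := B.mu_de X
  rw [xb_eq1, B.H.map_comp, B.H.map_comp, Category.assoc, Category.assoc, ← reassoc_of% h, h2,
    ll, B.H.map_comp, kk, B.H.map_comp, Category.assoc, ← reassoc_of% h1, reassoc_of% (B.Hun_mu X),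
    de_Hco]

/-! ### `ω·eH` -/

theorem na_Hde : B.na X ≫ B.H.map (B.de X) = B.H.map (B.de X) ≫ B.na (B.H.obj X) := by
  have h1 : B.na X ≫ B.H.map (B.de X) ≫ B.na (B.H.obj X) = B.na X ≫ B.H.map (B.de X) := by
    rw [na, Category.assoc, reassoc_of% (B.ta_Hde X), ta_na, ← B.ta_Hde X,
      ← Category.assoc, ← na_def]
  have h2 : B.na X ≫ B.H.map (B.de X) ≫ B.na (B.H.obj X) =
      B.H.map (B.de X) ≫ B.na (B.H.obj X) := by
    rw [B.na_eq X, B.na_eq (B.H.obj X), reassoc_of% (B.Hde_ta X), Category.assoc,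
      reassoc_of% (B.ta_tb_ta X)]
  rw [← h1, h2]

theorem kk_Hta : B.kk (B.H.obj X) ≫ B.H.map (B.ta X) =
    B.H.map (B.kk X) ≫ B.tb (B.H.obj X) := by
  have h : B.un (B.H.obj X) ≫ B.ta X = B.H.map (B.un X) ≫ B.na X := (B.He_nabla X).symm
  rw [kk, kk, Category.assoc, B.de_Hta X, reassoc_of% h, reassoc_of% (B.na_Hde X), na_tb,
    B.H.map_comp, Category.assoc]

/-- A mixed form of the braid relation for endomorphisms with commuting weak inverses. -/
theorem braid_mixed {Y : C} {a a' b b' : Y ⟶ Y} (ha : a' ≫ a = a ≫ a')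
    (hra : a ≫ a' ≫ a = a)
    (hrb : b ≫ b' ≫ b = b) (hrb' : b' ≫ b ≫ b' = b') (hb' : b' ≫ b = b ≫ b')
    (hyb : b ≫ a ≫ b = a ≫ b ≫ a) (hab : (b' ≫ b) ≫ a = a ≫ b' ≫ b)
    (hba : (a' ≫ a) ≫ b' = b' ≫ a' ≫ a) : b' ≫ a' ≫ b ≫ a = a ≫ b' := by
  calc b' ≫ a' ≫ b ≫ a = b' ≫ a' ≫ b ≫ (b' ≫ b) ≫ a := by
        simp only [Category.assoc]; rw [reassoc_of% hrb]
    _ = b' ≫ a' ≫ (b ≫ a ≫ b) ≫ b' := by rw [hab, hb']; simp only [Category.assoc]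
    _ = (b' ≫ a' ≫ a) ≫ b ≫ a ≫ b' := by rw [hyb]; simp only [Category.assoc]
    _ = a' ≫ a ≫ ((b' ≫ b) ≫ a) ≫ b' := by rw [← hba]; simp only [Category.assoc]
    _ = (a' ≫ a ≫ a) ≫ b' ≫ b ≫ b' := by rw [hab]; simp only [Category.assoc]
    _ = a ≫ b' := by rw [hrb', reassoc_of% ha, hra]

theorem tb_Htb_ta_Hta :
    B.H.map (B.tb X) ≫ B.tb (B.H.obj X) ≫ B.H.map (B.ta X) ≫ B.ta (B.H.obj X) =
      B.ta (B.H.obj X) ≫ B.H.map (B.tb X) := by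
  apply braid_mixed
  · rw [← na_def, na_eq]
  · exact B.ta_tb_ta _
  · rw [← B.H.map_comp, ← B.H.map_comp, ta_tb_ta]
  · rw [← B.H.map_comp, ← B.H.map_comp, tb_ta_tb]
  · rw [← B.H.map_comp, ← B.H.map_comp, ← na_def, na_eq]
  · exact B.ybPair.yangBaxter X
  · rw [← B.H.map_comp]; exact B.Hna_ta X
  · exact B.ybPair.Htau_nablaH' X

/-- A copy of `δ·e` can be braided past a factor before its second leg is comultiplied. -/
theorem kk_Hta_HHde :
    B.kk (B.H.obj X) ≫ B.H.map (B.ta X) ≫ B.H.map (B.H.map (B.de X)) =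
      B.kk (B.H.obj X) ≫ B.H.map (B.ta X) ≫ B.H.map (B.H.map (B.H.map (B.kk X) ≫
        B.tb (B.H.obj X) ≫ B.mu (B.H.obj X))) := by
  have e1 : B.kk (B.H.obj X) ≫ B.H.map (B.de (B.H.obj X)) =
      B.kk (B.H.obj X) ≫ B.H.map (B.H.map (B.kk (B.H.obj X)) ≫
        B.tb (B.H.obj (B.H.obj X)) ≫ B.mu (B.H.obj (B.H.obj X))) := by
    simp only [B.H.map_comp, kk_kk']
    rw [kk, Category.assoc, de_coassoc, Category.assoc]
  have e2 : B.mu (B.H.obj (B.H.obj X)) ≫ B.H.map (B.ta X) ≫ B.ta (B.H.obj X) =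
      B.H.map (B.H.map (B.ta X)) ≫ B.H.map (B.ta (B.H.obj X)) ≫ B.ta (B.H.obj (B.H.obj X)) ≫
        B.H.map (B.mu (B.H.obj X)) := by
    rw [← reassoc_of% (B.mu_nat (B.ta X)), B.mu_ta (B.H.obj X)]
  have e3 := B.tb_nat (B.ta X)
  have e4 := B.ta_nat (B.kk X)
  have e5 : B.H.map (B.kk (B.H.obj X)) ≫ B.tb (B.H.obj (B.H.obj X)) ≫ B.mu (B.H.obj (B.H.obj X)) ≫
      B.H.map (B.ta X) ≫ B.ta (B.H.obj X) = B.ta X ≫ B.H.map (B.H.map (B.kk X) ≫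
        B.tb (B.H.obj X) ≫ B.mu (B.H.obj X)) := by
    rw [e2, ← reassoc_of% e3, ← B.H.map_comp_assoc (B.kk _), B.kk_Hta X, B.H.map_comp,
      Category.assoc, reassoc_of% (B.tb_Htb_ta_Hta (B.H.obj X)), reassoc_of% e4]
    simp only [B.H.map_comp]
  rw [← B.H.map_comp, B.ta_Hde X, B.H.map_comp, reassoc_of% e1, ← B.H.map_comp, ← B.H.map_comp,
    ← e5]
  simp only [Category.assoc]

theorem un_Hde_om : B.un (B.H.obj X) ≫ B.H.map (B.de X) ≫ B.om (B.H.obj X) =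
    B.de X ≫ B.kk (B.H.obj (B.H.obj X)) ≫ B.H.map (B.ta (B.H.obj X)) ≫
      B.mu (B.H.obj (B.H.obj X)) := by
  rw [om, ← reassoc_of% (B.un_nat (B.de X)), kk, Category.assoc]

/-- Rewrites `ξ(hg)` so that a copy of `δ·e` sits between `h` and `g`. It is the shape in which
`kk_Hta_HHde` can be applied in `un_om`. -/
theorem mu_xa : B.mu X ≫ B.xa X = B.H.map (B.kk (B.H.obj X)) ≫ B.tb (B.H.obj (B.H.obj X)) ≫
    B.mu (B.H.obj (B.H.obj X)) ≫ B.H.map (B.ta X) ≫ B.ll (B.H.obj X) := by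
  have h : B.H.map (B.mu (B.H.obj X)) ≫ B.ll (B.H.obj X) =
      B.mu (B.H.obj (B.H.obj X)) ≫ B.ll (B.H.obj X) := by
    rw [ll, reassoc_of% (B.mu_assoc (B.H.obj X))]
  have h1 := B.kk_nat (B.mu X)
  have h2 := B.mu_nat (B.ta X)
  rw [← reassoc_of% h2, ← h, ← reassoc_of% (B.kk_Hta (B.H.obj X))]
  rw [xa, om, ll]
  simp only [← B.H.map_comp_assoc, ← Category.assoc]
  rw [Category.assoc (B.mu X), ← kk, h1]
  simp only [Category.assoc, ← B.H.map_comp_assoc, B.Hmu_ta]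

/-- In a weak bialgebra this reads `1₁h⊗1₂ = h₁⊗ξ(h₂)`. Both sides are expressed through
`1₁h₁⊗1₂⊗h₂`: the left by compatibility of `ω` with `δ`, the right by writing `h` as `1·h`. The
remaining discrepancy is the weak comultiplicativity of the unit, contained in `kk_Hta_HHde`. -/
theorem un_om : B.un (B.H.obj X) ≫ B.om X = B.de X ≫ B.H.map (B.xa X) := by
  have hL : B.un (B.H.obj X) ≫ B.om X = B.de X ≫ B.kk (B.H.obj (B.H.obj X)) ≫
      B.H.map (B.ta (B.H.obj X)) ≫ B.mu (B.H.obj (B.H.obj X)) ≫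
        B.H.map (B.om X ≫ B.co (B.H.obj X)) := by
    rw [B.H.map_comp, ← reassoc_of% (B.un_Hde_om X), ← reassoc_of% (B.om_de X),
      de_Hco, Category.comp_id]
  have hD : B.de X = B.de X ≫ B.kk (B.H.obj (B.H.obj X)) ≫ B.H.map (B.ta (B.H.obj X)) ≫
      B.mu (B.H.obj (B.H.obj X)) ≫ B.H.map (B.mu X) := by
    rw [← reassoc_of% (B.un_Hde_om X), ← B.mu_de_om, reassoc_of% (B.un_mu X)]
  have hm1 := B.mu_nat (B.H.map (B.kk (B.H.obj X)) ≫ B.tb (B.H.obj (B.H.obj X)) ≫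
    B.mu (B.H.obj (B.H.obj X)))
  have hm2 := B.mu_nat (B.de (B.H.obj X))
  have h := B.kk_Hta_HHde (B.H.obj X)
  rw [hL]
  conv_rhs => rw [hD]
  simp only [Category.assoc]
  rw [← B.H.map_comp, mu_xa, om]
  simp only [Category.assoc]
  rw [B.H.map_comp (B.de _), ← reassoc_of% hm2, reassoc_of% h]
  rw [reassoc_of% hm1, ll]
  simp only [B.H.map_comp, Category.assoc]

/-! ### Idempotents on `H(X)` attached to modules over `H^ξ̄` -/

variable {B} in
/-- The conditions on `r : H(X) ⟶ X` that characterise the extensions `r = x·q` along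
`q : H ⟶ H^ξ̄` of associative actions `x` of `H^ξ̄` on `X`. -/
structure IsBaseAction {X : C} (r : B.H.obj X ⟶ X) : Prop where
  xb_comp : B.xb X ≫ r = r
  assoc : B.H.map r ≫ r = B.H.map (B.xb X) ≫ B.mu X ≫ r

namespace IsBaseAction

variable {B}
variable {X Y : C} {r : B.H.obj X ⟶ X} {s : B.H.obj Y ⟶ Y}

/-- Since `r` absorbs `ξ̄`, only `δ(hg)` with `ξ̄` on its second leg matters, and there it may be
replaced by `hg₁⊗g₂`. -/
theorem mu_de (hr : IsBaseAction r) :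
    B.mu X ≫ B.de X ≫ B.H.map r = B.H.map (B.de X ≫ B.H.map r) ≫ B.mu X := by
  rw [← hr.xb_comp, B.H.map_comp, reassoc_of% (B.mu_de_Hxb X), sb, Category.assoc,
    ← B.H.map_comp, hr.xb_comp, ← B.mu_nat, B.H.map_comp, Category.assoc]

theorem de_de (r : B.H.obj X ⟶ X) :
    B.de X ≫ B.H.map (B.de X ≫ B.H.map r) = (B.de X ≫ B.H.map r) ≫ B.de X := by
  rw [B.H.map_comp, reassoc_of% (B.de_coassoc X), Category.assoc, B.de_nat]

theorem de_comp (hr : IsBaseAction r) : (B.de X ≫ B.H.map r) ≫ r = r := by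
  rw [Category.assoc, hr.assoc, reassoc_of% (B.de_Hxb_mu X)]

theorem idem (hr : IsBaseAction r) :
    (B.de X ≫ B.H.map r) ≫ B.de X ≫ B.H.map r = B.de X ≫ B.H.map r := by
  rw [← Category.assoc, ← de_de, Category.assoc, ← B.H.map_comp, hr.de_comp]

/-- The defining relation of the tensor product over the base, which makes the idempotent `h⊗x ↦
h₁⊗r(h₂⊗x)` a projection onto it. It holds because `δ(hξ̄(g)) = h₁⊗h₂ξ̄(g)` and `r` is associative.
-/
theorem balanced (hr : IsBaseAction r) :
    B.H.map (B.xb X) ≫ B.mu X ≫ B.de X ≫ B.H.map r = B.H.map r ≫ B.de X ≫ B.H.map r := by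
  rw [reassoc_of% (B.Hxb_mu_de X), sg, Category.assoc, ← B.H.map_comp, reassoc_of% (B.de_nat (B.xb X)),
    ← B.H.map_comp, ← hr.assoc, B.H.map_comp, ← reassoc_of% (B.de_nat r)]

theorem un_de_comp (hr : IsBaseAction r) (hu : B.un X ≫ r = 𝟙 X) :
    B.un X ≫ B.de X ≫ B.H.map r ≫ r = 𝟙 X := by
  rw [← hu]
  conv_rhs => rw [← hr.de_comp]
  simp only [Category.assoc]

theorem naturality {f : X ⟶ Y} (h : B.H.map f ≫ s = r ≫ f) :
    B.H.map f ≫ B.de Y ≫ B.H.map s = (B.de X ≫ B.H.map r) ≫ B.H.map f := by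
  rw [reassoc_of% (B.de_nat f), ← B.H.map_comp, h, B.H.map_comp, Category.assoc]

end IsBaseAction

variable {B} in
-- Restriction of an `H`-action to the base; associativity is `ξ̄(hξ̄(g)) = ξ̄(h)ξ̄(g)`.
theorem IsBaseAction.of_action {X : C} {a : B.H.obj X ⟶ X} (ha : B.mu X ≫ a = B.H.map a ≫ a) :
    IsBaseAction (B.xb X ≫ a) where
  xb_comp := by rw [reassoc_of% (B.xb_idem X)]
  assoc := by
    rw [reassoc_of% (B.xb_mu_xb X).symm, reassoc_of% (B.xb_mu_xb X), B.H.map_comp, Category.assoc,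
      reassoc_of% (B.xb_nat a), ← ha]
    rw [reassoc_of% (B.Hxb_mu_xb X)]

section

variable {B} {S : NatSplitting B.xiBar}

/-- The action `H^ξ̄(X) ⟶ X` of an algebra. -/
def algAct (x : (B.xiMonad S).Algebra) : S.obj.obj x.A ⟶ x.A := x.a

/-- The action of an `H^ξ̄`-algebra, extended to `H(X)` along `q`. -/
def baseAct (x : (B.xiMonad S).Algebra) : B.H.obj x.A ⟶ x.A := S.proj.app x.A ≫ algAct x

theorem algAct_assoc (x : (B.xiMonad S).Algebra) :
    S.incl.app (S.obj.obj x.A) ≫ B.H.map (S.incl.app x.A) ≫ B.mu x.A ≫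
      S.proj.app x.A ≫ algAct x = S.obj.map (algAct x) ≫ algAct x := by
  have := x.assoc
  simpa [xiMonad] using! this

theorem un_baseAct (x : (B.xiMonad S).Algebra) : B.un x.A ≫ baseAct x = 𝟙 x.A := by
  have := x.unit
  simpa [xiMonad] using! this

theorem isBaseAction_baseAct (x : (B.xiMonad S).Algebra) : IsBaseAction (baseAct x) where
  xb_comp := by rw [baseAct, ← Category.assoc, B.xb_proj S]
  assoc := by
    have h2 := S.proj.naturality (algAct x)
    have hp : ∀ Y, S.proj.app Y ≫ S.incl.app Y = B.xb Y := S.pi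
    have h3 := S.proj.naturality (S.proj.app x.A)
    have h4 := S.incl.naturality (S.incl.app x.A)
    have h5 := S.incl.naturality (S.proj.app x.A)
    rw [baseAct, B.H.map_comp, Category.assoc, reassoc_of% h2, ← algAct_assoc, reassoc_of% h3,
      reassoc_of% h5, reassoc_of% (hp (B.H.obj x.A)), ← B.H.map_comp_assoc, hp,
      ← reassoc_of% (B.xb_nat (B.xb x.A)), reassoc_of% (B.Hxb_mu_xb x.A).symm,
      reassoc_of% (B.xb_proj S x.A)]

/-- The algebra of a unital base action. -/
def algOf {X : C} {r : B.H.obj X ⟶ X} (hr : IsBaseAction r) (hu : B.un X ≫ r = 𝟙 X) :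
    (B.xiMonad S).Algebra where
  A := X
  a := S.incl.app X ≫ r
  unit := by
    have hp : ∀ Y, S.proj.app Y ≫ S.incl.app Y = B.xb Y := S.pi
    show (B.un X ≫ S.proj.app X) ≫ S.incl.app X ≫ r = 𝟙 X
    rw [Category.assoc, reassoc_of% (hp X), hr.xb_comp, hu]
  assoc := by
    have hp : ∀ Y, S.proj.app Y ≫ S.incl.app Y = B.xb Y := S.pi
    have h := S.incl.naturality (S.incl.app X)
    have h2 := S.incl.naturality r
    show (S.incl.app (S.obj.obj X) ≫ B.H.map (S.incl.app X) ≫ B.mu X ≫ S.proj.app X) ≫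
      S.incl.app X ≫ r = S.obj.map (S.incl.app X ≫ r) ≫ S.incl.app X ≫ r
    simp only [Category.assoc]
    rw [reassoc_of% (hp X), hr.xb_comp, S.obj.map_comp, Category.assoc, reassoc_of% h2, hr.assoc,
      reassoc_of% h, ← B.H.map_comp_assoc, B.incl_xb S]

theorem baseAct_algOf {X : C} {r : B.H.obj X ⟶ X} (hr : IsBaseAction r) (hu : B.un X ≫ r = 𝟙 X) :
    baseAct (algOf (S := S) hr hu) = r := by
  show S.proj.app X ≫ S.incl.app X ≫ r = r
  have hp : ∀ Y, S.proj.app Y ≫ S.incl.app Y = B.xb Y := S.pi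
  rw [reassoc_of% (hp X), hr.xb_comp]

theorem baseAct_hom {x y : (B.xiMonad S).Algebra} (f : x ⟶ y) :
    B.H.map f.f ≫ baseAct y = baseAct x ≫ f.f := by
  have h : S.obj.map f.f ≫ algAct y = algAct x ≫ f.f := f.h
  have h2 := S.proj.naturality f.f
  rw [baseAct, baseAct, reassoc_of% h2, h, Category.assoc]

/-- A morphism compatible with the extended actions is a morphism of algebras. -/
def algHom {x y : (B.xiMonad S).Algebra} (f : x.A ⟶ y.A)
    (hf : B.H.map f ≫ baseAct y = baseAct x ≫ f) : x ⟶ y where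
  f := f
  h := by
    show S.obj.map f ≫ algAct y = algAct x ≫ f
    have h2 := S.incl.naturality f
    have h3 := S.incl.app x.A ≫= hf
    have hip : ∀ Y, S.incl.app Y ≫ S.proj.app Y = 𝟙 _ := S.ip
    rw [← reassoc_of% h2, baseAct, baseAct, Category.assoc, reassoc_of% (hip y.A),
      reassoc_of% (hip x.A)] at h3
    exact h3

end

/-! ### The maps `σ`, `Γ` and `Ē` for associative actions -/

section

variable {B} {A : C} {a : B.H.obj A ⟶ A}

/-- `H(H(A)) ⟶ H(A)`, the diagonal action on `H(A)`. -/
def diag (a : B.H.obj A ⟶ A) : B.H.obj (B.H.obj A) ⟶ B.H.obj A := B.om A ≫ B.H.map a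

/-- The diagonal action is associative but in general not unital: the unit acts by the idempotent
`Γ`, and the action becomes unital on the image of `Γ`. -/
theorem diag_assoc (ha : B.mu A ≫ a = B.H.map a ≫ a) :
    B.mu (B.H.obj A) ≫ diag a = B.H.map (diag a) ≫ diag a := by
  rw [diag, reassoc_of% (B.mu_om A), ← B.H.map_comp, ha, B.H.map_comp, B.H.map_comp,
    Category.assoc, ← reassoc_of% (B.om_nat a)]

theorem mu_sigma (ha : B.mu A ≫ a = B.H.map a ≫ a) :
    B.mu A ≫ B.de A ≫ B.H.map a = B.H.map (B.de A ≫ B.H.map a) ≫ diag a := by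
  rw [diag, reassoc_of% (B.mu_de_om A), ← B.H.map_comp, ha, B.H.map_comp, B.H.map_comp,
    Category.assoc, ← reassoc_of% (B.om_nat a)]

/-- A base element `b` satisfies `δ(b) = 1₁⊗1₂b`, so `b` can be moved onto the module before `σ` is
applied. -/
theorem xb_sigma (ha : B.mu A ≫ a = B.H.map a ≫ a) :
    B.xb A ≫ B.de A ≫ B.H.map a = B.xb A ≫ a ≫ B.un A ≫ B.de A ≫ B.H.map a := by
  rw [reassoc_of% (B.xb_de A), sg, Category.assoc, ← B.H.map_comp, ha, reassoc_of% (B.un_nat a),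
    reassoc_of% (B.de_nat a), B.H.map_comp]

theorem un_diag : B.un (B.H.obj A) ≫ diag a = B.de A ≫ B.H.map (B.xa A ≫ a) := by
  rw [diag, reassoc_of% (B.un_om A), B.H.map_comp]

theorem un_diag_de : (B.un (B.H.obj A) ≫ diag a) ≫ B.de A =
    B.de A ≫ B.H.map (B.un (B.H.obj A) ≫ diag a) := by
  rw [un_diag, Category.assoc, B.de_nat, B.H.map_comp (B.de A), reassoc_of% (B.de_coassoc A)]

theorem un_diag_idem (ha : B.mu A ≫ a = B.H.map a ≫ a) :
    (B.un (B.H.obj A) ≫ diag a) ≫ B.un (B.H.obj A) ≫ diag a = B.un (B.H.obj A) ≫ diag a :=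
  B.gam_idem ha

theorem diag_un_diag (ha : B.mu A ≫ a = B.H.map a ≫ a) :
    diag a ≫ B.un (B.H.obj A) ≫ diag a = diag a := by
  rw [reassoc_of% (B.un_nat (diag a)), ← diag_assoc ha, reassoc_of% (B.un_mu (B.H.obj A))]

theorem Hun_diag (ha : B.mu A ≫ a = B.H.map a ≫ a) :
    B.H.map (B.un (B.H.obj A) ≫ diag a) ≫ diag a = diag a := by
  rw [B.H.map_comp, Category.assoc, ← diag_assoc ha, reassoc_of% (B.Hun_mu (B.H.obj A))]

/-- `σ` is linear from the free action to the diagonal one. The unit acts as the identity on the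
source and as `Γ` on the target, so `σ` lands in the image of `Γ`. -/
theorem sigma_un_diag (ha : B.mu A ≫ a = B.H.map a ≫ a) :
    (B.de A ≫ B.H.map a) ≫ B.un (B.H.obj A) ≫ diag a = B.de A ≫ B.H.map a := by
  rw [← Category.assoc, B.un_nat (B.de A ≫ B.H.map a), Category.assoc, ← mu_sigma ha, reassoc_of% (B.un_mu A)]

theorem sigma_co : B.de A ≫ B.H.map a ≫ B.co A = a := by
  rw [B.co_nat, reassoc_of% (B.de_co A)]

theorem E_sigma (ha : B.mu A ≫ a = B.H.map a ≫ a) :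
    (B.de A ≫ B.H.map (B.xb A ≫ a)) ≫ B.de A ≫ B.H.map a = B.de A ≫ B.H.map a := by
  rw [Category.assoc, reassoc_of% (B.de_nat (B.xb A ≫ a)), ← B.H.map_comp,
    ← reassoc_of% (B.de_coassoc A),
    ← B.H.map_comp, B.H.map_comp (B.xb A), Category.assoc, ← ha, reassoc_of% (B.de_Hxb_mu A)]

end

end WeakBraidedBimonad

/-! ### Duality: the opposite weak braided bimonad -/

namespace WeakBraidedBimonad

open Opposite

variable {C : Type u} [Category.{v} C] (B : WeakBraidedBimonad C)

/-- The endomorphism of `H^op H^op` induced by an endomorphism of `HH`. -/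
def opHH {H : C ⥤ C} (t : H ⋙ H ⟶ H ⋙ H) : H.op ⋙ H.op ⟶ H.op ⋙ H.op where
  app X := (t.app X.unop).op
  naturality _ _ f := congrArg Quiver.Hom.op (t.naturality f.unop).symm

theorem unop_inj {X Y : Cᵒᵖ} {f g : X ⟶ Y} (h : f.unop = g.unop) : f = g :=
  Quiver.Hom.unop_inj h

/-- The dual weak braided bimonad on `Cᵒᵖ`: the monad and the comonad exchange their roles. -/
def op : WeakBraidedBimonad Cᵒᵖ where
  H := B.H.op
  m := ⟨fun X => (B.δ.app X.unop).op, fun _ _ f => unop_inj (B.δ.naturality f.unop).symm⟩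
  e := ⟨fun X => (B.ε.app X.unop).op, fun _ _ f => unop_inj (B.ε.naturality f.unop).symm⟩
  δ := ⟨fun X => (B.m.app X.unop).op, fun _ _ f => unop_inj (B.m.naturality f.unop).symm⟩
  ε := ⟨fun X => (B.e.app X.unop).op, fun _ _ f => unop_inj (B.e.naturality f.unop).symm⟩
  assoc X := unop_inj (B.coassoc X.unop)
  left_unit X := unop_inj (B.left_counit X.unop)
  right_unit X := unop_inj (B.right_counit X.unop)
  coassoc X := unop_inj (B.assoc X.unop)
  left_counit X := unop_inj (B.left_unit X.unop)
  right_counit X := unop_inj (B.right_unit X.unop)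
  τ := opHH B.τ
  τ' := opHH B.τ'
  ybPair := by
    constructor
    · ext X; exact unop_inj (by simpa using! B.ta_tb_ta X.unop)
    · ext X; exact unop_inj (by simpa using! B.tb_ta_tb X.unop)
    · ext X; exact unop_inj ((B.na_eq X.unop).symm)
    · intro X; exact unop_inj (by simpa using! B.ybPair.yangBaxter X.unop)
    · intro X; exact unop_inj (by simpa using! B.ybPair.yangBaxter' X.unop)
    · intro X
      have := B.ybPair.tauH_Hnabla X.unop
      rw [B.ybPair.comm] at this
      exact unop_inj (this.symm)
    · intro X
      have := B.ybPair.Htau_nablaH X.unop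
      rw [B.ybPair.comm] at this
      exact unop_inj (this.symm)
    · intro X
      have := B.ybPair.tauH_Hnabla' X.unop
      rw [B.ybPair.comm] at this
      exact unop_inj (this.symm)
    · intro X
      have := B.ybPair.Htau_nablaH' X.unop
      rw [B.ybPair.comm] at this
      exact unop_inj (this.symm)
  nabla_m X := by
    have := B.delta_nabla X.unop
    rw [B.ybPair.comm] at this
    exact unop_inj this
  delta_nabla X := by
    have := B.nabla_m X.unop
    rw [B.ybPair.comm] at this
    exact unop_inj this
  He_nabla X := by
    have := B.nabla_Heps X.unop
    rw [B.ybPair.comm] at this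
    exact unop_inj this
  nabla_Heps X := by
    have := B.He_nabla X.unop
    rw [B.ybPair.comm] at this
    exact unop_inj this
  eH_nabla X := by
    have := B.nabla_epsH X.unop
    rw [B.ybPair.comm] at this
    exact unop_inj this
  nabla_epsH X := by
    have := B.eH_nabla X.unop
    rw [B.ybPair.comm] at this
    exact unop_inj this
  tau_deltaH X := unop_inj (by simpa using! B.mH_tau X.unop)
  mH_tau X := unop_inj (by simpa using! B.tau_deltaH X.unop)
  tau_Hdelta X := unop_inj (by simpa using! B.Hm_tau X.unop)
  Hm_tau X := unop_inj (by simpa using! B.tau_Hdelta X.unop)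
  m_delta X := unop_inj (by
    show B.mu X.unop ≫ B.de X.unop = ((B.H.map (B.de X.unop) ≫ B.de (B.H.obj (B.H.obj X.unop))) ≫
      B.H.map (B.ta (B.H.obj X.unop))) ≫ B.mu (B.H.obj (B.H.obj X.unop)) ≫ B.H.map (B.mu X.unop)
    simp only [Category.assoc]
    exact B.mu_de X.unop)
  eps_mul X := unop_inj (by simpa using! B.unit_comul X.unop)
  eps_mul' X := unop_inj (by simpa using! B.unit_comul' X.unop)
  unit_comul X := unop_inj (by simpa using! B.eps_mul X.unop)
  unit_comul' X := unop_inj (by simpa using! B.eps_mul' X.unop)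

theorem op_om (X : Cᵒᵖ) : B.op.om X = (B.om X.unop).op :=
  unop_inj (by
    show (B.de (B.H.obj X.unop) ≫ B.H.map (B.ta X.unop)) ≫ B.mu (B.H.obj X.unop) = B.om X.unop
    rw [om, Category.assoc])

theorem op_xb (X : Cᵒᵖ) : B.op.xb X = (B.xb X.unop).op :=
  unop_inj (by
    show (B.H.map (B.un X.unop) ≫ (B.H.map (B.de X.unop) ≫ B.ta (B.H.obj X.unop)) ≫
      B.H.map (B.mu X.unop)) ≫ B.H.map (B.co X.unop) = B.xb X.unop
    simp only [xb, ob, Category.assoc])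

theorem op_xa (X : Cᵒᵖ) : B.op.xa X = (B.xa X.unop).op := by
  rw [xa, op_om]
  refine unop_inj ?_
  show (B.un (B.H.obj X.unop) ≫ B.om X.unop) ≫ B.co (B.H.obj X.unop) = B.xa X.unop
  rw [xa, Category.assoc]

/-- The dual of `un_om`. -/
theorem om_co (X : C) : B.om X ≫ B.co (B.H.obj X) = B.H.map (B.xa X) ≫ B.mu X := by
  have h := B.op.un_om (Opposite.op X)
  rw [op_om, op_xa] at h
  exact congrArg Quiver.Hom.unop h

/-- The natural transformation of opposite functors given by a natural transformation `H ⟶ H`. -/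
def opH (s : B.H ⟶ B.H) : B.op.H ⟶ B.op.H :=
  ⟨fun X => (s.app X.unop).op, fun _ _ f => unop_inj (s.naturality f.unop).symm⟩

/-- The natural transformation `H ⟶ H` given by one of opposite functors. -/
def unopH (s : B.op.H ⟶ B.op.H) : B.H ⟶ B.H :=
  ⟨fun X => (s.app (Opposite.op X)).unop,
    fun _ _ f => congrArg Quiver.Hom.unop (s.naturality f.op).symm⟩

theorem opH_injective {s t : B.H ⟶ B.H} (h : B.opH s = B.opH t) : s = t := by
  ext X
  exact congrArg (fun r : B.op.H ⟶ B.op.H => (r.app (Opposite.op X)).unop) h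

theorem conv_app (s t : B.H ⟶ B.H) (X : C) :
    (B.conv s t).app X = B.de X ≫ B.H.map (t.app X) ≫ s.app (B.H.obj X) ≫ B.mu X := by
  show B.de X ≫ (B.H.map (t.app X) ≫ s.app (B.H.obj X)) ≫ B.mu X = _
  rw [Category.assoc]

theorem conv_opH (s t : B.H ⟶ B.H) : B.op.conv (B.opH s) (B.opH t) = B.opH (B.conv s t) := by
  ext X
  refine unop_inj ?_
  show (B.de X.unop ≫ (s.app (B.H.obj X.unop) ≫ B.H.map (t.app X.unop))) ≫ B.mu X.unop =
    B.de X.unop ≫ (B.H.map (t.app X.unop) ≫ s.app (B.H.obj X.unop)) ≫ B.mu X.unop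
  rw [s.naturality, Category.assoc]

theorem opH_id : B.opH (𝟙 B.H) = 𝟙 B.op.H := rfl

theorem opH_xi : B.opH B.xi = B.op.xi := by
  ext X
  exact (B.op_xa X).symm

theorem opH_xiBar : B.opH B.xiBar = B.op.xiBar := by
  ext X
  exact (B.op_xb X).symm

theorem isWeakAntipode_opH (s : B.H ⟶ B.H) :
    B.op.IsWeakAntipode (B.opH s) ↔ B.IsWeakAntipode s := by
  constructor
  · rintro ⟨h1, h2, h3⟩
    rw [← opH_id, conv_opH] at *
    exact ⟨B.opH_injective (by rw [h1, opH_xi]), B.opH_injective (by rw [h2, opH_xiBar]),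
      B.opH_injective (by rw [← conv_opH, h3])⟩
  · rintro ⟨h1, h2, h3⟩
    refine ⟨?_, ?_, ?_⟩ <;> rw [← opH_id]
    · rw [conv_opH, h1, opH_xi]
    · rw [conv_opH, h2, opH_xiBar]
    · rw [conv_opH, conv_opH, h3]

/-- Convolution, `ξ` and `ξ̄` are all preserved by passing to the opposite, so a weak antipode for
one is a weak antipode for the other. -/
theorem isHopf_op : B.op.IsHopf ↔ B.IsHopf :=
  ⟨fun ⟨s, hs⟩ => ⟨B.unopH s, (B.isWeakAntipode_opH (B.unopH s)).1 hs⟩,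
    fun ⟨s, hs⟩ => ⟨B.opH s, (B.isWeakAntipode_opH s).2 hs⟩⟩

end WeakBraidedBimonad

namespace WeakBraidedBimonad

variable {C : Type u} [Category.{v} C] {B : WeakBraidedBimonad C}

/-! ### The category of mixed bimodules -/

namespace MixedBimodule

theorem hom_ext {M N : B.MixedBimodule} {f g : M ⟶ N} (h : Hom.f f = Hom.f g) : f = g :=
  Hom.ext h

/-- A morphism of mixed bimodules with an inverse in the base category is an isomorphism. -/
def isoMk {M N : B.MixedBimodule} (f : M ⟶ N) (g : N.A ⟶ M.A) (h1 : Hom.f f ≫ g = 𝟙 _)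
    (h2 : g ≫ Hom.f f = 𝟙 _) : M ≅ N where
  hom := f
  inv :=
    { f := g
      h := by
        have hf := Hom.h f
        have := B.H.map g ≫= hf =≫ g
        simp only [Category.assoc, h1, Category.comp_id] at this
        rw [← this, ← B.H.map_comp_assoc, h2, B.H.map_id, Category.id_comp]
      θ := by
        have hf := Hom.θ f
        have := g ≫= hf =≫ B.H.map g
        simp only [Category.assoc] at this
        rw [reassoc_of% h2, ← B.H.map_comp, h1, B.H.map_id, Category.comp_id] at this
        exact this.symm }
  hom_inv_id := hom_ext h1
  inv_hom_id := hom_ext h2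

/-- The mixed bimodule on a retract given by an idempotent endomorphism. -/
def ofSplitting (M : B.MixedBimodule) (f : M ⟶ M) {Y : C} (i : Y ⟶ M.A) (p : M.A ⟶ Y)
    (hip : i ≫ p = 𝟙 Y) (hpi : p ≫ i = Hom.f f) : B.MixedBimodule where
  A := Y
  h := B.H.map i ≫ M.h ≫ p
  θ := i ≫ M.θ ≫ B.H.map p
  unit := by rw [← reassoc_of% (B.un_nat i), reassoc_of% M.unit, hip]
  assoc := by
    have hf := Hom.h f
    have hi : i ≫ Hom.f f = i := by rw [← hpi, reassoc_of% hip]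
    have hp : Hom.f f ≫ p = p := by rw [← hpi, Category.assoc, hip, Category.comp_id]
    rw [← reassoc_of% (B.mu_nat i), reassoc_of% M.assoc]
    simp only [B.H.map_comp, Category.assoc]
    rw [← B.H.map_comp_assoc p, hpi, reassoc_of% hf, hp]
  counit := by
    rw [Category.assoc, Category.assoc, B.co_nat, reassoc_of% M.counit, hip]
  coassoc := by
    have hf := Hom.θ f
    have hi : i ≫ Hom.f f = i := by rw [← hpi, reassoc_of% hip]
    simp only [B.H.map_comp, Category.assoc]
    rw [B.de_nat, ← B.H.map_comp_assoc p, hpi, reassoc_of% hf, reassoc_of% hi,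
      reassoc_of% M.coassoc]
  compat := by
    have hf := Hom.h f
    have hf' := Hom.θ f
    have hi : i ≫ Hom.f f = i := by rw [← hpi, reassoc_of% hip]
    have hp : Hom.f f ≫ p = p := by rw [← hpi, Category.assoc, hip, Category.comp_id]
    simp only [B.H.map_comp, Category.assoc]
    have h1 : M.h ≫ p ≫ i ≫ M.θ ≫ B.H.map p = M.h ≫ M.θ ≫ B.H.map p := by
      rw [reassoc_of% hpi, ← reassoc_of% hf', ← B.H.map_comp, hp]
    have h2 : B.H.map i ≫ B.H.map M.θ ≫ B.H.map (B.H.map p) ≫ B.H.map (B.H.map i) =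
        B.H.map i ≫ B.H.map M.θ := by
      simp only [← B.H.map_comp]
      rw [hpi, hf', reassoc_of% hi]
    rw [h1, ← reassoc_of% (B.om_nat i), reassoc_of% h2, reassoc_of% M.compat]

/-- Allows the base idempotent to be split among mixed bimodules, which is how the induced bimodule
`H⊗X` over the base is formed. -/
instance [IsIdempotentComplete C] : IsIdempotentComplete B.MixedBimodule where
  idempotents_split M f hf := by
    obtain ⟨Y, i, p, hip, hpi⟩ := IsIdempotentComplete.idempotents_split M.A (Hom.f f)
      (congrArg Hom.f hf)
    have hi : i ≫ Hom.f f = i := by rw [← hpi, reassoc_of% hip]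
    have hp : Hom.f f ≫ p = p := by rw [← hpi, Category.assoc, hip, Category.comp_id]
    have hh := Hom.h f
    have hθ := Hom.θ f
    refine ⟨M.ofSplitting f i p hip hpi, ⟨i, ?_, ?_⟩, ⟨p, ?_, ?_⟩, hom_ext hip, hom_ext hpi⟩
    · show B.H.map i ≫ M.h = (B.H.map i ≫ M.h ≫ p) ≫ i
      simp only [Category.assoc]
      rw [hpi, ← hh, ← B.H.map_comp_assoc, hi]
    · show (i ≫ M.θ ≫ B.H.map p) ≫ B.H.map i = i ≫ M.θ
      simp only [Category.assoc]
      rw [← B.H.map_comp, hpi, hθ, reassoc_of% hi]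
    · show B.H.map p ≫ B.H.map i ≫ M.h ≫ p = M.h ≫ p
      rw [← B.H.map_comp_assoc, hpi, reassoc_of% hh, hp]
    · show M.θ ≫ B.H.map p = p ≫ i ≫ M.θ ≫ B.H.map p
      rw [reassoc_of% hpi, ← reassoc_of% hθ, ← B.H.map_comp, hp]

end MixedBimodule

/-! ### The functor from `H^ξ̄`-modules to mixed bimodules -/

section

variable {S : NatSplitting B.xiBar}

open MixedBimodule

/-- The idempotent `h⊗x ↦ h₁⊗ξ̄(h₂)x` on `H(X)` for an `H^ξ̄`-module `X`. -/
def baseIdem (S : NatSplitting B.xiBar) :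
    (B.xiMonad S).forget ⋙ B.Komega ⟶ (B.xiMonad S).forget ⋙ B.Komega where
  app x :=
    { f := B.de x.A ≫ B.H.map (baseAct x)
      h := by
        have := (isBaseAction_baseAct x).mu_de
        exact this.symm
      θ := IsBaseAction.de_de _ }
  naturality x y f := hom_ext (IsBaseAction.naturality (baseAct_hom f))

theorem baseIdem_idem (S : NatSplitting B.xiBar) : baseIdem S ≫ baseIdem S = baseIdem S := by
  ext x
  exact hom_ext (isBaseAction_baseAct x).idem

theorem eq_map_un_comp {X A : C} {a : B.H.obj A ⟶ A} {g : B.H.obj X ⟶ A}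
    (hg : B.H.map g ≫ a = B.mu X ≫ g) : g = B.H.map (B.un X ≫ g) ≫ a := by
  rw [B.H.map_comp, Category.assoc, hg, reassoc_of% (B.Hun_mu X)]

/-- A morphism of modules and comodules from a free module is given by a coinvariant morphism. -/
theorem un_comp_coinvariant {X A : C} {a : B.H.obj A ⟶ A} {t : A ⟶ B.H.obj A}
    {g : B.H.obj X ⟶ A} (hg : B.H.map g ≫ a = B.mu X ≫ g) (hg' : B.de X ≫ B.H.map g = g ≫ t) :
    (B.un X ≫ g) ≫ t = (B.un X ≫ g) ≫ B.un A ≫ B.de A ≫ B.H.map a := by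
  have h := B.un_nat (B.un X ≫ g)
  simp only [Category.assoc] at h ⊢
  rw [reassoc_of% h, reassoc_of% (B.de_nat (B.un X ≫ g)), ← B.H.map_comp, ← eq_map_un_comp hg, hg']

section

variable {X Y : C} {g : B.H.obj X ⟶ B.H.obj Y}

/-- The morphism `X ⟶ H(Y)` given by a morphism `H(X) ⟶ H(Y)` of mixed bimodules takes values
in the base. -/
theorem un_comp_xb (hg : B.H.map g ≫ B.mu Y = B.mu X ≫ g)
    (hg' : B.de X ≫ B.H.map g = g ≫ B.de Y) : (B.un X ≫ g) ≫ B.xb Y = B.un X ≫ g :=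
  B.eq_xb_of_de _ (un_comp_coinvariant hg hg')

/-- A morphism `H(X) ⟶ H(Y)` of mixed bimodules that is invariant under the idempotent of a base
action on `Y` is determined by a morphism `X ⟶ Y`. -/
theorem map_un_comp (hg : B.H.map g ≫ B.mu Y = B.mu X ≫ g)
    (hg' : B.de X ≫ B.H.map g = g ≫ B.de Y) {s : B.H.obj Y ⟶ Y} (hs : IsBaseAction s) :
    B.H.map (B.un X ≫ g ≫ s) ≫ B.de Y ≫ B.H.map s = g ≫ B.de Y ≫ B.H.map s := by
  have h := un_comp_xb hg hg'
  -- As `e ≫ g` lands in the image of `ξ̄`, balancedness trades the action `s` for a multiplication,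
  -- and that rebuilds `g` from its restriction along the unit.
  rw [← Category.assoc (B.un X), B.H.map_comp, Category.assoc, ← hs.balanced,
    ← B.H.map_comp_assoc, h, ← reassoc_of% (eq_map_un_comp hg)]

/-- The morphism `X ⟶ Y` underlying a morphism between induced mixed bimodules is compatible with
the base actions. -/
theorem action_un_comp (hg : B.H.map g ≫ B.mu Y = B.mu X ≫ g)
    (hg' : B.de X ≫ B.H.map g = g ≫ B.de Y) {r : B.H.obj X ⟶ X} {s : B.H.obj Y ⟶ Y}
    (hr : IsBaseAction r) (hs : IsBaseAction s) (hrg : (B.de X ≫ B.H.map r) ≫ g = g) :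
    B.H.map (B.un X ≫ g ≫ s) ≫ s = r ≫ B.un X ≫ g ≫ s := by
  have h := un_comp_xb hg hg'
  -- Invariance under the idempotent of `r` lets `g` inherit the balancing relation.
  have h1 : B.H.map r ≫ g = B.H.map (B.xb X) ≫ B.mu X ≫ g := by
    rw [← hrg, Category.assoc, ← reassoc_of% hr.balanced]
  have h2 := B.un_nat (B.xb X)
  have h3 := eq_map_un_comp hg
  have h4 := B.xb_nat (B.un X ≫ g)
  calc B.H.map (B.un X ≫ g ≫ s) ≫ s
      = B.H.map ((B.un X ≫ g) ≫ B.xb Y) ≫ B.mu Y ≫ s := by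
        rw [B.H.map_comp _ (B.xb Y), Category.assoc, ← hs.assoc, ← B.H.map_comp_assoc,
          Category.assoc]
    _ = B.H.map (B.un X ≫ g) ≫ B.mu Y ≫ B.xb Y ≫ s := by rw [h, hs.xb_comp]
    _ = B.H.map (B.un X ≫ g) ≫ B.xb (B.H.obj Y) ≫ B.mu Y ≫ s := by
        rw [← hs.xb_comp, reassoc_of% (B.xb_mu_xb Y), reassoc_of% (B.xb_idem Y)]
    _ = B.xb X ≫ g ≫ s := by rw [reassoc_of% h4, ← reassoc_of% h3]
    _ = r ≫ B.un X ≫ g ≫ s := by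
        rw [reassoc_of% (B.un_nat r), reassoc_of% h1, ← reassoc_of% h2,
          reassoc_of% (B.un_mu X)]

end

variable (N : NatSplitting (baseIdem S))

/-- The underlying morphism `H(X) ⟶ H(Y)` of a morphism between split mixed bimodules. -/
def lift {x y : (B.xiMonad S).Algebra} (g : N.obj.obj x ⟶ N.obj.obj y) :
    B.H.obj x.A ⟶ B.H.obj y.A := Hom.f (N.proj.app x ≫ g ≫ N.incl.app y)

section

variable {N} {x y : (B.xiMonad S).Algebra}

theorem lift_h (g : N.obj.obj x ⟶ N.obj.obj y) :
    B.H.map (lift N g) ≫ B.mu y.A = B.mu x.A ≫ lift N g :=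
  Hom.h (N.proj.app x ≫ g ≫ N.incl.app y)

theorem lift_θ (g : N.obj.obj x ⟶ N.obj.obj y) :
    B.de x.A ≫ B.H.map (lift N g) = lift N g ≫ B.de y.A :=
  Hom.θ (N.proj.app x ≫ g ≫ N.incl.app y)

theorem baseIdem_lift (g : N.obj.obj x ⟶ N.obj.obj y) :
    (B.de x.A ≫ B.H.map (baseAct x)) ≫ lift N g = lift N g := by
  have h : (baseIdem S).app x ≫ N.proj.app x ≫ g ≫ N.incl.app y =
      N.proj.app x ≫ g ≫ N.incl.app y := by
    rw [← N.pi x, Category.assoc, reassoc_of% (N.ip x)]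
  exact congrArg Hom.f h

theorem lift_baseIdem (g : N.obj.obj x ⟶ N.obj.obj y) :
    lift N g ≫ B.de y.A ≫ B.H.map (baseAct y) = lift N g := by
  have h : (N.proj.app x ≫ g ≫ N.incl.app y) ≫ (baseIdem S).app y =
      N.proj.app x ≫ g ≫ N.incl.app y := by
    rw [← N.pi y, Category.assoc, Category.assoc, reassoc_of% (N.ip y)]
  exact congrArg Hom.f h

theorem lift_map (k : x ⟶ y) :
    lift N (N.obj.map k) = B.H.map k.f ≫ B.de y.A ≫ B.H.map (baseAct y) := by
  have h : N.proj.app x ≫ N.obj.map k ≫ N.incl.app y =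
      B.Komega.map k.f ≫ (baseIdem S).app y := by
    rw [← N.pi y, ← N.proj.naturality_assoc]
    rfl
  exact congrArg Hom.f h

theorem lift_injective {g g' : N.obj.obj x ⟶ N.obj.obj y} (h : lift N g = lift N g') : g = g' := by
  have h' : N.proj.app x ≫ g ≫ N.incl.app y = N.proj.app x ≫ g' ≫ N.incl.app y := hom_ext h
  have := N.incl.app x ≫= h' =≫ N.proj.app y
  simpa only [Category.assoc, N.ip, Category.comp_id, reassoc_of% (N.ip x)] using this

end

/-- A morphism of base modules is recovered from the induced one by inserting the unit and then
acting. -/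
theorem faithful_of_split : N.obj.Faithful where
  map_injective {x y} f f' h := by
    have key : ∀ k : x ⟶ y, k.f = B.un x.A ≫ lift N (N.obj.map k) ≫ baseAct y := by
      intro k
      have h1 := un_baseAct y
      rw [lift_map, Category.assoc, (isBaseAction_baseAct y).de_comp,
        ← reassoc_of% (B.un_nat k.f), h1, Category.comp_id]
    ext
    rw [key f, key f', h]

/-- The preimage of `g` is `x ↦ g(1⊗x)` followed by the base action. It induces `g` again because
`g(1⊗x)` lies in the base part of `H(Y)`; no antipode enters. -/
theorem full_of_split : N.obj.Full where
  map_surjective {x y} g := by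
    refine ⟨algHom (B.un x.A ≫ lift N g ≫ baseAct y) (action_un_comp (lift_h g) (lift_θ g)
      (isBaseAction_baseAct x) (isBaseAction_baseAct y) (baseIdem_lift g)), lift_injective ?_⟩
    rw [lift_map]
    exact (map_un_comp (lift_h g) (lift_θ g) (isBaseAction_baseAct y)).trans (lift_baseIdem g)

theorem incl_mu_de (S : NatSplitting B.xiBar) (X : C) :
    B.H.map (S.incl.app X) ≫ B.mu X ≫ B.de X =
      B.de (S.obj.obj X) ≫ B.H.map (B.H.map (S.incl.app X) ≫ B.mu X) := by
  have h := B.de_nat (S.incl.app X)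
  rw [B.H.map_comp, ← reassoc_of% h, ← B.incl_xb S X, B.H.map_comp, Category.assoc,
    B.Hxb_mu_de X, Category.assoc, sg]

/-- The morphism `m·Hι : H H^ξ̄(X) ⟶ H(X)` of mixed bimodules. -/
def counitHom (S : NatSplitting B.xiBar) (X : C) :
    B.Komega.obj (S.obj.obj X) ⟶ B.Komega.obj X where
  f := B.H.map (S.incl.app X) ≫ B.mu X
  h := by
    show B.H.map (B.H.map (S.incl.app X) ≫ B.mu X) ≫ B.mu X =
      B.mu _ ≫ B.H.map (S.incl.app X) ≫ B.mu X
    rw [B.H.map_comp, Category.assoc, B.mu_assoc, reassoc_of% (B.mu_nat (S.incl.app X))]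
  θ := by
    refine (incl_mu_de S X).symm.trans ?_
    exact (Category.assoc _ _ _).symm

theorem counitHom_nat {X Y : C} (f : X ⟶ Y) :
    B.H.map (S.obj.map f) ≫ B.H.map (S.incl.app Y) ≫ B.mu Y =
      (B.H.map (S.incl.app X) ≫ B.mu X) ≫ B.H.map f := by
  have h := S.incl.naturality f
  rw [← B.H.map_comp_assoc, h, B.H.map_comp, Category.assoc, B.mu_nat, Category.assoc]

theorem baseAct_free (X : C) :
    baseAct ((B.xiMonad S).free.obj X) = B.H.map (S.incl.app X) ≫ B.mu X ≫ S.proj.app X := by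
  have hp : ∀ Y, S.proj.app Y ≫ S.incl.app Y = B.xb Y := S.pi
  show S.proj.app (S.obj.obj X) ≫ S.incl.app (S.obj.obj X) ≫ B.H.map (S.incl.app X) ≫ B.mu X ≫
    S.proj.app X = _
  rw [reassoc_of% (hp (S.obj.obj X)), ← reassoc_of% (B.xb_nat (S.incl.app X)), ← B.xb_proj S,
    reassoc_of% (B.xb_mu_xb X)]

/-- Factors the base idempotent of a free module as `m·Hι` followed by its section `Hq·δ`. This
second splitting, through `H(X)`, is what `freeIso` compares with the chosen one. -/
theorem baseIdem_free (X : C) :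
    B.de (S.obj.obj X) ≫ B.H.map (baseAct ((B.xiMonad S).free.obj X)) =
      (B.H.map (S.incl.app X) ≫ B.mu X) ≫ B.de X ≫ B.H.map (S.proj.app X) := by
  refine (congrArg (fun t => B.de (S.obj.obj X) ≫ B.H.map t) (baseAct_free X)).trans ?_
  rw [Category.assoc, reassoc_of% (incl_mu_de S X), ← B.H.map_comp, Category.assoc]
  rfl

theorem de_proj_incl_mu (X : C) :
    (B.de X ≫ B.H.map (S.proj.app X)) ≫ B.H.map (S.incl.app X) ≫ B.mu X = 𝟙 _ := by
  have hp : ∀ Y, S.proj.app Y ≫ S.incl.app Y = B.xb Y := S.pi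
  rw [Category.assoc, ← B.H.map_comp_assoc, hp, de_Hxb_mu]

/-- Two splittings of the same idempotent have canonically isomorphic middle objects. -/
theorem splittings_comp {P T Q : C} {i : P ⟶ T} {p : T ⟶ P} {f : T ⟶ Q} {g : Q ⟶ T}
    (hip : i ≫ p = 𝟙 P) (hgf : g ≫ f = 𝟙 Q) (h : p ≫ i = f ≫ g) :
    (i ≫ f) ≫ g ≫ p = 𝟙 P ∧ (g ≫ p) ≫ i ≫ f = 𝟙 Q := by
  constructor
  · rw [Category.assoc, ← reassoc_of% h, reassoc_of% hip, hip]
  · rw [Category.assoc, reassoc_of% h, hgf, Category.comp_id, hgf]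

/-- The inclusion of the split mixed bimodule of a free module. -/
def freeIncl (X : C) :
    N.obj.obj ((B.xiMonad S).free.obj X) ⟶ B.Komega.obj (S.obj.obj X) :=
  N.incl.app ((B.xiMonad S).free.obj X)

theorem freeIncl_nat {X Y : C} (f : X ⟶ Y) :
    N.obj.map ((B.xiMonad S).free.map f) ≫ freeIncl N Y =
      freeIncl N X ≫ B.Komega.map (S.obj.map f) :=
  N.incl.naturality ((B.xiMonad S).free.map f)

/-- On free modules the functor is `K_ω`. -/
def freeIso : (B.xiMonad S).free ⋙ N.obj ≅ B.Komega :=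
  have h (X : C) := splittings_comp (congrArg Hom.f (N.ip ((B.xiMonad S).free.obj X)))
    (de_proj_incl_mu (S := S) X)
    ((congrArg Hom.f (N.pi ((B.xiMonad S).free.obj X))).trans (baseIdem_free (S := S) X))
  NatIso.ofComponents (fun X => isoMk (freeIncl N X ≫ counitHom S X)
    ((B.de X ≫ B.H.map (S.proj.app X)) ≫ Hom.f (N.proj.app ((B.xiMonad S).free.obj X)))
    (h X).1 (h X).2)
    (fun {X Y} f => by
      have h1 : B.Komega.map (S.obj.map f) ≫ counitHom S Y = counitHom S X ≫ B.Komega.map f :=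
        hom_ext (counitHom_nat f)
      show N.obj.map ((B.xiMonad S).free.map f) ≫ freeIncl N Y ≫ counitHom S Y =
        (freeIncl N X ≫ counitHom S X) ≫ B.Komega.map f
      rw [reassoc_of% (freeIncl_nat N f), Category.assoc, h1])

end

/-! ### Essential surjectivity in the presence of a weak antipode -/

section

variable {s : B.H ⟶ B.H} {A : C} {a : B.H.obj A ⟶ A}

theorem de_comp_de {A X Y : C} (f : B.H.obj A ⟶ X) (g : B.H.obj X ⟶ Y) :
    (B.de A ≫ B.H.map f) ≫ B.de X ≫ B.H.map g = B.de A ≫ B.H.map (B.de A ≫ B.H.map f ≫ g) := by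
  rw [Category.assoc, reassoc_of% (B.de_nat f), ← B.H.map_comp, ← reassoc_of% (B.de_coassoc A),
    ← B.H.map_comp]

/-- The map `h⊗x ↦ h₁⊗S(h₂)x`. -/
def kappa (s : B.H ⟶ B.H) (a : B.H.obj A ⟶ A) : B.H.obj A ⟶ B.H.obj A :=
  B.de A ≫ B.H.map (s.app A ≫ a)

theorem de_antipode_mu (hs : B.IsWeakAntipode s) (X : C) :
    B.de X ≫ s.app (B.H.obj X) ≫ B.mu X = B.xb X := by
  have h := congrArg (fun t : B.H ⟶ B.H => t.app X) hs.conv_id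
  simp only [conv_app, NatTrans.id_app, B.H.map_id, Category.id_comp] at h
  exact h

theorem de_Hantipode_mu (hs : B.IsWeakAntipode s) (X : C) :
    B.de X ≫ B.H.map (s.app X) ≫ B.mu X = B.xa X := by
  have h := congrArg (fun t : B.H ⟶ B.H => t.app X) hs.id_conv
  simp only [conv_app, NatTrans.id_app, Category.id_comp] at h
  exact h

theorem sigma_kappa (hs : B.IsWeakAntipode s) (ha : B.mu A ≫ a = B.H.map a ≫ a) :
    (B.de A ≫ B.H.map a) ≫ kappa s a = B.de A ≫ B.H.map (B.xb A ≫ a) := by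
  rw [kappa, de_comp_de, s.naturality_assoc, ← ha, ← reassoc_of% (de_antipode_mu hs A)]

theorem kappa_sigma (hs : B.IsWeakAntipode s) (ha : B.mu A ≫ a = B.H.map a ≫ a) :
    kappa s a ≫ B.de A ≫ B.H.map a = B.de A ≫ B.H.map (B.xa A ≫ a) := by
  rw [kappa, de_comp_de, B.H.map_comp (s.app A) a, Category.assoc, ← ha,
    ← reassoc_of% (de_Hantipode_mu hs A)]

end

section

variable {s : B.H ⟶ B.H} (hs : B.IsWeakAntipode s) (M : B.MixedBimodule)

/-- In elements, `ξ(a₋₁)a₀ = a`: the compatibility of a mixed bimodule evaluated on `1·a`, with the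
counit applied. -/
theorem theta_xa : M.θ ≫ B.xa M.A ≫ M.h = 𝟙 M.A := by
  rw [xa]
  simp only [Category.assoc]
  rw [← B.co_nat M.h, reassoc_of% (B.un_nat M.θ), ← reassoc_of% M.compat, M.counit,
    Category.comp_id, M.unit]

theorem h_theta : M.h ≫ M.θ = B.H.map M.θ ≫ diag M.h := M.compat

/-- The splitting `a ↦ a₋₂⊗S(a₋₁)a₀` of the action. -/
def chi (s : B.H ⟶ B.H) : M.A ⟶ B.H.obj M.A := M.θ ≫ kappa s M.h

theorem chi_sigma (hs : B.IsWeakAntipode s) : chi M s ≫ B.de M.A ≫ B.H.map M.h = M.θ := by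
  rw [chi, Category.assoc, kappa_sigma hs M.assoc, reassoc_of% M.coassoc, ← B.H.map_comp, theta_xa,
    B.H.map_id, Category.comp_id]

theorem chi_idem (hs : B.IsWeakAntipode s) :
    chi M s ≫ B.de M.A ≫ B.H.map (B.xb M.A ≫ M.h) = chi M s := by
  rw [← sigma_kappa hs M.assoc, ← Category.assoc, chi_sigma M hs, chi]

theorem h_chi (hs : B.IsWeakAntipode s) : M.h ≫ chi M s = B.H.map (chi M s) ≫ B.mu M.A := by
  have h1 := (IsBaseAction.of_action M.assoc).mu_de
  have h2 := mu_sigma M.assoc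
  conv_rhs => rw [← chi_idem M hs, B.H.map_comp, Category.assoc, ← h1,
    ← sigma_kappa hs M.assoc, ← Category.assoc (B.mu M.A), h2, Category.assoc,
    ← B.H.map_comp_assoc, chi_sigma M hs, ← reassoc_of% (h_theta M), ← chi]

theorem Hun_sigma_diag : B.H.map (B.un M.A ≫ B.de M.A ≫ B.H.map M.h) ≫ diag M.h =
    B.de M.A ≫ B.H.map M.h := by
  rw [B.H.map_comp, Category.assoc, ← mu_sigma M.assoc, reassoc_of% (B.Hun_mu M.A)]

/-- Expresses that `S(a₋₁)a₀` is coinvariant, with `a₋₂` carried along. After `σ` for the diagonal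
action on `H(A)` both sides become the iterated coaction `a₋₂⊗a₋₁⊗a₀`. Applying `κ` cancels `σ` up
to the idempotent `E`, which `chi` absorbs. -/
theorem chi_theta (hs : B.IsWeakAntipode s) :
    chi M s ≫ B.H.map M.θ = chi M s ≫ B.H.map (B.un M.A ≫ B.de M.A ≫ B.H.map M.h) := by
  have hD := diag_assoc M.assoc
  have e1 : (chi M s ≫ B.H.map M.θ) ≫ B.de (B.H.obj M.A) ≫ B.H.map (diag M.h) =
      (chi M s ≫ B.H.map (B.un M.A ≫ B.de M.A ≫ B.H.map M.h)) ≫ B.de (B.H.obj M.A) ≫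
        B.H.map (diag M.h) := by
    have l : (chi M s ≫ B.H.map M.θ) ≫ B.de (B.H.obj M.A) ≫ B.H.map (diag M.h) =
        M.θ ≫ B.H.map M.θ := by
      rw [Category.assoc, reassoc_of% (B.de_nat M.θ), ← B.H.map_comp, ← h_theta, B.H.map_comp,
        reassoc_of% (chi_sigma M hs)]
    have r : (chi M s ≫ B.H.map (B.un M.A ≫ B.de M.A ≫ B.H.map M.h)) ≫ B.de (B.H.obj M.A) ≫
        B.H.map (diag M.h) = M.θ ≫ B.H.map M.θ := by
      rw [Category.assoc, reassoc_of% (B.de_nat (B.un M.A ≫ B.de M.A ≫ B.H.map M.h)),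
        ← B.H.map_comp, Hun_sigma_diag M, B.H.map_comp, reassoc_of% (B.de_coassoc M.A), ← B.de_nat,
        reassoc_of% (chi_sigma M hs), M.coassoc]
    rw [l, r]
  have e2 := e1 =≫ kappa s (diag M.h)
  simp only [Category.assoc] at e2
  rw [← Category.assoc (B.de (B.H.obj M.A)), sigma_kappa hs hD] at e2
  rw [reassoc_of% (B.de_nat M.θ), ← B.H.map_comp, reassoc_of% (B.xb_nat M.θ), ← h_theta,
    reassoc_of% (B.de_nat (B.un M.A ≫ B.de M.A ≫ B.H.map M.h)), ← B.H.map_comp,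
    reassoc_of% (B.xb_nat (B.un M.A ≫ B.de M.A ≫ B.H.map M.h)), Hun_sigma_diag M, xb_sigma M.assoc] at e2
  have e3 := chi_idem M hs =≫ B.H.map M.θ
  have e4 := chi_idem M hs =≫ B.H.map (B.un M.A ≫ B.de M.A ≫ B.H.map M.h)
  simp only [Category.assoc, ← B.H.map_comp] at e3 e4
  rw [← e3, ← e4]
  exact e2

/-- A coinvariant stays coinvariant when acted upon by the base. -/
theorem coinvariant_xb {Z : C} {i : Z ⟶ M.A}
    (hi : i ≫ M.θ = i ≫ B.un M.A ≫ B.de M.A ≫ B.H.map M.h) :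
    (B.H.map i ≫ B.xb M.A ≫ M.h) ≫ M.θ =
      (B.H.map i ≫ B.xb M.A ≫ M.h) ≫ B.un M.A ≫ B.de M.A ≫ B.H.map M.h := by
  simp only [Category.assoc]
  rw [h_theta, ← reassoc_of% (B.xb_nat M.θ), ← B.H.map_comp_assoc, hi, B.H.map_comp, Category.assoc,
    reassoc_of% (B.xb_nat (B.un M.A ≫ B.de M.A ≫ B.H.map M.h)), Hun_sigma_diag M, xb_sigma M.assoc]

/-- The projection `a ↦ S(a₋₁)a₀` onto the coinvariants. -/
def coinvProj (s : B.H ⟶ B.H) : M.A ⟶ M.A := chi M s ≫ B.xb M.A ≫ M.h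

theorem coinvProj_coinvariant (hs : B.IsWeakAntipode s) :
    coinvProj M s ≫ M.θ = coinvProj M s ≫ B.un M.A ≫ B.de M.A ≫ B.H.map M.h := by
  rw [coinvProj]
  simp only [Category.assoc]
  rw [h_theta, ← reassoc_of% (B.xb_nat M.θ), reassoc_of% (chi_theta M hs),
    reassoc_of% (B.xb_nat (B.un M.A ≫ B.de M.A ≫ B.H.map M.h)), Hun_sigma_diag M, xb_sigma M.assoc]

/-- By `sigma_kappa` this is `1₁ξ̄(1₂)x = x`. It is used both to show that coinvariants are fixed by
`coinvProj` and that `chi` takes values in `H` of the coinvariants. -/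
theorem un_sigma_kappa (hs : B.IsWeakAntipode s) :
    (B.un M.A ≫ B.de M.A ≫ B.H.map M.h) ≫ kappa s M.h ≫ B.xb M.A ≫ M.h = 𝟙 M.A := by
  have h1 := (IsBaseAction.of_action M.assoc).un_de_comp
    (by rw [reassoc_of% (B.un_xb M.A), M.unit])
  have h := sigma_kappa hs M.assoc
  simp only [Category.assoc] at h ⊢
  rw [reassoc_of% h, h1]

theorem comp_coinvProj (hs : B.IsWeakAntipode s) {Z : C} {i : Z ⟶ M.A}
    (hi : i ≫ M.θ = i ≫ B.un M.A ≫ B.de M.A ≫ B.H.map M.h) : i ≫ coinvProj M s = i := by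
  have h := un_sigma_kappa M hs
  simp only [Category.assoc] at h
  rw [coinvProj, chi, Category.assoc, reassoc_of% hi, h, Category.comp_id]

theorem chi_coinvProj (hs : B.IsWeakAntipode s) : chi M s ≫ B.H.map (coinvProj M s) = chi M s := by
  have h : coinvProj M s = M.θ ≫ kappa s M.h ≫ B.xb M.A ≫ M.h := by
    rw [coinvProj, chi, Category.assoc]
  have h1 := un_sigma_kappa M hs
  rw [h, B.H.map_comp, reassoc_of% (chi_theta M hs), ← B.H.map_comp, h1, B.H.map_id,
    Category.comp_id]

theorem chi_h (hs : B.IsWeakAntipode s) : chi M s ≫ M.h = 𝟙 M.A := by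
  rw [← sigma_co (a := M.h), reassoc_of% (chi_sigma M hs), M.counit]

variable {S : NatSplitting B.xiBar} (N : NatSplitting (baseIdem S))

open MixedBimodule in
-- The fundamental theorem of Hopf modules: a mixed bimodule is induced from its coinvariants, with
-- inverse `a ↦ a₋₂⊗S(a₋₁)a₀` to the action map.
theorem essSurj_of_split [IsIdempotentComplete C] (hs : B.IsWeakAntipode s) : N.obj.EssSurj where
  mem_essImage M := by
    have hidem : coinvProj M s ≫ coinvProj M s = coinvProj M s :=
      comp_coinvProj M hs (coinvProj_coinvariant M hs)
    -- `Y` is the object of coinvariants of `M`, split off by `a ↦ S(a₋₁)a₀`.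
    obtain ⟨Y, i, p, hip, hpi⟩ := IsIdempotentComplete.idempotents_split M.A _ hidem
    have hi : i ≫ M.θ = i ≫ B.un M.A ≫ B.de M.A ≫ B.H.map M.h := by
      have h := coinvProj_coinvariant M hs
      rw [← hpi] at h
      have := i ≫= h
      simpa only [Category.assoc, reassoc_of% hip] using this
    have hz := comp_coinvProj M hs (coinvariant_xb M hi)
    -- The base acts on coinvariants by `h⊗y ↦ ξ̄(h)y`, which is again coinvariant by
    -- `coinvariant_xb`; so projecting back by `p` loses nothing.
    have hr : IsBaseAction (B.H.map i ≫ B.xb M.A ≫ M.h ≫ p) := by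
      constructor
      · rw [← reassoc_of% (B.xb_nat i), reassoc_of% (B.xb_idem M.A)]
      · have h1 : B.H.map (B.H.map i ≫ B.xb M.A ≫ M.h ≫ p) ≫ B.H.map i =
            B.H.map (B.H.map i ≫ B.xb M.A ≫ M.h) := by
          rw [← B.H.map_comp]
          simp only [Category.assoc] at hz ⊢
          rw [hpi, hz]
        rw [reassoc_of% h1]
        simp only [B.H.map_comp, Category.assoc]
        rw [reassoc_of% (B.xb_nat M.h), ← reassoc_of% M.assoc, reassoc_of% (B.Hxb_mu_xb M.A).symm,
          ← reassoc_of% (B.mu_nat i), ← B.H.map_comp_assoc (B.xb Y), ← B.xb_nat i, B.H.map_comp,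
          Category.assoc]
    have hu : B.un Y ≫ B.H.map i ≫ B.xb M.A ≫ M.h ≫ p = 𝟙 Y := by
      rw [← reassoc_of% (B.un_nat i), reassoc_of% (B.un_xb M.A), reassoc_of% M.unit, hip]
    let α : B.Komega.obj Y ⟶ M :=
      { f := B.H.map i ≫ M.h
        h := by
          show B.H.map (B.H.map i ≫ M.h) ≫ M.h = B.mu Y ≫ B.H.map i ≫ M.h
          rw [← reassoc_of% (B.mu_nat i), M.assoc, B.H.map_comp, Category.assoc]
        θ := by
          show B.de Y ≫ B.H.map (B.H.map i ≫ M.h) = (B.H.map i ≫ M.h) ≫ M.θ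
          rw [Category.assoc, h_theta, ← B.H.map_comp_assoc, hi, B.H.map_comp i, Category.assoc,
            Hun_sigma_diag M, reassoc_of% (B.de_nat i), ← B.H.map_comp] }
    have hgf : (chi M s ≫ B.H.map p) ≫ B.H.map i ≫ M.h = 𝟙 M.A := by
      rw [Category.assoc, ← B.H.map_comp_assoc, hpi, reassoc_of% (chi_coinvProj M hs), chi_h M hs]
    -- The action map `H(Y) ⟶ M` and its section thus split the base idempotent of `Y`, so `M` is
    -- isomorphic to the bimodule induced from `Y`.
    have hfg : B.de Y ≫ B.H.map (B.H.map i ≫ B.xb M.A ≫ M.h ≫ p) =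
        (B.H.map i ≫ M.h) ≫ chi M s ≫ B.H.map p := by
      have hE := (IsBaseAction.of_action M.assoc).mu_de
      have hχ : i ≫ chi M s = i ≫ B.un M.A ≫ B.de M.A ≫ B.H.map (B.xb M.A ≫ M.h) := by
        have h := sigma_kappa hs M.assoc
        rw [Category.assoc] at h
        rw [chi, reassoc_of% hi, h]
      rw [Category.assoc, reassoc_of% (h_chi M hs), ← B.H.map_comp_assoc, hχ, B.H.map_comp i,
        B.H.map_comp (B.un _), Category.assoc, Category.assoc, ← reassoc_of% hE,
        reassoc_of% (B.Hun_mu M.A), reassoc_of% (B.de_nat i)]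
      simp only [B.H.map_comp, Category.assoc]
    have h := splittings_comp (congrArg Hom.f (N.ip (algOf hr hu))) hgf
      ((congrArg Hom.f (N.pi (algOf hr hu))).trans ((congrArg (fun t => B.de Y ≫ B.H.map t)
        (baseAct_algOf hr hu)).trans hfg))
    exact ⟨algOf hr hu, ⟨isoMk ((N.incl.app (algOf hr hu) : _ ⟶ B.Komega.obj Y) ≫ α) _ h.1 h.2⟩⟩

end

end WeakBraidedBimonad

/-! ### Transport of monadic adjunctions along equivalences and opposites -/

namespace WeakBraidedBimonad

open Opposite

section

variable {A : Type u} [Category.{v} A] {D : Type u'} [Category.{v'} D]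

section

variable (T : Monad A) (E : T.Algebra ≌ D) {K : A ⥤ D} (i : T.free ⋙ E.functor ≅ K)

/-- The adjunction transported from the free module adjunction along an equivalence. -/
def transportAdj : K ⊣ E.inverse ⋙ T.forget :=
  (T.adj.comp E.toAdjunction).ofNatIsoLeft i

/-- The comparison of free modules with the transported monad. -/
def transportHom (X : A) : T.free.obj X ≅ E.inverse.obj (K.obj X) :=
  E.unitIso.app (T.free.obj X) ≪≫ E.inverse.mapIso (i.app X)

theorem transportHom_hom (X : A) : (transportHom T E i X).hom =
    E.unit.app (T.free.obj X) ≫ E.inverse.map (i.hom.app X) := rfl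

variable {T} in
theorem unit_nat {P Q : T.Algebra} (g : P ⟶ Q) :
    g ≫ E.unit.app Q = E.unit.app P ≫ E.inverse.map (E.functor.map g) := E.unit.naturality g

theorem transportHom_nat {X Y : A} (f : X ⟶ Y) :
    T.free.map f ≫ (transportHom T E i Y).hom =
      (transportHom T E i X).hom ≫ E.inverse.map (K.map f) := by
  have h : E.functor.map (T.free.map f) ≫ i.hom.app Y = i.hom.app X ≫ K.map f :=
    i.hom.naturality f
  rw [transportHom_hom, transportHom_hom, reassoc_of% (unit_nat E (T.free.map f)),
    ← E.inverse.map_comp, h, E.inverse.map_comp, Category.assoc]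

variable {T} in
/-- The structure morphism of an algebra, as a morphism from a free algebra. -/
def structHom (P : T.Algebra) : T.free.obj P.A ⟶ P := T.adj.counit.app P

variable {T} in
theorem structHom_f (P : T.Algebra) : (structHom P).f = P.a := by
  simp [structHom]
  rfl

theorem transportAdj_counit (M : D) : (transportAdj T E i).counit.app M =
    i.inv.app (E.inverse.obj M).A ≫ E.functor.map (structHom (E.inverse.obj M)) ≫
      E.counit.app M := by
  simp [transportAdj, structHom]
  rfl

theorem transportAdj_unit (X : A) : (transportAdj T E i).unit.app X =
    T.η.app X ≫ (E.unit.app (T.free.obj X)).f ≫ (E.inverse.map (i.hom.app X)).f := by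
  simp [transportAdj]
  exact Category.assoc _ _ _

theorem transportHom_counit (M : D) :
    (transportHom T E i (E.inverse.obj M).A).hom ≫
      E.inverse.map ((transportAdj T E i).counit.app M) = structHom (E.inverse.obj M) := by
  have h := unit_nat E (structHom (E.inverse.obj M))
  have h2 : i.hom.app (E.inverse.obj M).A ≫ i.inv.app (E.inverse.obj M).A ≫
    E.functor.map (structHom (E.inverse.obj M)) ≫ E.counit.app M =
    E.functor.map (structHom (E.inverse.obj M)) ≫ E.counit.app M := by
    rw [i.hom_inv_id_app_assoc]
  rw [transportHom_hom, transportAdj_counit, Category.assoc, ← E.inverse.map_comp, h2,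
    E.inverse.map_comp, ← reassoc_of% h, E.unit_inverse_comp, Category.comp_id]

theorem transportHom_counit_f (M : D) :
    (transportHom T E i (E.inverse.obj M).A).hom.f ≫
      (E.inverse.map ((transportAdj T E i).counit.app M)).f = (E.inverse.obj M).a :=
  (congrArg Monad.Algebra.Hom.f (transportHom_counit T E i M)).trans (structHom_f _)

/-- The monad of the transported adjunction. -/
def transportIso : T ≅ (transportAdj T E i).toMonad :=
  MonadIso.mk (NatIso.ofComponents (fun X => T.forget.mapIso (transportHom T E i X))
    (fun f => congrArg Monad.Algebra.Hom.f (transportHom_nat T E i f)))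
    (fun X => (transportAdj_unit T E i X).symm)
    (fun X => by
      have h := transportHom_counit_f T E i (K.obj X)
      have h2 := (transportHom T E i X).hom.h
      show T.μ.app X ≫ (transportHom T E i X).hom.f =
        (T.map (transportHom T E i X).hom.f ≫ (transportHom T E i (E.inverse.obj (K.obj X)).A).hom.f)
          ≫ (E.inverse.map ((transportAdj T E i).counit.app (K.obj X))).f
      refine Eq.trans h2.symm ?_
      exact (congrArg (fun t => T.map (transportHom T E i X).hom.f ≫ t) h).symm.trans
        (Category.assoc _ _ _).symm)

end

/-- A functor that corresponds to the free module functor of a monad under an equivalence has a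
monadic right adjoint. -/
theorem hasMonadicRightAdjoint_of_equivalence (T : Monad A) (E : T.Algebra ≌ D) {K : A ⥤ D}
    (i : T.free ⋙ E.functor ≅ K) : HasMonadicRightAdjoint K := by
  refine ⟨E.inverse ⋙ T.forget, transportAdj T E i, ?_⟩
  let J := Monad.algebraEquivOfIsoMonads (transportIso T E i).symm
  -- After identifying the two monads, the comparison functor is `E.inverse`.
  have e : Monad.comparison (transportAdj T E i) ⋙ J.functor ≅ E.inverse :=
    NatIso.ofComponents (fun M => Monad.Algebra.isoMk (Iso.refl _) (by
      refine (congrArg (fun t => t ≫ _) (T.map_id _)).trans ?_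
      refine (Category.id_comp _).trans ?_
      refine ((transportHom_counit_f T E i M).symm).trans ?_
      exact (Category.comp_id _).symm)) (fun f => by
        ext
        exact (Category.comp_id _).trans (Category.id_comp _).symm)
  have : (Monad.comparison (transportAdj T E i) ⋙ J.functor).IsEquivalence :=
    Functor.isEquivalence_of_iso e.symm
  exact Functor.isEquivalence_of_comp_right _ J.functor

/-- If `Kᵒᵖ` has a monadic right adjoint, then `K` has a comonadic left adjoint. -/
theorem hasComonadicLeftAdjoint_of_op {K : A ⥤ D} (h : HasMonadicRightAdjoint K.op) :
    HasComonadicLeftAdjoint K := by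
  obtain ⟨R, adj, hR⟩ := h
  -- Coalgebras for the comonad of `adj.unop` are, up to opposites, algebras for the monad of `adj`.
  -- Each of the three properties is therefore read off from the comparison functor of `adj`.
  refine ⟨R.unop, adj.unop, { faithful := ?_, full := ?_, essSurj := ?_ }⟩
  · constructor
    intro M N f g h
    have h1 : R.map f.op = R.map g.op := Quiver.Hom.unop_inj (congrArg Comonad.Coalgebra.Hom.f h)
    exact Quiver.Hom.op_inj ((Monad.comparison adj).map_injective (Monad.Algebra.Hom.ext h1))
  · constructor
    intro M N g
    let g' : (Monad.comparison adj).obj (Opposite.op N) ⟶ (Monad.comparison adj).obj (Opposite.op M) :=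
      { f := g.f.op
        h := Quiver.Hom.unop_inj g.h }
    refine ⟨((Monad.comparison adj).preimage g').unop, ?_⟩
    ext
    have := congrArg Monad.Algebra.Hom.f ((Monad.comparison adj).map_preimage g')
    exact congrArg Quiver.Hom.unop this
  · constructor
    intro X
    let X' : adj.toMonad.Algebra :=
      { A := Opposite.op X.A
        a := X.a.op
        unit := Quiver.Hom.unop_inj X.counit
        assoc := Quiver.Hom.unop_inj X.coassoc }
    let e := (Monad.comparison adj).objObjPreimageIso X'
    refine ⟨((Monad.comparison adj).objPreimage X').unop, ⟨(Comonad.Coalgebra.isoMk ((adj.toMonad.forget.mapIso e).unop) ?_).symm⟩⟩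
    exact Quiver.Hom.op_inj e.hom.h

end

end WeakBraidedBimonad

/-! ### The Galois condition and the (co)tensor product as split idempotents -/

namespace WeakBraidedBimonad

variable {C : Type u} [Category.{v} C]

/-- The Galois condition: `σ` is invertible up to the idempotents that define the tensor product
over the base and the functor `Ḡ`. -/
def IsGalois (B : WeakBraidedBimonad C) : Prop :=
  ∀ X, ∃ k : B.H.obj (B.H.obj X) ⟶ B.H.obj (B.H.obj X),
    B.sg X ≫ k = B.de (B.H.obj X) ≫ B.H.map (B.xb (B.H.obj X) ≫ B.mu X) ∧
    k ≫ B.sg X = B.un (B.H.obj (B.H.obj X)) ≫ diag (B.mu X)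

variable {B : WeakBraidedBimonad C}

theorem isGalois_op_iff : B.op.IsGalois ↔
    ∀ X, ∃ k : B.H.obj (B.H.obj X) ⟶ B.H.obj (B.H.obj X),
      k ≫ B.sb X = B.H.map (B.de X ≫ B.xb (B.H.obj X)) ≫ B.mu (B.H.obj X) ∧
      B.sb X ≫ k = B.H.map (B.de X) ≫ B.om (B.H.obj X) ≫ B.co (B.H.obj (B.H.obj X)) := by
  have h1 (X : Cᵒᵖ) : (B.op.de (B.op.H.obj X) ≫ B.op.H.map (B.op.xb (B.op.H.obj X) ≫ B.op.mu X)) =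
      (B.H.map (B.de X.unop ≫ B.xb (B.H.obj X.unop)) ≫ B.mu (B.H.obj X.unop)).op := by
    rw [op_xb]
    rfl
  have h2 (X : Cᵒᵖ) : B.op.un (B.op.H.obj (B.op.H.obj X)) ≫ diag (B.op.mu X) =
      (B.H.map (B.de X.unop) ≫ B.om (B.H.obj X.unop) ≫ B.co (B.H.obj (B.H.obj X.unop))).op := by
    rw [diag, op_om]
    refine unop_inj ?_
    exact Category.assoc _ _ _
  constructor
  · intro h X
    obtain ⟨k, hk, hk'⟩ := h (Opposite.op X)
    rw [h1] at hk
    rw [h2] at hk'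
    exact ⟨k.unop, congrArg Quiver.Hom.unop hk, congrArg Quiver.Hom.unop hk'⟩
  · intro h X
    obtain ⟨k, hk, hk'⟩ := h X.unop
    refine ⟨k.op, ?_, ?_⟩
    · rw [h1]; exact unop_inj hk
    · rw [h2]; exact unop_inj hk'

section

variable (S : NatSplitting B.xiBar)

/-- The idempotent `h⊗x ↦ h₁⊗ξ̄(h₂)x` on `HH`. -/
def tensorIdem : B.H ⋙ B.H ⟶ B.H ⋙ B.H := B.thetaRightH S ≫ B.HrhoLeft S

theorem tensorIdem_app (X : C) : (tensorIdem S).app X =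
    B.de (B.H.obj X) ≫ B.H.map (B.xb (B.H.obj X) ≫ B.mu X) := by
  have hp : ∀ Y, S.proj.app Y ≫ S.incl.app Y = B.xb Y := S.pi
  show (B.de (B.H.obj X) ≫ B.H.map (S.proj.app (B.H.obj X))) ≫
    B.H.map (S.incl.app (B.H.obj X) ≫ B.mu X) = _
  rw [Category.assoc, ← B.H.map_comp, reassoc_of% (hp (B.H.obj X))]

theorem thetaRightH_rhoRightH : B.thetaRightH S ≫ B.rhoRightH S = 𝟙 _ := by
  ext X
  exact de_proj_incl_mu (S := S) (B.H.obj X)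

theorem rho_tensorIdem : B.rhoRightH S ≫ tensorIdem S = B.HrhoLeft S ≫ tensorIdem S := by
  have hp : ∀ Y, S.proj.app Y ≫ S.incl.app Y = B.xb Y := S.pi
  ext X
  have h := (IsBaseAction.of_action (B.mu_assoc X).symm).balanced
  have h2 := B.H.map (S.incl.app (B.H.obj X)) ≫= h
  rw [NatTrans.comp_app, NatTrans.comp_app, tensorIdem_app]
  rw [← B.H.map_comp_assoc, B.incl_xb S, ← B.H.map_comp_assoc, reassoc_of% (B.incl_xb S)] at h2
  exact (Category.assoc _ _ _).trans h2

theorem tensorIdem_idem : tensorIdem S ≫ tensorIdem S = tensorIdem S := by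
  rw [tensorIdem, Category.assoc, ← tensorIdem, ← rho_tensorIdem, ← Category.assoc,
    thetaRightH_rhoRightH, Category.id_comp]

/-- `θ_rH` is a section of `ρ_rH`, and `θ_rH` followed by `Hρ_l` coequalises the pair. It is
therefore idempotent, and any splitting of it is a coequaliser. -/
theorem hasCoequalizer_rho [IsIdempotentComplete C] :
    HasCoequalizer (B.rhoRightH S) (B.HrhoLeft S) := by
  obtain ⟨N⟩ := NatSplitting.nonempty_of_idem (tensorIdem_idem S)
  have hp : N.proj = tensorIdem S ≫ N.proj := by
    have := N.proj ≫= N.incl_proj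
    rw [Category.comp_id, ← Category.assoc, N.proj_incl] at this
    exact this.symm
  have w : B.rhoRightH S ≫ N.proj = B.HrhoLeft S ≫ N.proj := by
    rw [hp, ← Category.assoc, rho_tensorIdem, Category.assoc]
  have hc : IsColimit (Cofork.ofπ N.proj w) := Cofork.IsColimit.mk _ (fun s => N.incl ≫ s.π)
    (fun s => by
      have h := s.condition
      show N.proj ≫ N.incl ≫ s.π = s.π
      rw [← Category.assoc, N.proj_incl, tensorIdem, Category.assoc, ← h, ← Category.assoc,
        thetaRightH_rhoRightH, Category.id_comp])
    (fun s m hm => by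
      have hm' : N.proj ≫ m = s.π := hm
      rw [← hm', ← Category.assoc, N.incl_proj]
      exact (Category.id_comp m).symm)
  exact HasColimit.mk ⟨_, hc⟩

variable {S} in
theorem exists_section {c : Cofork (B.rhoRightH S) (B.HrhoLeft S)} (hc : IsColimit c) :
    ∃ s : c.pt ⟶ B.H ⋙ B.H, c.π ≫ s = tensorIdem S ∧ s ≫ c.π = 𝟙 _ := by
  refine ⟨hc.desc (Cofork.ofπ (tensorIdem S) (rho_tensorIdem S)), ?_, ?_⟩
  · exact hc.fac _ WalkingParallelPair.one
  · apply Cofork.IsColimit.hom_ext hc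
    have h : c.π ≫ hc.desc (Cofork.ofπ (tensorIdem S) (rho_tensorIdem S)) = tensorIdem S :=
      hc.fac _ WalkingParallelPair.one
    rw [← Category.assoc, h, tensorIdem, Category.assoc, ← c.condition, ← Category.assoc,
      thetaRightH_rhoRightH, Category.id_comp, Category.comp_id]

theorem gamma_fac (SG : NatSplitting B.Gamma) {c : Cofork (B.rhoRightH S) (B.HrhoLeft S)}
    (hc : IsColimit c) : c.π ≫ B.gamma S SG c hc = B.sigma ≫ B.pBar SG :=
  hc.fac _ WalkingParallelPair.one

/-- A morphism induced by `s` between two retracts is invertible iff `s` is invertible up to the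
idempotents. -/
theorem isIso_iff_of_retracts {P Q T : C} {l : T ⟶ P} {s : P ⟶ T} {i : Q ⟶ T} {p : T ⟶ Q}
    {g : P ⟶ Q} {σ E G : T ⟶ T} (hls : l ≫ s = E) (hsl : s ≫ l = 𝟙 P) (hip : i ≫ p = 𝟙 Q)
    (hpi : p ≫ i = G) (hG : σ ≫ G = σ) (hg : l ≫ g = σ ≫ p) :
    IsIso g ↔ ∃ k : T ⟶ T, σ ≫ k = E ∧ k ≫ σ = G := by
  have hg' : g = s ≫ σ ≫ p := by rw [← hg, reassoc_of% hsl]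
  have hg'' : l ≫ g ≫ i = σ := by rw [reassoc_of% hg, hpi, hG]
  constructor
  · intro _
    refine ⟨p ≫ inv g ≫ s, ?_, ?_⟩
    · rw [← reassoc_of% hg, IsIso.hom_inv_id_assoc, hls]
    · rw [← hg'']
      simp only [Category.assoc]
      rw [reassoc_of% hsl, IsIso.inv_hom_id_assoc, hpi]
  · rintro ⟨k, hk, hk'⟩
    refine ⟨i ≫ k ≫ l, ?_, ?_⟩
    · rw [hg']
      simp only [Category.assoc]
      rw [reassoc_of% hpi, reassoc_of% hG, reassoc_of% hk, ← hls, Category.assoc, hsl,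
        Category.comp_id, hsl]
    · simp only [Category.assoc]
      rw [hg, reassoc_of% hk', ← hpi, Category.assoc, hip, Category.comp_id, hip]

/-- Source and target of `γ` are retracts of `HH` with idempotents `E` and `Γ`. Invertibility is
checked on components, so the weak inverses in `IsGalois` need not be natural in `X`. -/
theorem isIso_gamma_iff (SG : NatSplitting B.Gamma) {c : Cofork (B.rhoRightH S) (B.HrhoLeft S)}
    (hc : IsColimit c) : IsIso (B.gamma S SG c hc) ↔ B.IsGalois := by
  obtain ⟨s, hs, hs'⟩ := exists_section hc
  rw [NatTrans.isIso_iff_isIso_app]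
  refine forall_congr' fun X => isIso_iff_of_retracts (l := c.π.app X) (s := s.app X)
    (i := SG.incl.app (B.monad.free.obj X)) (p := (B.pBar SG).app X) ?_ ?_ ?_ ?_ ?_ ?_
  · exact (congrArg (fun t : B.H ⋙ B.H ⟶ B.H ⋙ B.H => t.app X) hs).trans (tensorIdem_app S X)
  · exact congrArg (fun t : c.pt ⟶ c.pt => t.app X) hs'
  · exact SG.ip _
  · exact SG.pi _
  · exact sigma_un_diag (B.mu_assoc X).symm
  · exact congrArg (fun t : B.H ⋙ B.H ⟶ B.GBar SG => t.app X) (gamma_fac S SG hc)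

/-- The idempotent on `HH` whose image is the cotensor product. -/
def cotensorIdem : B.H ⋙ B.H ⟶ B.H ⋙ B.H := B.HthetaLeft S ≫ B.rhoRightH S

theorem cotensorIdem_app (X : C) : (cotensorIdem S).app X =
    B.H.map (B.de X ≫ B.xb (B.H.obj X)) ≫ B.mu (B.H.obj X) := by
  have hp : ∀ Y, S.proj.app Y ≫ S.incl.app Y = B.xb Y := S.pi
  show B.H.map (B.de X ≫ S.proj.app (B.H.obj X)) ≫ B.H.map (S.incl.app (B.H.obj X)) ≫
    B.mu (B.H.obj X) = _
  rw [← B.H.map_comp_assoc, Category.assoc, hp]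

/-- The balancing relation of the opposite bimonad; composing with `q` replaces `ξ̄` by the
projection onto the base. -/
theorem cotensorIdem_theta :
    cotensorIdem S ≫ B.thetaRightH S = cotensorIdem S ≫ B.HthetaLeft S := by
  ext X
  have h := (IsBaseAction.of_action (B := B.op) (B.op.mu_assoc (Opposite.op X)).symm).balanced
  rw [op_xb] at h
  have h' : ((B.H.map (B.de X ≫ B.xb (B.H.obj X)) ≫ B.mu (B.H.obj X)) ≫ B.de (B.H.obj X)) ≫
      B.H.map (B.xb (B.H.obj X)) =
      (B.H.map (B.de X ≫ B.xb (B.H.obj X)) ≫ B.mu (B.H.obj X)) ≫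
        B.H.map (B.de X ≫ B.xb (B.H.obj X)) := congrArg Quiver.Hom.unop h
  have h2 := h' =≫ B.H.map (S.proj.app (B.H.obj X))
  rw [NatTrans.comp_app, NatTrans.comp_app, cotensorIdem_app]
  simp only [Category.assoc, ← B.H.map_comp, B.xb_proj S] at h2 ⊢
  exact h2

theorem cotensorIdem_idem : cotensorIdem S ≫ cotensorIdem S = cotensorIdem S := by
  have h : cotensorIdem S ≫ B.HthetaLeft S ≫ B.rhoRightH S = cotensorIdem S := by
    rw [← Category.assoc, ← cotensorIdem_theta, Category.assoc, thetaRightH_rhoRightH,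
      Category.comp_id]
  exact h

theorem hasEqualizer_theta [IsIdempotentComplete C] :
    HasEqualizer (B.thetaRightH S) (B.HthetaLeft S) := by
  obtain ⟨N⟩ := NatSplitting.nonempty_of_idem (cotensorIdem_idem S)
  have hi : N.incl = N.incl ≫ cotensorIdem S := by
    have := N.incl_proj =≫ N.incl
    rw [Category.id_comp, Category.assoc, N.proj_incl] at this
    exact this.symm
  have w : N.incl ≫ B.thetaRightH S = N.incl ≫ B.HthetaLeft S := by
    rw [hi, Category.assoc, cotensorIdem_theta, Category.assoc]
  have hc : IsLimit (Fork.ofι N.incl w) := Fork.IsLimit.mk _ (fun s => s.ι ≫ N.proj)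
    (fun s => by
      have h := s.condition
      show (s.ι ≫ N.proj) ≫ N.incl = s.ι
      rw [Category.assoc, N.proj_incl, cotensorIdem, ← Category.assoc, ← h, Category.assoc,
        thetaRightH_rhoRightH, Category.comp_id])
    (fun s m hm => by
      have hm' : m ≫ N.incl = s.ι := hm
      rw [← hm', Category.assoc, N.incl_proj]
      exact (Category.comp_id m).symm)
  exact HasLimit.mk ⟨_, hc⟩

variable {S} in
theorem exists_retraction {c : Fork (B.thetaRightH S) (B.HthetaLeft S)} (hc : IsLimit c) :
    ∃ r : B.H ⋙ B.H ⟶ c.pt, r ≫ c.ι = cotensorIdem S ∧ c.ι ≫ r = 𝟙 _ := by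
  have h : hc.lift (Fork.ofι (cotensorIdem S) (cotensorIdem_theta S)) ≫ c.ι = cotensorIdem S :=
    hc.fac _ WalkingParallelPair.zero
  refine ⟨_, h, ?_⟩
  apply Fork.IsLimit.hom_ext hc
  rw [Category.assoc, h, cotensorIdem, ← Category.assoc, ← c.condition, Category.assoc,
    thetaRightH_rhoRightH, Category.id_comp, Category.comp_id]

theorem gamma'_fac (ST : NatSplitting B.GammaPrime) {c : Fork (B.thetaRightH S) (B.HthetaLeft S)}
    (hc : IsLimit c) : B.gamma' S ST c hc ≫ c.ι = B.iBar ST ≫ B.sigmaBar :=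
  hc.fac _ WalkingParallelPair.zero

/-- The dual of `isIso_iff_of_retracts`. -/
theorem isIso_iff_of_retracts' {P Q T : C} {l : T ⟶ P} {s : P ⟶ T} {i : Q ⟶ T} {p : T ⟶ Q}
    {g : Q ⟶ P} {σ E G : T ⟶ T} (hls : l ≫ s = E) (hsl : s ≫ l = 𝟙 P) (hip : i ≫ p = 𝟙 Q)
    (hpi : p ≫ i = G) (hG : G ≫ σ = σ) (hg : g ≫ s = i ≫ σ) :
    IsIso g ↔ ∃ k : T ⟶ T, k ≫ σ = E ∧ σ ≫ k = G := by
  have hg' : g = i ≫ σ ≫ l := by rw [← reassoc_of% hg, hsl, Category.comp_id]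
  have hg'' : p ≫ g ≫ s = σ := by rw [hg, reassoc_of% hpi, hG]
  constructor
  · intro _
    refine ⟨l ≫ inv g ≫ i, ?_, ?_⟩
    · simp only [Category.assoc]
      rw [← hg, IsIso.inv_hom_id_assoc, hls]
    · rw [← hg'']
      simp only [Category.assoc]
      rw [reassoc_of% hsl, IsIso.hom_inv_id_assoc, hpi]
  · rintro ⟨k, hk, hk'⟩
    refine ⟨s ≫ k ≫ p, ?_, ?_⟩
    · rw [reassoc_of% hg, reassoc_of% hk', ← hpi, Category.assoc, hip, Category.comp_id, hip]
    · rw [hg']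
      simp only [Category.assoc]
      rw [reassoc_of% hpi, reassoc_of% hG, reassoc_of% hk, ← hls, Category.assoc, hsl,
        Category.comp_id, hsl]

theorem isIso_gamma'_iff (ST : NatSplitting B.GammaPrime)
    {c : Fork (B.thetaRightH S) (B.HthetaLeft S)} (hc : IsLimit c) :
    IsIso (B.gamma' S ST c hc) ↔ B.op.IsGalois := by
  obtain ⟨r, hr, hr'⟩ := exists_retraction hc
  rw [NatTrans.isIso_iff_isIso_app, isGalois_op_iff]
  refine forall_congr' fun X => isIso_iff_of_retracts' (l := r.app X) (s := c.ι.app X)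
    (i := (B.iBar ST).app X) (p := ST.proj.app (B.comonad.cofree.obj X)) ?_ ?_ ?_ ?_ ?_ ?_
  · exact (congrArg (fun t : B.H ⋙ B.H ⟶ B.H ⋙ B.H => t.app X) hr).trans (cotensorIdem_app S X)
  · exact congrArg (fun t : c.pt ⟶ c.pt => t.app X) hr'
  · exact ST.ip _
  · exact ST.pi _
  · have h := sigma_un_diag (B := B.op) (B.op.mu_assoc (Opposite.op X)).symm
    rw [diag, op_om] at h
    have h' := congrArg Quiver.Hom.unop h
    refine Eq.trans ?_ h'
    show (B.H.map (B.de X) ≫ B.om (B.H.obj X) ≫ B.co (B.H.obj (B.H.obj X))) ≫ B.sb X =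
      ((B.H.map (B.de X) ≫ B.om (B.H.obj X)) ≫ B.co (B.H.obj (B.H.obj X))) ≫ B.sb X
    simp only [Category.assoc]
  · exact congrArg (fun t : B.TBar ST ⟶ B.H ⋙ B.H => t.app X) (gamma'_fac S ST hc)

end

end WeakBraidedBimonad

namespace WeakBraidedBimonad

variable {C : Type u} [Category.{v} C] {B : WeakBraidedBimonad C}

/-! ### Convolution and the construction of weak antipodes -/

theorem conv_assoc (r s t : B.H ⟶ B.H) :
    B.conv (B.conv r s) t = B.conv r (B.conv s t) := by
  ext X
  have h := r.naturality (B.mu X)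
  simp only [conv_app, B.H.map_comp, Category.assoc]
  rw [reassoc_of% h, B.mu_assoc, reassoc_of% (B.de_coassoc X), reassoc_of% (B.de_nat (t.app X))]

theorem id_conv_xiBar : B.conv (𝟙 B.H) B.xiBar = 𝟙 B.H := by
  ext X
  rw [conv_app]
  simp only [NatTrans.id_app, Category.id_comp]
  exact B.de_Hxb_mu X

/-- The third antipode equation can be forced by replacing `s` with `ξ̄ * s`: since `1 * ξ̄ = 1`,
also `ξ̄ * ξ̄ = s * 1 * ξ̄ = ξ̄`. -/
theorem isHopf_of_conv {s : B.H ⟶ B.H} (h1 : B.conv (𝟙 B.H) s = B.xi)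
    (h2 : B.conv s (𝟙 B.H) = B.xiBar) : B.IsHopf := by
  have hx : B.conv B.xiBar B.xiBar = B.xiBar := by
    have h : B.conv (B.conv s (𝟙 B.H)) B.xiBar = B.xiBar := by
      rw [conv_assoc, id_conv_xiBar, h2]
    rwa [h2] at h
  have hr : B.conv (B.conv B.xiBar s) (𝟙 B.H) = B.xiBar := by rw [conv_assoc, h2, hx]
  refine ⟨B.conv B.xiBar s, ?_, hr, ?_⟩
  · rw [← conv_assoc, id_conv_xiBar, h1]
  · rw [hr, ← conv_assoc, hx]

/-- Morphisms that commute with two maps and with the associated idempotents commute with the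
weak inverses. -/
theorem comp_weakInverse {P Q : C} {t : P ⟶ Q} {a k e g : P ⟶ P} {a' k' e' g' : Q ⟶ Q}
    (h1 : k ≫ a = g) (h2 : k ≫ e = k) (h3 : a' ≫ k' = e') (h4 : g' ≫ k' = k')
    (ha : a ≫ t = t ≫ a') (he : e ≫ t = t ≫ e') (hg : g ≫ t = t ≫ g') : k ≫ t = t ≫ k' := by
  calc k ≫ t = k ≫ t ≫ e' := by rw [← he, reassoc_of% h2]
    _ = (k ≫ a) ≫ t ≫ k' := by rw [← h3, Category.assoc, reassoc_of% ha]
    _ = t ≫ k' := by rw [h1, reassoc_of% hg, h4]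

/-- Replacing `k` by `kσk` makes `E` and `Γ` absorbable on its two sides, as `comp_weakInverse`
requires. -/
theorem IsGalois.exists_weakInverse (h : B.IsGalois) :
    ∃ k : ∀ X, B.H.obj (B.H.obj X) ⟶ B.H.obj (B.H.obj X),
      (∀ X, B.sg X ≫ k X = B.de (B.H.obj X) ≫ B.H.map (B.xb (B.H.obj X) ≫ B.mu X)) ∧
      (∀ X, k X ≫ B.sg X = B.un (B.H.obj (B.H.obj X)) ≫ diag (B.mu X)) ∧
      (∀ X, k X ≫ B.de (B.H.obj X) ≫ B.H.map (B.xb (B.H.obj X) ≫ B.mu X) = k X) ∧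
      (∀ X, (B.un (B.H.obj (B.H.obj X)) ≫ diag (B.mu X)) ≫ k X = k X) := by
  choose k h1 h2 using h
  have hm (X : C) := (B.mu_assoc X).symm
  have hE (X : C) := (IsBaseAction.of_action (hm X)).idem
  have hG (X : C) := un_diag_idem (hm X)
  have e1 (X : C) : B.sg X ≫ k X ≫ B.sg X ≫ k X =
      B.de (B.H.obj X) ≫ B.H.map (B.xb (B.H.obj X) ≫ B.mu X) := by
    rw [reassoc_of% (h1 X), h1]
    simpa only [Category.assoc] using hE X
  have e2 (X : C) : (k X ≫ B.sg X ≫ k X) ≫ B.sg X =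
      B.un (B.H.obj (B.H.obj X)) ≫ diag (B.mu X) := by
    simp only [Category.assoc]
    rw [h2, reassoc_of% (h2 X)]
    simpa only [Category.assoc] using hG X
  refine ⟨fun X => k X ≫ B.sg X ≫ k X, e1, e2, fun X => ?_, fun X => ?_⟩
  · have := e1 X
    rw [← h1 X]
    simp only [Category.assoc]
    rw [this, h1]
  · beta_reduce
    rw [reassoc_of% (h2 X)]
    simpa only [Category.assoc] using hG X =≫ k X

/-- The normalised weak inverse inherits from `σ`, `E` and `Γ` naturality, compatibility with `Hm`
and compatibility with `δ`. These are exactly what evaluates the two convolutions. -/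
theorem IsGalois.isHopf (h : B.IsGalois) : B.IsHopf := by
  obtain ⟨k, h1, h2, h3, h4⟩ := h.exists_weakInverse
  have hm (X : C) := (B.mu_assoc X).symm
  have hnat {X Y : C} (f : X ⟶ Y) : k X ≫ B.H.map (B.H.map f) = B.H.map (B.H.map f) ≫ k Y := by
    refine comp_weakInverse (h2 X) (h3 X) (h1 Y) (h4 Y) (B.sg_nat f).symm ?_ ?_
    · exact (IsBaseAction.naturality (by rw [reassoc_of% (B.xb_nat (B.H.map f)), B.mu_nat,
        Category.assoc])).symm
    · exact (B.gam_nat (B.mu_nat f)).symm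
  have hmu (X : C) : k (B.H.obj X) ≫ B.H.map (B.mu X) = B.H.map (B.mu X) ≫ k X := by
    refine comp_weakInverse (h2 _) (h3 _) (h1 X) (h4 X) ?_ ?_ ?_
    · rw [sg, sg, Category.assoc, reassoc_of% (B.de_nat (B.mu X)), ← B.H.map_comp, ← B.H.map_comp,
        B.mu_assoc]
    · exact (IsBaseAction.naturality (by rw [reassoc_of% (B.xb_nat (B.mu X)), B.mu_assoc,
        Category.assoc])).symm
    · exact (B.gam_nat (B.mu_assoc X)).symm
  have hde (X : C) : k X ≫ B.de (B.H.obj X) = B.de (B.H.obj X) ≫ B.H.map (k X) := by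
    refine comp_weakInverse (h2 X) (h3 X) (e' := B.H.map (B.de (B.H.obj X) ≫ B.H.map (B.xb (B.H.obj X) ≫ B.mu X)))
      (g' := B.H.map (B.un (B.H.obj (B.H.obj X)) ≫ diag (B.mu X))) (a' := B.H.map (B.sg X)) ?_ ?_ ?_ ?_ ?_
    · rw [← B.H.map_comp, h1]
    · rw [← B.H.map_comp, h4]
    · rw [sg, IsBaseAction.de_de]
    · rw [IsBaseAction.de_de]
    · exact un_diag_de
  let s : B.H ⟶ B.H :=
    { app := fun X => B.H.map (B.un X) ≫ k X ≫ B.co (B.H.obj X)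
      naturality := fun X Y f => by
        have hf := B.un_nat f
        rw [← B.H.map_comp_assoc, hf, B.H.map_comp_assoc, ← reassoc_of% (hnat f), B.co_nat]
        simp only [Category.assoc] }
  have hs (X : C) : s.app X = B.H.map (B.un X) ≫ k X ≫ B.co (B.H.obj X) := rfl
  have hmc (X : C) : B.mu X = B.de (B.H.obj X) ≫ B.H.map (B.mu X) ≫ B.co (B.H.obj X) :=
    sigma_co.symm
  refine isHopf_of_conv (s := s) ?_ ?_
  -- In `h₁S(h₂)`, `hde` pulls `h₁` inside `k`. Since `m` is `σ` followed by the counit, `kσ = Γ`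
  -- remains, and it yields `ξ`.
  · ext X
    have h5 := B.xa_nat (B.un X)
    rw [conv_app, xi_app, hs, NatTrans.id_app, Category.id_comp]
    show B.de X ≫ B.H.map _ ≫ B.mu X = _
    simp only [B.H.map_comp, Category.assoc]
    rw [← reassoc_of% (B.de_nat (B.un X)), ← reassoc_of% (hde X), reassoc_of% (B.de_Hco), hmc X]
    have h6 := h2 X
    rw [sg] at h6
    rw [reassoc_of% h6, reassoc_of% (un_diag (B := B) (a := B.mu X)), sigma_co,
      reassoc_of% h5, B.Hun_mu, Category.comp_id]
  -- In `S(h₁)h₂`, `hmu` moves `h₂` inside `k`. As `h₁⊗h₂ = σ(h⊗1)`, the weak inverse relation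
  -- leaves `E(h⊗1)`, which yields `ξ̄`.
  · ext X
    have h5 := B.co_nat (B.mu X)
    have h6 := h1 X
    have h7 := B.xb_nat (B.un X)
    rw [sg, Category.assoc] at h6
    rw [conv_app, hs, NatTrans.id_app, B.H.map_id, Category.id_comp]
    show B.de X ≫ (B.H.map _ ≫ _ ≫ _) ≫ B.mu X = B.xb X
    have h8 : B.de X = B.H.map (B.un X) ≫ B.de (B.H.obj X) ≫ B.H.map (B.mu X) := by
      have h9 := B.un_mu (B.H.obj X)
      rw [reassoc_of% (B.de_nat (B.un X)), ← B.H.map_comp, B.Hun_mu, B.H.map_id, Category.comp_id]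
    simp only [Category.assoc]
    rw [← h5, reassoc_of% (hmu X), ← B.H.map_comp_assoc, B.un_mu, B.H.map_id, Category.id_comp,
      h8]
    simp only [Category.assoc]
    rw [reassoc_of% h6, B.co_nat, reassoc_of% (B.de_co), reassoc_of% h7, B.Hun_mu, Category.comp_id]

end WeakBraidedBimonad

/-! ### From a monadic right adjoint to the Galois condition -/

namespace WeakBraidedBimonad

section

variable {A : Type u} [Category.{v} A] {D : Type u'} [Category.{v'} D] {K : A ⥤ D}

/-- Functors with a monadic right adjoint: a morphism `K Z ⟶ M` through which all morphisms
`K Y ⟶ M` factor is an effective epimorphism. -/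
theorem HasMonadicRightAdjoint.effective (h : HasMonadicRightAdjoint K) {M : D} {Z : A}
    (t : K.obj Z ⟶ M) (ht : ∀ (Y : A) (g : K.obj Y ⟶ M), ∃ f : Y ⟶ Z, K.map f ≫ t = g) (P : D) :
    (∀ g g' : M ⟶ P, t ≫ g = t ≫ g' → g = g') ∧
    ∀ q : K.obj Z ⟶ P, (∀ (Y : A) (a b : K.obj Y ⟶ K.obj Z), a ≫ t = b ≫ t → a ≫ q = b ≫ q) →
      ∃ g : M ⟶ P, t ≫ g = q := by
  obtain ⟨R, adj, hR⟩ := h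
  obtain ⟨f, hf⟩ := ht _ (adj.counit.app M)
  have huniq (g g' : M ⟶ P) (hg : t ≫ g = t ≫ g') : g = g' := by
    have h1 : adj.counit.app M ≫ g = adj.counit.app M ≫ g' := by
      rw [← hf, Category.assoc, hg, Category.assoc]
    have h2 : R.map g = R.map g' := by
      rw [← adj.right_triangle_components_assoc M (R.map g), ← R.map_comp, h1, R.map_comp,
        adj.right_triangle_components_assoc]
    exact (Monad.comparison adj).map_injective (Monad.Algebra.Hom.ext h2)
  refine ⟨huniq, fun q hq => ?_⟩
  -- The two canonical maps agree after the counit `K f ≫ t`, so the assumption on `q` makes `K f ≫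
  -- q` coequalise them; by monadicity it descends along the counit.
  have hq1 : K.map (R.map (adj.counit.app M)) ≫ K.map f ≫ q =
      adj.counit.app (K.obj (R.obj M)) ≫ K.map f ≫ q := by
    simp only [← Category.assoc]
    refine hq _ _ _ ?_
    rw [Category.assoc, Category.assoc, hf]
    exact adj.counit.naturality (adj.counit.app M)
  let φ : (Monad.comparison adj).obj M ⟶ (Monad.comparison adj).obj P :=
    { f := adj.unit.app (R.obj M) ≫ R.map (K.map f ≫ q)
      h := by
        show R.map (K.map (adj.unit.app (R.obj M) ≫ R.map (K.map f ≫ q))) ≫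
          R.map (adj.counit.app P) = R.map (adj.counit.app M) ≫ adj.unit.app (R.obj M) ≫
            R.map (K.map f ≫ q)
        have h1 : R.map (adj.counit.app M) ≫ adj.unit.app (R.obj M) =
            adj.unit.app _ ≫ R.map (K.map (R.map (adj.counit.app M))) :=
          adj.unit.naturality (R.map (adj.counit.app M))
        have h2 : K.map (R.map (K.map f ≫ q)) ≫ adj.counit.app P =
          adj.counit.app (K.obj (R.obj M)) ≫ K.map f ≫ q := adj.counit.naturality (K.map f ≫ q)
        have h3 : K.map (adj.unit.app (R.obj M)) ≫ adj.counit.app (K.obj (R.obj M)) = 𝟙 _ :=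
          adj.left_triangle_components (R.obj M)
        rw [reassoc_of% h1, ← R.map_comp, ← R.map_comp, hq1,
          R.map_comp (adj.counit.app (K.obj (R.obj M))), adj.right_triangle_components_assoc,
          K.map_comp, Category.assoc, h2, reassoc_of% h3] }
  refine ⟨(Monad.comparison adj).preimage φ, ?_⟩
  have hφ : R.map ((Monad.comparison adj).preimage φ) =
      adj.unit.app (R.obj M) ≫ R.map (K.map f ≫ q) :=
    congrArg Monad.Algebra.Hom.f ((Monad.comparison adj).map_preimage φ)
  have h3 : adj.counit.app M ≫ (Monad.comparison adj).preimage φ = K.map f ≫ q := by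
    have h2 : K.map (R.map (K.map f ≫ q)) ≫ adj.counit.app P =
      adj.counit.app (K.obj (R.obj M)) ≫ K.map f ≫ q := adj.counit.naturality (K.map f ≫ q)
    have h4 : K.map (R.map ((Monad.comparison adj).preimage φ)) ≫ adj.counit.app P =
      adj.counit.app M ≫ (Monad.comparison adj).preimage φ := adj.counit.naturality _
    rw [← h4, hφ, K.map_comp, Category.assoc, h2, adj.left_triangle_components_assoc]
  obtain ⟨f', hf'⟩ : ∃ f', K.map f' ≫ adj.counit.app M = t := ⟨adj.unit.app Z ≫ R.map t, by
    have h4 : K.map (R.map t) ≫ adj.counit.app M = adj.counit.app (K.obj Z) ≫ t :=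
      adj.counit.naturality t
    rw [K.map_comp, Category.assoc, h4, adj.left_triangle_components_assoc]⟩
  -- `t` factors through the counit by `f'`, and `K(f' ≫ f)` does not change `t`; hence it does not
  -- change `q`.
  have h5 : (K.map f' ≫ K.map f) ≫ q = 𝟙 _ ≫ q :=
    hq _ _ _ (by rw [Category.assoc, hf, hf', Category.id_comp])
  rw [← hf', Category.assoc, h3, ← Category.assoc, h5, Category.id_comp]

end

variable {C : Type u} [Category.{v} C] {B : WeakBraidedBimonad C}

open MixedBimodule

section

variable {A Y : C} {a : B.H.obj A ⟶ A} {i : Y ⟶ B.H.obj A} {p : B.H.obj A ⟶ Y}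

theorem diag_de : diag a ≫ B.de A = B.H.map (B.de A) ≫ B.om (B.H.obj A) ≫ B.H.map (diag a) := by
  rw [diag, Category.assoc, B.de_nat, reassoc_of% (B.om_de A), B.H.map_comp]

theorem diag_co : diag a ≫ B.co A = B.H.map (B.xa A) ≫ B.mu A ≫ a := by
  rw [diag, Category.assoc, B.co_nat, reassoc_of% (B.om_co A)]

theorem diag_co' (ha : B.mu A ≫ a = B.H.map a ≫ a) : diag a ≫ B.co A = B.H.map (B.xa A ≫ a) ≫ a := by
  rw [diag_co, ha, B.H.map_comp, Category.assoc]

theorem Hun_sigma_diag' (ha : B.mu A ≫ a = B.H.map a ≫ a) :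
    B.H.map (B.un A ≫ B.de A ≫ B.H.map a) ≫ diag a = B.de A ≫ B.H.map a := by
  rw [B.H.map_comp, Category.assoc, ← mu_sigma ha, reassoc_of% (B.Hun_mu A)]

/-- The mixed bimodule structure on the image of `Γ`. -/
def diagBimodule (ha : B.mu A ≫ a = B.H.map a ≫ a) (hip : i ≫ p = 𝟙 Y)
    (hpi : p ≫ i = B.un (B.H.obj A) ≫ diag a) : B.MixedBimodule where
  A := Y
  h := B.H.map i ≫ diag a ≫ p
  θ := i ≫ B.de A ≫ B.H.map p
  unit := by
    have h : B.un (B.H.obj A) ≫ diag a ≫ p = p := by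
      rw [← Category.assoc, ← hpi, Category.assoc, hip, Category.comp_id]
    rw [← reassoc_of% (B.un_nat i), h, hip]
  assoc := by
    have h := Hun_diag ha
    rw [← hpi] at h
    rw [← reassoc_of% (B.mu_nat i), reassoc_of% (diag_assoc ha)]
    simp only [B.H.map_comp, Category.assoc] at h ⊢
    rw [reassoc_of% h]
  counit := by
    rw [Category.assoc, Category.assoc, B.co_nat, reassoc_of% (B.de_co A), hip]
  coassoc := by
    have h := un_diag_de (B := B) (a := a)
    rw [← hpi, Category.assoc] at h
    have h1 := i ≫= h
    rw [reassoc_of% hip, B.H.map_comp] at h1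
    simp only [B.H.map_comp, Category.assoc]
    rw [← reassoc_of% h1, B.de_nat, reassoc_of% (B.de_coassoc A)]
  compat := by
    have h := un_diag_de (B := B) (a := a)
    rw [← hpi, Category.assoc] at h
    have h1 := i ≫= h
    rw [reassoc_of% hip, B.H.map_comp] at h1
    have h2 := diag_un_diag ha
    rw [← hpi] at h2
    have h3 := congrArg B.H.map h1
    simp only [B.H.map_comp, Category.assoc] at h3 ⊢
    rw [reassoc_of% h2, reassoc_of% (diag_de (B := B) (a := a)), ← reassoc_of% (B.om_nat i),
      ← reassoc_of% h3]

/-- The morphism from a cofree object to the image of `Γ` induced by `σ`. -/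
def sigmaHom (ha : B.mu A ≫ a = B.H.map a ≫ a) (hip : i ≫ p = 𝟙 Y)
    (hpi : p ≫ i = B.un (B.H.obj A) ≫ diag a) :
    B.Komega.obj A ⟶ diagBimodule ha hip hpi where
  f := B.de A ≫ B.H.map a ≫ p
  h := by
    have h1 := sigma_un_diag ha
    have h2 := mu_sigma ha
    have h4 : (B.de A ≫ B.H.map a ≫ p) ≫ i = B.de A ≫ B.H.map a := by
      rw [Category.assoc, Category.assoc, hpi]
      simpa only [Category.assoc] using h1
    show B.H.map (B.de A ≫ B.H.map a ≫ p) ≫ B.H.map i ≫ diag a ≫ p =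
      B.mu A ≫ B.de A ≫ B.H.map a ≫ p
    rw [← B.H.map_comp_assoc, h4, reassoc_of% h2]
  θ := by
    have h1 := sigma_un_diag ha
    have h4 : B.de A ≫ B.H.map a ≫ p ≫ i = B.de A ≫ B.H.map a := by
      rw [hpi]
      simpa only [Category.assoc] using h1
    have h3 := IsBaseAction.de_de (B := B) a
    show B.de A ≫ B.H.map (B.de A ≫ B.H.map a ≫ p) =
      (B.de A ≫ B.H.map a ≫ p) ≫ i ≫ B.de A ≫ B.H.map p
    simp only [Category.assoc] at h3 ⊢
    rw [reassoc_of% h4, ← reassoc_of% h3]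
    simp only [B.H.map_comp, Category.assoc]

/-- A morphism out of `K_ω(Z)` is fixed by its restriction to `Z`. A coinvariant of the image of `Γ`
has the form `σ(1⊗x)`, where `x` is found by applying `ε`. -/
theorem exists_factor_sigmaHom (ha : B.mu A ≫ a = B.H.map a ≫ a) (hip : i ≫ p = 𝟙 Y)
    (hpi : p ≫ i = B.un (B.H.obj A) ≫ diag a) (Z : C)
    (g : B.Komega.obj Z ⟶ diagBimodule ha hip hpi) :
    ∃ f : Z ⟶ A, B.Komega.map f ≫ sigmaHom ha hip hpi = g := by
  obtain ⟨g, hh, hθ⟩ := g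
  change B.H.obj Z ⟶ Y at g
  change B.H.map g ≫ B.H.map i ≫ diag a ≫ p = B.mu Z ≫ g at hh
  change B.de Z ≫ B.H.map g = g ≫ i ≫ B.de A ≫ B.H.map p at hθ
  refine ⟨B.un Z ≫ g ≫ i ≫ B.co A, hom_ext ?_⟩
  show B.H.map (B.un Z ≫ g ≫ i ≫ B.co A) ≫ B.de A ≫ B.H.map a ≫ p = g
  have hc := un_comp_coinvariant hh hθ =≫ B.H.map (i ≫ B.co A)
  have h2 := diag_un_diag ha
  rw [← hpi] at h2
  have hd := un_diag_de (B := B) (a := a)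
  rw [← hpi, Category.assoc] at hd
  have hd1 := i ≫= hd
  rw [reassoc_of% hip, B.H.map_comp] at hd1
  -- On the image of `Γ` the map `h⊗x ↦ ξ(h)x` coincides with `ε⊗1`.
  have hi : i ≫ B.xa A ≫ a = i ≫ B.co A := by
    have : i ≫ p ≫ i ≫ B.co A = i ≫ B.co A := by rw [reassoc_of% hip]
    rw [← this, reassoc_of% hpi, reassoc_of% (un_diag (B := B) (a := a)), B.co_nat,
      reassoc_of% (B.de_co A)]
  have hx : B.un Z ≫ g ≫ i =
      (B.un Z ≫ g ≫ i ≫ B.co A) ≫ B.un A ≫ B.de A ≫ B.H.map a := by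
    simp only [B.H.map_comp, Category.assoc] at hc
    rw [← reassoc_of% hd1, B.de_Hco, Category.comp_id] at hc
    rw [hc, ← hi]
    have h3 := B.un_nat (i ≫ B.xa A ≫ a)
    have h4 := B.de_nat (i ≫ B.xa A ≫ a)
    have h5 := h2 =≫ B.co A
    have h6 := congrArg (B.H.map) ((h5.trans (diag_co' ha)))
    simp only [B.H.map_comp, Category.assoc] at h3 h4 h6 ⊢
    rw [h6, reassoc_of% h3, reassoc_of% h4]
  have hg := eq_map_un_comp hh
  have h7 := Hun_sigma_diag' ha
  conv_rhs => rw [hg, ← B.H.map_comp_assoc, Category.assoc, hx, B.H.map_comp, Category.assoc,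
    reassoc_of% h7]

end

/-- Morphisms of mixed bimodules into `K_ω(A)` that are identified by `σ` are identified by the
idempotent `h⊗x ↦ h₁⊗ξ̄(h₂)x`. -/
theorem comp_baseIdem_eq_of_sigma {A Z : C} {a : B.H.obj A ⟶ A} (ha : B.mu A ≫ a = B.H.map a ≫ a)
    {b c : B.H.obj Z ⟶ B.H.obj A} (hb : B.H.map b ≫ B.mu A = B.mu Z ≫ b)
    (hb' : B.de Z ≫ B.H.map b = b ≫ B.de A) (hc : B.H.map c ≫ B.mu A = B.mu Z ≫ c)
    (hc' : B.de Z ≫ B.H.map c = c ≫ B.de A)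
    (h : b ≫ B.de A ≫ B.H.map a = c ≫ B.de A ≫ B.H.map a) :
    b ≫ B.de A ≫ B.H.map (B.xb A ≫ a) = c ≫ B.de A ≫ B.H.map (B.xb A ≫ a) := by
  have hr := IsBaseAction.of_action ha
  have h1 := un_comp_xb hb hb'
  have h2 := un_comp_xb hc hc'
  -- The counit turns `σ` into the action, and the restrictions to `Z` already lie in the image of
  -- `ξ̄`; so `b` and `c` have the same image under the base action there.
  have h3 := h =≫ B.co A
  simp only [Category.assoc, sigma_co] at h1 h2 h3
  rw [← map_un_comp hb hb' hr, ← map_un_comp hc hc' hr, reassoc_of% h1, reassoc_of% h2, h3]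

theorem isGalois_of_hasMonadicRightAdjoint [IsIdempotentComplete C]
    (h : HasMonadicRightAdjoint B.Komega) : B.IsGalois := by
  intro X
  have ha := (B.mu_assoc X).symm
  have hr := IsBaseAction.of_action ha
  obtain ⟨Y, i, p, hip, hpi⟩ := IsIdempotentComplete.idempotents_split _ _ (un_diag_idem ha)
  let E : B.Komega.obj (B.H.obj X) ⟶ B.Komega.obj (B.H.obj X) :=
    ⟨B.de (B.H.obj X) ≫ B.H.map (B.xb (B.H.obj X) ≫ B.mu X), hr.mu_de.symm,
      IsBaseAction.de_de _⟩
  obtain ⟨P, i', p', hip', hpi'⟩ := IsIdempotentComplete.idempotents_split _ E (hom_ext hr.idem)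
  have hp' : p' = E ≫ p' := by rw [← hpi', Category.assoc, hip', Category.comp_id]
  have ht := exists_factor_sigmaHom ha hip hpi
  have hσ : (B.de (B.H.obj X) ≫ B.H.map (B.mu X) ≫ p) ≫ i = B.sg X := by
    have h1 := sigma_un_diag ha
    rw [sg, Category.assoc, Category.assoc, hpi]
    simpa only [Category.assoc] using h1
  -- The projection onto the image of `E` respects every identification made by `σ`, so it descends
  -- to the image of `Γ`; there it inverts `σ`.
  obtain ⟨g, hg⟩ := (h.effective _ ht P).2 p' (fun Z b c hbc => by
    have hE : b ≫ E = c ≫ E := hom_ext (comp_baseIdem_eq_of_sigma ha (Hom.h b) (Hom.θ b) (Hom.h c)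
      (Hom.θ c) (by
        have h1 := congrArg Hom.f hbc =≫ i
        refine Eq.trans ?_ (h1.trans ?_)
        · exact (congrArg (fun t => Hom.f b ≫ t) hσ.symm).trans (Category.assoc _ _ _).symm
        · exact (Category.assoc _ _ _).trans (congrArg (fun t => Hom.f c ≫ t) hσ)))
    rw [hp', reassoc_of% hE])
  have hEt : E ≫ sigmaHom ha hip hpi = sigmaHom ha hip hpi := hom_ext (by
    have := E_sigma ha =≫ p
    simp only [Category.assoc] at this
    exact (Category.assoc _ _ _).trans this)
  have hid : g ≫ i' ≫ sigmaHom ha hip hpi = 𝟙 _ := by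
    apply (h.effective _ ht _).1
    rw [reassoc_of% hg, reassoc_of% hpi', hEt, Category.comp_id]
  obtain ⟨k, h1, h2⟩ : ∃ k : Y ⟶ B.H.obj (B.H.obj X),
      (B.de (B.H.obj X) ≫ B.H.map (B.mu X) ≫ p) ≫ k =
        B.de (B.H.obj X) ≫ B.H.map (B.xb (B.H.obj X) ≫ B.mu X) ∧
      k ≫ B.de (B.H.obj X) ≫ B.H.map (B.mu X) ≫ p = 𝟙 Y :=
    ⟨Hom.f (g ≫ i'), congrArg Hom.f ((reassoc_of% hg) i' |>.trans hpi'),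
      congrArg Hom.f ((Category.assoc _ _ _).trans hid)⟩
  refine ⟨p ≫ k, ?_, ?_⟩
  · rw [sg, Category.assoc, ← h1]
    simp only [Category.assoc]
  · rw [← hσ, ← hpi, Category.assoc]
    simp only [Category.assoc] at h2 ⊢
    rw [reassoc_of% h2]

end WeakBraidedBimonad

/-! ### Dualising the adjunctions and closing the circle -/

namespace WeakBraidedBimonad

section

variable {A : Type u} [Category.{v} A] {D : Type u'} [Category.{v'} D]

/-- If `K` has a comonadic left adjoint, then `Kᵒᵖ` has a monadic right adjoint. -/
theorem hasMonadicRightAdjoint_op {K : A ⥤ D} (h : HasComonadicLeftAdjoint K) :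
    HasMonadicRightAdjoint K.op := by
  obtain ⟨L, adj, hL⟩ := h
  refine ⟨L.op, adj.op, { faithful := ?_, full := ?_, essSurj := ?_ }⟩
  · constructor
    intro M N f g h
    have h1 : L.map f.unop = L.map g.unop :=
      Quiver.Hom.op_inj (congrArg Monad.Algebra.Hom.f h)
    exact Quiver.Hom.unop_inj
      ((Comonad.comparison adj).map_injective (Comonad.Coalgebra.Hom.ext h1))
  · constructor
    intro M N g
    let g' : (Comonad.comparison adj).obj N.unop ⟶ (Comonad.comparison adj).obj M.unop :=
      { f := g.f.unop
        h := Quiver.Hom.op_inj g.h }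
    refine ⟨((Comonad.comparison adj).preimage g').op, ?_⟩
    ext
    have := congrArg Comonad.Coalgebra.Hom.f ((Comonad.comparison adj).map_preimage g')
    exact congrArg Quiver.Hom.op this
  · constructor
    intro X
    let X' : adj.toComonad.Coalgebra :=
      { A := X.A.unop
        a := X.a.unop
        counit := Quiver.Hom.op_inj X.unit
        coassoc := Quiver.Hom.op_inj X.assoc }
    let e := (Comonad.comparison adj).objObjPreimageIso X'
    refine ⟨Opposite.op ((Comonad.comparison adj).objPreimage X'),
      ⟨(Monad.Algebra.isoMk ((adj.toComonad.forget.mapIso e).op) ?_).symm⟩⟩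
    exact Quiver.Hom.unop_inj e.hom.h

/-- Having a monadic right adjoint is invariant under equivalences of the target category. -/
theorem HasMonadicRightAdjoint.of_equivalence {D' : Type u'} [Category.{v'} D'] {K : A ⥤ D}
    (h : HasMonadicRightAdjoint K) (E : D ≌ D') {K' : A ⥤ D'} (i : K ⋙ E.functor ≅ K') :
    HasMonadicRightAdjoint K' := by
  obtain ⟨R, adj, hR⟩ := h
  let J := (Monad.comparison adj).asEquivalence
  -- Monadicity presents `K` as a free algebra functor followed by an equivalence, to which `E` can
  -- be appended.
  have e : adj.toMonad.free ⋙ J.inverse ≅ K :=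
    Functor.isoWhiskerRight (eqToIso (Monad.left_comparison adj)).symm J.inverse ≪≫
      Functor.associator _ _ _ ≪≫ Functor.isoWhiskerLeft K J.unitIso.symm ≪≫ K.rightUnitor
  exact hasMonadicRightAdjoint_of_equivalence adj.toMonad (J.symm.trans E)
    ((Functor.associator _ _ _).symm ≪≫ Functor.isoWhiskerRight e E.functor ≪≫ i)

end

variable {C : Type u} [Category.{v} C] (B : WeakBraidedBimonad C)

open MixedBimodule Opposite

/-- The mixed bimodule over `B` given by a mixed bimodule over `B.op`. -/
def mixedOfOp (M : B.op.MixedBimodule) : B.MixedBimodule where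
  A := M.A.unop
  h := M.θ.unop
  θ := M.h.unop
  unit := Quiver.Hom.op_inj M.counit
  assoc := Quiver.Hom.op_inj M.coassoc
  counit := Quiver.Hom.op_inj M.unit
  coassoc := Quiver.Hom.op_inj M.assoc
  compat := by
    have h := M.compat
    rw [op_om] at h
    exact (congrArg Quiver.Hom.unop h).trans (Category.assoc _ _ _)

/-- The mixed bimodule over `B.op` given by a mixed bimodule over `B`. -/
def opOfMixed (M : B.MixedBimodule) : B.op.MixedBimodule where
  A := Opposite.op M.A
  h := M.θ.op
  θ := M.h.op
  unit := Quiver.Hom.unop_inj M.counit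
  assoc := Quiver.Hom.unop_inj M.coassoc
  counit := Quiver.Hom.unop_inj M.unit
  coassoc := Quiver.Hom.unop_inj M.assoc
  compat := by
    rw [op_om]
    exact Quiver.Hom.unop_inj (M.compat.trans (Category.assoc _ _ _).symm)

/-- Mixed bimodules over `B.op` are the opposite of mixed bimodules over `B`. -/
def mixedOpEquivalence : B.op.MixedBimodule ≌ B.MixedBimoduleᵒᵖ where
  functor :=
    { obj M := Opposite.op (B.mixedOfOp M)
      map f := Quiver.Hom.op ⟨(Hom.f f).unop, congrArg Quiver.Hom.unop (Hom.θ f),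
        congrArg Quiver.Hom.unop (Hom.h f)⟩ }
  inverse :=
    { obj M := B.opOfMixed M.unop
      map f := ⟨(Hom.f f.unop).op, congrArg Quiver.Hom.op (Hom.θ f.unop),
        congrArg Quiver.Hom.op (Hom.h f.unop)⟩ }
  unitIso := Iso.refl _
  counitIso := Iso.refl _
  functor_unitIso_comp _ := Category.comp_id _

/-- The equivalence matches the comparison functors. -/
def komegaOpIso : B.op.Komega ⋙ B.mixedOpEquivalence.functor ≅ B.Komega.op := Iso.refl _

theorem hasMonadicRightAdjoint_Komega_op_iff :
    HasMonadicRightAdjoint B.op.Komega ↔ HasComonadicLeftAdjoint B.Komega := by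
  constructor
  · intro h
    exact hasComonadicLeftAdjoint_of_op (h.of_equivalence B.mixedOpEquivalence B.komegaOpIso)
  · intro h
    exact (hasMonadicRightAdjoint_op h).of_equivalence B.mixedOpEquivalence.symm
      (Functor.isoWhiskerRight B.komegaOpIso.symm _ ≪≫ Functor.associator _ _ _ ≪≫
        Functor.isoWhiskerLeft _ B.mixedOpEquivalence.unitIso.symm ≪≫ Functor.rightUnitor _)

variable {B} [IsIdempotentComplete C]

/-- For a weak braided Hopf monad the induction functor from modules over the base is an
equivalence, which turns the free module functor into `K_ω`. -/
theorem IsHopf.exists_equivalence (h : B.IsHopf) (S : NatSplitting B.xiBar) :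
    ∃ E : (B.xiMonad S).Algebra ≌ B.MixedBimodule,
      Nonempty ((B.xiMonad S).free ⋙ E.functor ≅ B.Komega) := by
  obtain ⟨s, hs⟩ := h
  obtain ⟨N⟩ := NatSplitting.nonempty_of_idem (baseIdem_idem S)
  have : N.obj.IsEquivalence :=
    { faithful := faithful_of_split N
      full := full_of_split N
      essSurj := essSurj_of_split N hs }
  exact ⟨N.obj.asEquivalence, ⟨freeIso N⟩⟩

/-- From an antipode the Galois condition is reached through the equivalence with base modules and
the monadic adjunction it provides. -/
theorem isHopf_iff_isGalois : B.IsHopf ↔ B.IsGalois := by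
  refine ⟨fun h => ?_, IsGalois.isHopf⟩
  obtain ⟨S⟩ : Nonempty (NatSplitting B.xiBar) := inferInstance
  obtain ⟨E, ⟨i⟩⟩ := h.exists_equivalence S
  exact isGalois_of_hasMonadicRightAdjoint (hasMonadicRightAdjoint_of_equivalence _ E i)

theorem isHopf_iff_hasMonadicRightAdjoint : B.IsHopf ↔ HasMonadicRightAdjoint B.Komega := by
  refine ⟨fun h => ?_, fun h => (isGalois_of_hasMonadicRightAdjoint h).isHopf⟩
  obtain ⟨S⟩ : Nonempty (NatSplitting B.xiBar) := inferInstance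
  obtain ⟨E, ⟨i⟩⟩ := h.exists_equivalence S
  exact hasMonadicRightAdjoint_of_equivalence _ E i

end WeakBraidedBimonad

theorem theorem7p9 {C : Type u} [Category.{v} C] [IsIdempotentComplete C]
    (B : WeakBraidedBimonad C)
    (S : NatSplitting B.xiBar) (SG : NatSplitting B.Gamma) (ST : NatSplitting B.GammaPrime) :
    HasCoequalizer (B.rhoRightH S) (B.HrhoLeft S) ∧
    HasEqualizer (B.thetaRightH S) (B.HthetaLeft S) ∧
    (PreservesColimitsOfShape WalkingParallelPair B.H →
      ∀ (c : Cofork (B.rhoRightH S) (B.HrhoLeft S)) (hc : IsColimit c),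
        List.TFAE [B.IsHopf,
          WeakBraidedBimonad.HasMonadicRightAdjoint B.Komega,
          IsIso (B.gamma S SG c hc)]) ∧
    (PreservesLimitsOfShape WalkingParallelPair B.H →
      ∀ (c : Fork (B.thetaRightH S) (B.HthetaLeft S)) (hc : IsLimit c),
        List.TFAE [B.IsHopf,
          WeakBraidedBimonad.HasComonadicLeftAdjoint B.Komega,
          IsIso (B.gamma' S ST c hc)]) ∧
    (B.IsHopf → Nonempty ((B.xiMonad S).Algebra ≌ B.MixedBimodule)) := by
  refine ⟨WeakBraidedBimonad.hasCoequalizer_rho S, WeakBraidedBimonad.hasEqualizer_theta S,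
    fun _ c hc => ?_, fun _ c hc => ?_, fun h => ?_⟩
  · tfae_have 1 ↔ 2 := WeakBraidedBimonad.isHopf_iff_hasMonadicRightAdjoint
    tfae_have 1 ↔ 3 := WeakBraidedBimonad.isHopf_iff_isGalois.trans
      (WeakBraidedBimonad.isIso_gamma_iff S SG hc).symm
    tfae_finish
  · tfae_have 1 ↔ 2 := B.isHopf_op.symm.trans
      (WeakBraidedBimonad.isHopf_iff_hasMonadicRightAdjoint.trans
        B.hasMonadicRightAdjoint_Komega_op_iff)
    tfae_have 1 ↔ 3 := B.isHopf_op.symm.trans (WeakBraidedBimonad.isHopf_iff_isGalois.trans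
      (WeakBraidedBimonad.isIso_gamma'_iff S ST hc).symm)
    tfae_finish
  · obtain ⟨E, -⟩ := h.exists_equivalence S
    exact ⟨E⟩
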